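/- Let $(W,S)$ be a Coxeter system with $S$ finite and Coxeter matrix $(m_{st})$ which is even, i.e. $m_{st}$ is even or infinite for $s\neq t$. For $T\subseteq S$ let $W_T$ be the subgroup generated by $T$; $T$ is spherical if $W_T$ is finite. The nerve $L$ is the simplicial complex with vertex set $S$ whose simplices are the non-empty spherical subsets. Assume that $L$ is a flag triangulation of $S^{n-1}$ in which the link of every simplex with $k$ vertices is a triangulation of $S^{n-1-k}$ (with $S^{-1}=\emptyset$; this is automatic for PL triangulations). The Davis complex $\Sigma(W,S)$ is the geometric realization of the poset of all spherical cosets $wW_T$ ($w\in W$, $T$ spherical), ordered by inclusion; the cosets contained in $wW_T$ span the closed Coxeter cell $wW_T$ of type $T$, and the cosets $W_T$ ($T$ spherical) span the fundamental domain $K$. Fix $t\in S$ and put $U=\{s\in S: m_{st}<\infty\}$, $S'=\{s\in U: m_{st}>2\}$ and, for $s\in S'$, $U_{st}=\{r\in S: m_{rt}=m_{rs}=2\}$. Let $\Omega\subseteq\Sigma(W,S)$ be the union of the closed Coxeter cells $wW_T$ with $w\in W_U$, $T$ spherical and $t\in T$, and let $K(U)=K\cap\Omega$. For $V,T\subseteq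 S$ let $g_{VT}:W_V\to W_T$ be the homomorphism that fixes the generators in $V\cap T$ and sends those in $V\setminus T$ to $e$. The set of colors is $A=\prod_T W_T/W_{T\setminus\{t\}}$, the product over the spherical $T$ containing $t$; $W_U$ acts on $A$ by $w\cdot (v_TW_{T\setminus\{t\}})_T=(g_{UT}(w)v_TW_{T\setminus\{t\}})_T$, and the color of $w\in W_U$ is $c(w)=w\cdot\bar e$, where $\bar e$ is the family of trivial cosets. A vertex $w\in W_U$ is even if $g_{U\{t\}}(w)=e$, and a color is even if it is the color of an even vertex. The boundary collar containing the vertex $w\in W_U$ is $\bigcup_{v\in wW_{U\setminus\{t\}}}vK(U)$, and for $c\in A$ the $c$-collar $F_c$ is the union of the boundary collars containing the vertices $w\in W_U$ with $c(w)=c$. Then: (1) if $c\neq c'$ are even colors, then $F_c\cap F_{c'}$ is a (possibly empty) disjoint union of connected topological $(n-2)$-manifolds, each open in $F_c\cap F_{c'}$, and each a copy of the Davis complex $\Sigma(W_{U_{st}},U_{st})$ for some $s\in S'$; if $n\geq 3$, each of them is infinite, i.e. non-compact; (2) more generally, if $c_1,\dots,c_k$ and $c_e$ are even colors with $c_e\neq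 c_j$ for all $j$, then $F_{c_e}\cap\bigcup_{j=1}^k F_{c_j}$ is a disjoint union of the same kind. Here a copy of $\Sigma(W_{U_{st}},U_{st})$ is a subcomplex of $\Sigma(W,S)$ that is homeomorphic to it and is spanned by a set of spherical cosets which is isomorphic, as a poset, to the poset of spherical cosets of $(W_{U_{st}},U_{st})$. -/

import Mathlib

open scoped Pointwise

noncomputable section

/-! ## Simplicial complexes and their geometric realization -/

namespace PreAbstractSimplicialComplex

variable {V : Type*}

/-- The geometric realization of an abstract simplicial complex: all systems of barycentric
coordinates `f : V → ℝ` whose support is a face. It is a subset of `V → ℝ` and carries the subspace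
topology (convergence of the barycentric coordinates). All complexes below are locally finite,
and for these this is the same topology as the weak (coherent) one. -/
def realization (K : PreAbstractSimplicialComplex V) : Set (V → ℝ) :=
  {f | (∀ v, 0 ≤ f v) ∧ ∃ σ ∈ K.faces, Function.support f = (σ : Set V) ∧ ∑ v ∈ σ, f v = 1}

/-- The link of a (possibly empty) face `σ`; the link of `∅` is `K` itself. -/
def link (K : PreAbstractSimplicialComplex V) (σ : Finset V) : PreAbstractSimplicialComplex V where
  faces := {τ | τ.Nonempty ∧ Disjoint τ σ ∧ ∃ ρ ∈ K.faces, τ ⊆ ρ ∧ σ ⊆ ρ}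
  isRelLowerSet_faces := by
    rintro τ ⟨hne, hd, ρ, hρ, h1, h2⟩
    exact ⟨hne, fun τ' hle hne' =>
      ⟨hne', Finset.disjoint_of_subset_left hle hd, ρ, hρ, hle.trans h1, h2⟩⟩

/-- A flag complex: any nonempty finite set of pairwise connected vertices spans a simplex. -/
def IsFlag (K : PreAbstractSimplicialComplex V) : Prop :=
  ∀ σ : Finset V, σ.Nonempty →
    (∀ u ∈ σ, ∀ v ∈ σ, ∃ ρ ∈ K.faces, u ∈ ρ ∧ v ∈ ρ) → σ ∈ K.faces

/-- `K` is a triangulation of the sphere `S^(n-1)`, the links of simplices being triangulations of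
spheres as well: the realization of `K` is homeomorphic to `S^(n-1)` (the case `σ = ∅`), and the
realization of the link of every simplex with `k` vertices is homeomorphic to `S^(n-1-k)`.
Here `S^(d-1)` is the unit sphere of `ℝ^d`, so that `S^(-1)` is empty. -/
def IsSphereTriangulation (K : PreAbstractSimplicialComplex V) (n : ℕ) : Prop :=
  ∀ σ : Finset V, (σ = ∅ ∨ σ ∈ K.faces) → ∃ d : ℕ, d + σ.card = n ∧
    Nonempty ((K.link σ).realization ≃ₜ Metric.sphere (0 : EuclideanSpace ℝ (Fin d)) 1)

end PreAbstractSimplicialComplex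

/-- The complex of nonempty finite chains of a poset `P` all of whose elements lie in `Q`. Its
realization is the geometric realization of the subposet `Q`, as a subspace of that of `P`. -/
def chainComplex {P : Type*} [PartialOrder P] (Q : Set P) : PreAbstractSimplicialComplex P where
  faces := {σ | σ.Nonempty ∧ (σ : Set P) ⊆ Q ∧ IsChain (· ≤ ·) (σ : Set P)}
  isRelLowerSet_faces := by
    rintro σ ⟨hne, hQ, hc⟩
    exact ⟨hne, fun τ hle hne' =>
      ⟨hne', (Finset.coe_subset.2 hle).trans hQ, hc.mono (Finset.coe_subset.2 hle)⟩⟩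

/-! ## Spherical cosets, nerve and Davis complex

These are defined for a group `W` with a family of generators `gen : S → W`, so that they apply both
to a Coxeter system `(W, S)` and to its subsystems `(W_V, V)`. -/

namespace Davis

section General

variable {W S : Type*} [Group W]

/-- The subgroup `W_T` generated by `T ⊆ S`. -/
def parabolic (gen : S → W) (T : Set S) : Subgroup W := Subgroup.closure (gen '' T)

/-- `T` is spherical if `W_T` is finite. -/
def IsSpherical (gen : S → W) (T : Set S) : Prop := Finite (parabolic gen T)

theorem IsSpherical.mono {gen : S → W} {T T' : Set S} (h : IsSpherical gen T) (hT : T' ⊆ T) :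
    IsSpherical gen T' := by
  have hle : parabolic gen T' ≤ parabolic gen T := Subgroup.closure_mono (Set.image_mono hT)
  have hfin : Finite (parabolic gen T) := h
  exact Finite.of_injective _ (Subgroup.inclusion_injective hle)

/-- The nerve: a nonempty finite `T ⊆ S` spans a simplex if and only if it is spherical. -/
def nerve (gen : S → W) : PreAbstractSimplicialComplex S where
  faces := {T | T.Nonempty ∧ IsSpherical gen (T : Set S)}
  isRelLowerSet_faces := by
    rintro T ⟨hne, hT⟩
    exact ⟨hne, fun T' hle hne' => ⟨hne', hT.mono (Finset.coe_subset.2 hle)⟩⟩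

/-- The set of spherical cosets `w W_T`, as subsets of `W`. As a subtype of `Set W` it is a poset
under inclusion. -/
abbrev SphericalCoset (gen : S → W) : Type _ :=
  {C : Set W // ∃ (w : W) (T : Set S), IsSpherical gen T ∧ C = w • (parabolic gen T : Set W)}

/-- The coset `w W_T` for spherical `T`. -/
def coset (gen : S → W) (w : W) (T : Set S) (hT : IsSpherical gen T) : SphericalCoset gen :=
  ⟨w • (parabolic gen T : Set W), w, T, hT, rfl⟩

/-- Left translation of spherical cosets by an element of `W`. -/
def translate {gen : S → W} (w : W) (C : SphericalCoset gen) : SphericalCoset gen :=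
  ⟨w • C.1, by
    obtain ⟨v, T, hT, hC⟩ := C.2
    exact ⟨w * v, T, hT, by rw [hC, smul_smul]⟩⟩

/-- The Davis complex: its realization is the geometric realization of the poset of all spherical
cosets. -/
def davisComplex (gen : S → W) : PreAbstractSimplicialComplex (SphericalCoset gen) :=
  chainComplex Set.univ

/-- The fundamental domain `K`, spanned by the `W_T` with `T` spherical. -/
def fundamentalDomain (gen : S → W) : PreAbstractSimplicialComplex (SphericalCoset gen) :=
  chainComplex {C | ∃ (T : Set S) (hT : IsSpherical gen T), C = coset gen 1 T hT}

/-- The closed Coxeter cell `C = w W_T` (of type `T`), subdivided: the realization of the poset of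
spherical cosets contained in `w W_T`. -/
def closedCell {gen : S → W} (C : SphericalCoset gen) :
    PreAbstractSimplicialComplex (SphericalCoset gen) :=
  chainComplex (Set.Iic C)

/-- The generators of the subsystem `(W_V, V)`. -/
def subGen (gen : S → W) (V : Set S) (r : V) : parabolic gen V :=
  ⟨gen r, Subgroup.subset_closure (Set.mem_image_of_mem gen r.2)⟩

end General

/-! ## One-letter ruins, colors and collars -/

section Coxeter

variable {S W : Type*} [Group W] {M : CoxeterMatrix S} (cs : CoxeterSystem M W)

/-- An even Coxeter matrix: off-diagonal entries are even or infinite (`∞` is encoded by `0`). -/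
def IsEvenMatrix (M : CoxeterMatrix S) : Prop := ∀ s t : S, s ≠ t → M s t = 0 ∨ Even (M s t)

/-- `U = {s | m_st < ∞}`. -/
def starSet (M : CoxeterMatrix S) (t : S) : Set S := {s | M s t ≠ 0}

/-- `S' = {s ∈ U | m_st > 2}`. -/
def bigSet (M : CoxeterMatrix S) (t : S) : Set S := {s ∈ starSet M t | 2 < M s t}

/-- `U_st = {r | m_rt = m_rs = 2}`. -/
def commSet (M : CoxeterMatrix S) (s t : S) : Set S := {r | M r t = 2 ∧ M r s = 2}

/-- The subcomplex `Ω`: the path component of the one-letter ruin `Ω(S,t)` (the union of the closed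
Coxeter cells whose type contains `t`) with vertex set `W_U`, that is, the union of the closed
cells `w W_T` with `t ∈ T` and `w ∈ W_U`. -/
def ruin (t : S) : PreAbstractSimplicialComplex (SphericalCoset cs.simple) :=
  ⨆ (w : parabolic cs.simple (starSet M t)) (T : Set S) (hT : IsSpherical cs.simple T)
    (_ : t ∈ T), closedCell (coset cs.simple w T hT)

/-- `K(U) = K ∩ Ω`. -/
def ruinDomain (t : S) : PreAbstractSimplicialComplex (SphericalCoset cs.simple) :=
  fundamentalDomain cs.simple ⊓ ruin cs t

open Classical in
/-- The translate `w K(U)`. -/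
def ruinChamber (t : S) (w : W) : PreAbstractSimplicialComplex (SphericalCoset cs.simple) :=
  (ruinDomain cs t).map (translate w)

/-- The boundary collar containing the vertex `w ∈ W_U`. The component `B` of `∂Ω` containing `w` has
vertex set `w W_{U-t}`, and the collar is the union of the `v K(U)` over the vertices `v` of `B`. -/
def boundaryCollar (t : S) (w : parabolic cs.simple (starSet M t)) :
    PreAbstractSimplicialComplex (SphericalCoset cs.simple) :=
  ⨆ v ∈ (w : W) • (parabolic cs.simple (starSet M t \ {t}) : Set W), ruinChamber cs t v

open Classical in
theorem retraction_liftable (hM : IsEvenMatrix M) (T : Set S) :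
    M.IsLiftable (fun s : S => if h : s ∈ T then subGen cs.simple T ⟨s, h⟩ else 1) := by
  have hpow : ∀ i i', i ≠ i' → ∀ j, cs.simple j ^ M i i' = 1 := by
    intro i i' hne j
    rcases hM i i' hne with h | ⟨k, hk⟩
    · simp [h]
    · rw [hk, ← two_mul, pow_mul, cs.simple_sq, one_pow]
  intro i i'
  apply Subtype.ext
  by_cases hi : i ∈ T <;> by_cases hi' : i' ∈ T
  · simp [hi, hi', subGen]
  · have hne : i ≠ i' := fun h => hi' (h ▸ hi)
    simp [hi, hi', subGen, hpow i i' hne]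
  · have hne : i ≠ i' := fun h => hi (h ▸ hi')
    simp [hi, hi', subGen, hpow i i' hne]
  · simp [hi, hi']

open Classical in
/-- The homomorphism `g_{VT} : W_V → W_T` of an even Coxeter system that fixes the generators in
`V ∩ T` and kills those in `V - T`. -/
def g (hM : IsEvenMatrix M) (V T : Set S) :
    parabolic cs.simple V →* parabolic cs.simple T :=
  (cs.lift ⟨_, retraction_liftable cs hM T⟩).comp (parabolic cs.simple V).subtype

/-- The set of colors `A`, the product of the coset spaces `W_T / W_{T-t}` over the spherical `T`
that contain `t`. -/
abbrev Color (t : S) : Type _ :=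
  (T : {T : Set S // IsSpherical cs.simple T ∧ t ∈ T}) →
    parabolic cs.simple T.1 ⧸
      (parabolic cs.simple (T.1 \ {t})).subgroupOf (parabolic cs.simple T.1)

/-- The diagonal action of `W_U` on `A`, given by `w · v W_{T-t} = g_{UT}(w) v W_{T-t}`. -/
def act (hM : IsEvenMatrix M) (t : S) (w : parabolic cs.simple (starSet M t)) (a : Color cs t) :
    Color cs t :=
  fun T => g cs hM (starSet M t) T.1 w • a T

/-- The color `c(w) = w · ē` of the vertex `w ∈ W_U`; here `ē` consists of the trivial cosets. -/
def color (hM : IsEvenMatrix M) (t : S) (w : parabolic cs.simple (starSet M t)) : Color cs t :=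
  act cs hM t w (fun _ => QuotientGroup.mk 1)

/-- A vertex `w ∈ W_U` is even if `g_{U,{t}}(w) = e`. -/
def IsEvenVertex (hM : IsEvenMatrix M) (t : S) (w : parabolic cs.simple (starSet M t)) : Prop :=
  g cs hM (starSet M t) {t} w = 1

/-- A color is even if it is the color of an even vertex. -/
def IsEvenColor (hM : IsEvenMatrix M) (t : S) (c : Color cs t) : Prop :=
  ∃ w, IsEvenVertex cs hM t w ∧ color cs hM t w = c

/-- The `c`-collar `F_c`, the union of the boundary collars of color `c`. -/
def collar (hM : IsEvenMatrix M) (t : S) (c : Color cs t) :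
    PreAbstractSimplicialComplex (SphericalCoset cs.simple) :=
  ⨆ (w : parabolic cs.simple (starSet M t)) (_ : color cs hM t w = c), boundaryCollar cs t w

/-- `F_c` as a subspace of the realization of the Davis complex. -/
def collarSpace (hM : IsEvenMatrix M) (t : S) (c : Color cs t) :
    Set (SphericalCoset cs.simple → ℝ) :=
  (collar cs hM t c).realization

/-- `C` is a copy of the Davis complex of `(W_V, V)`: it is a subcomplex of the Davis complex of
`(W, S)`, spanned by a set `Q` of spherical cosets which as a poset is isomorphic to the poset of
spherical cosets of `(W_V, V)`; and it is homeomorphic to the Davis complex of `(W_V, V)`. -/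
def IsDavisCopy (V : Set S) (C : Set (SphericalCoset cs.simple → ℝ)) : Prop :=
  (∃ Q : Set (SphericalCoset cs.simple), C = (chainComplex Q).realization ∧
    Nonempty (Q ≃o SphericalCoset (subGen cs.simple V))) ∧
  Nonempty (C ≃ₜ (davisComplex (subGen cs.simple V)).realization)

/-- `X` is the disjoint union of (relatively open) subspaces `C`, each of which is a connected
topological manifold of dimension `n - 2`, is a copy of the Davis complex of `(W_{U_st}, U_st)` for
some `s ∈ S'`, and is infinite (noncompact) as soon as `n ≥ 3`. -/
def IsDisjointUnionOfDavisManifolds (t : S) (n : ℕ) (X : Set (SphericalCoset cs.simple → ℝ)) :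
    Prop :=
  ∃ 𝒞 : Set (Set (SphericalCoset cs.simple → ℝ)),
    ⋃₀ 𝒞 = X ∧ 𝒞.PairwiseDisjoint id ∧
    ∀ C ∈ 𝒞,
      (∃ O, IsOpen O ∧ C = X ∩ O) ∧
      (∃ s ∈ bigSet M t, IsDavisCopy cs (commSet M s t) C) ∧
      ConnectedSpace C ∧ T2Space C ∧ SecondCountableTopology C ∧
      (∃ d : ℕ, d + 2 = n ∧ Nonempty (ChartedSpace (EuclideanSpace ℝ (Fin d)) C)) ∧
      (3 ≤ n → NoncompactSpace C)

end Coxeter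

end Davis

end

/-! Everything is computed in the poset of spherical cosets. The collar of color c is the
realization of the subposet `collarSet` of cosets that have type inside U and contain a vertex of
color c (`collar_eq_chainComplex`). The least coset of a chain hands its colored vertex to all
others, so the intersection of a collar with a union of collars is again the realization of a
subposet (`collarSpace_inter_iUnion`).

Let a coset of type T contain vertices v and v' of different even colors. The element v⁻¹v' of W_T
dies in W_{t} and does not lie in W_{T-t}, whose elements preserve colors. If t were absent from T
or commuted with T-t, this would be impossible; so T contains t and some s in S'
(`exists_mem_bigSet`). In a finite even Coxeter group no generator lies on two edges with label
above 2 (`IsSpherical.eq_two`). Hence s is unique and T is contained in {s,t} ∪ U_st. The cosets of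
the intersection therefore fall into the sets `piece`. These are closed under comparability inside
the intersection, hence disjoint and open, and a piece that meets the intersection lies in it.
Because W_{U_st} commutes with W_{s,t}, cutting a piece with vW_{U_st} identifies it with the poset
of spherical cosets of W_{U_st} (`exists_orderIso_piece`).

It remains to see that the Davis complex of W_{U_st} is a connected manifold. By flagness the nerve
of U_st is the link of {s,t}, a triangulated S^(n-3) (`isSphereTriangulation_commSet`). In general,
let the nerve triangulate S^(m-1). The open star of wW_T is open in the cone of weights on chains of
comparable cosets. The map `localMap` identifies this cone with ℝ^T times the cone over the link of
T, that is, with ℝ^m: smaller cosets subdivide ℝ^T as the chambers of W_T do, and larger ones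
subdivide the cone over the link (`injOn_localMap`, `range_localMap`). This rests on the dual
geometric representation, in which the closed chamber is a strict fundamental domain
(`dualRep_fundamental`) and a finite W_T moves every vector into it (`exists_dualRep_nonneg`).
Non-compactness holds because a finite Coxeter group has a full simplex as nerve
(`infinite_of_isSphereTriangulation`). -/

open scoped Pointwise

noncomputable section

namespace Davis

/-! ## The dual geometric representation -/

section Representation

variable {S W : Type*} [Group W] {M : CoxeterMatrix S} (cs : CoxeterSystem M W)

/-- The entries `2 cos (π / m_st)`, with the value `2` for `m_st = ∞` and `-2` for `s = t`. -/
def cosEntry (M : CoxeterMatrix S) (s t : S) : ℝ := 2 * Real.cos (Real.pi / M s t)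

/-- The vector `u_s` such that the simple reflection acts by `x ↦ x + x_s u_s`. -/
def simpleVector (M : CoxeterMatrix S) (s : S) : S → ℝ := fun r => cosEntry M s r

theorem cosEntry_self (M : CoxeterMatrix S) (s : S) : cosEntry M s s = -2 := by
  simp [cosEntry]

theorem cosEntry_comm (M : CoxeterMatrix S) (s t : S) : cosEntry M s t = cosEntry M t s := by
  rw [cosEntry, cosEntry, M.symmetric]

theorem cosEntry_of_two {M : CoxeterMatrix S} {s t : S} (h : M s t = 2) : cosEntry M s t = 0 := by
  simp [cosEntry, h]

theorem cosEntry_of_zero {M : CoxeterMatrix S} {s t : S} (h : M s t = 0) : cosEntry M s t = 2 := by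
  simp [cosEntry, h]

theorem IsEvenMatrix.two_le {M : CoxeterMatrix S} (hM : IsEvenMatrix M) {s t : S} (hst : s ≠ t)
    (h : M s t ≠ 0) : 2 ≤ M s t := by
  rcases hM s t hst with h' | ⟨k, hk⟩ <;> omega

theorem cosEntry_nonneg {M : CoxeterMatrix S} (hM : IsEvenMatrix M) {s t : S} (hst : s ≠ t) :
    0 ≤ cosEntry M s t := by
  by_cases h : M s t = 0
  · simp [cosEntry_of_zero h]
  · have h2 : (2 : ℝ) ≤ M s t := by exact_mod_cast hM.two_le hst h
    have : Real.pi / M s t ≤ Real.pi / 2 := by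
      gcongr
    refine mul_nonneg (by norm_num) (Real.cos_nonneg_of_mem_Icc ⟨?_, this⟩)
    have : 0 ≤ Real.pi / M s t := by positivity
    linarith [Real.pi_pos]

theorem sqrt_two_le_cosEntry {M : CoxeterMatrix S} (hM : IsEvenMatrix M) {s t : S} (hst : s ≠ t)
    (h2 : M s t ≠ 2) : √2 ≤ cosEntry M s t := by
  have hsq : √2 * √2 = 2 := Real.mul_self_sqrt (by norm_num)
  by_cases h : M s t = 0
  · rw [cosEntry_of_zero h]; nlinarith [Real.sqrt_nonneg 2]
  · have h4 : 4 ≤ M s t := by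
      rcases hM s t hst with h' | ⟨k, hk⟩ <;> omega
    have h4 : (4 : ℝ) ≤ M s t := by exact_mod_cast h4
    have : Real.cos (Real.pi / 4) ≤ Real.cos (Real.pi / M s t) := by
      apply Real.cos_le_cos_of_nonneg_of_le_pi (by positivity)
      · linarith [Real.pi_pos]
      · gcongr
    rw [Real.cos_pi_div_four] at this
    rw [cosEntry]
    linarith

theorem reflection_aux (M : CoxeterMatrix S) (s : S) :
    (LinearMap.proj s : (S → ℝ) →ₗ[ℝ] ℝ) (-simpleVector M s) = 2 := by
  simp [simpleVector, cosEntry_self]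

/-- The simple reflection of the dual geometric representation, `x ↦ x + x_s u_s`. -/
def dualReflection (M : CoxeterMatrix S) (s : S) : (S → ℝ) ≃ₗ[ℝ] (S → ℝ) :=
  Module.reflection (reflection_aux M s)

theorem dualReflection_apply (M : CoxeterMatrix S) (s : S) (x : S → ℝ) :
    dualReflection M s x = x + x s • simpleVector M s := by
  simp [dualReflection, Module.reflection_apply]

theorem dualReflection_sq (M : CoxeterMatrix S) (s : S) :
    dualReflection M s * dualReflection M s = 1 := by
  ext1 x
  exact Module.involutive_reflection (reflection_aux M s) x

/-- Powers of a product of two reflections are governed by Chebyshev polynomials. For m_st = 2k the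
relevant value is S_(k-1)(2 cos(π/k)) = sin π / sin(π/k) = 0. -/
theorem dualReflection_isLiftable {M : CoxeterMatrix S} (hM : IsEvenMatrix M) :
    M.IsLiftable (dualReflection M) := by
  intro s t
  by_cases hst : s = t
  · subst hst; rw [dualReflection_sq, one_pow]
  rcases hM s t hst with h | ⟨k, hk⟩
  · rw [h, pow_zero]
  have hcs : cosEntry M t s = cosEntry M s t := cosEntry_comm M t s
  ext1 x
  by_cases hk0 : k = 0
  · simp [hk, hk0]
  -- For k = 1 the denominator sin(π/k) vanishes, so the commuting case is checked by hand.
  by_cases hk1 : k = 1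
  · have h2 : M s t = 2 := by omega
    have h0 := cosEntry_of_two h2
    rw [h2, pow_two]
    simp only [LinearEquiv.mul_apply, dualReflection_apply, LinearEquiv.coe_one, id_eq]
    ext r
    simp [simpleVector, hcs, h0, cosEntry_self]
    ring
  set c := cosEntry M s t with hc
  have key := Module.reflection_mul_reflection_pow_apply (reflection_aux M s) (reflection_aux M t)
    (M s t) x (c * c - 2) (by simp [simpleVector, hcs, ← hc])
  have hS : (Polynomial.Chebyshev.S ℝ ((k : ℤ) - 1)).eval (c * c - 2) = 0 := by
    have hk2 : 2 ≤ k := by omega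
    have hk2' : (2 : ℝ) ≤ k := by exact_mod_cast hk2
    have hcc : c * c - 2 = 2 * Real.cos (Real.pi / k) := by
      have : Real.pi / k = 2 * (Real.pi / M s t) := by
        rw [hk]; push_cast; field_simp; ring
      rw [this, Real.cos_two_mul, hc, cosEntry]; ring
    have h1 := Polynomial.Chebyshev.S_two_mul_real_cos (Real.pi / k) ((k : ℤ) - 1)
    rw [hcc]
    have hsin : Real.sin (Real.pi / k) ≠ 0 := by
      apply (Real.sin_pos_of_pos_of_lt_pi (by positivity) _).ne'
      rw [div_lt_iff₀ (by positivity)]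
      nlinarith [Real.pi_pos]
    have h2 : (((k : ℤ) - 1 : ℤ) + 1 : ℝ) * (Real.pi / k) = Real.pi := by
      push_cast; field_simp; ring
    rw [h2, Real.sin_pi] at h1
    exact (mul_eq_zero.1 h1).resolve_right hsin
  have e1 : ((M s t : ℤ) - 2) / 2 = (k : ℤ) - 1 := by omega
  have e2 : ((M s t : ℤ) - 1) / 2 = (k : ℤ) - 1 := by omega
  rw [e1, e2, hS] at key
  simpa [dualReflection] using key

/-- The dual of the geometric representation of an even Coxeter system. -/
def dualRep (hM : IsEvenMatrix M) : W →* ((S → ℝ) ≃ₗ[ℝ] (S → ℝ)) :=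
  cs.lift ⟨dualReflection M, dualReflection_isLiftable hM⟩

theorem dualRep_simple (hM : IsEvenMatrix M) (s : S) (x : S → ℝ) :
    dualRep cs hM (cs.simple s) x = x + x s • simpleVector M s := by
  rw [dualRep, cs.lift_apply_simple, dualReflection_apply]

theorem dualRep_simple_apply (hM : IsEvenMatrix M) (s : S) (x : S → ℝ) (r : S) :
    dualRep cs hM (cs.simple s) x r = x r + x s * cosEntry M s r := by
  simp [dualRep_simple, simpleVector]

theorem dualRep_simple_self (hM : IsEvenMatrix M) (s : S) (x : S → ℝ) :
    dualRep cs hM (cs.simple s) x s = - x s := by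
  rw [dualRep_simple_apply, cosEntry_self]; ring

theorem dualRep_simple_of_eq_zero (hM : IsEvenMatrix M) {s : S} {x : S → ℝ} (h : x s = 0) :
    dualRep cs hM (cs.simple s) x = x := by
  simp [dualRep_simple, h]

theorem dualRep_mul_apply (hM : IsEvenMatrix M) (w v : W) (x : S → ℝ) :
    dualRep cs hM (w * v) x = dualRep cs hM w (dualRep cs hM v x) := by
  rw [map_mul, LinearEquiv.mul_apply]

/-! ### Parabolic subgroups -/

variable {G I : Type*} [Group G]

theorem gen_mem_parabolic {gen : I → G} {T : Set I} {s : I} (hs : s ∈ T) :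
    gen s ∈ parabolic gen T :=
  Subgroup.subset_closure (Set.mem_image_of_mem gen hs)

theorem parabolic_mono {gen : I → G} {T T' : Set I} (h : T ⊆ T') :
    parabolic gen T ≤ parabolic gen T' :=
  Subgroup.closure_mono (Set.image_mono h)

theorem parabolic_empty (gen : I → G) : parabolic gen ∅ = ⊥ := by
  simp [parabolic]

theorem parabolic_induction {T : Set S} {p : W → Prop} {w : W} (hw : w ∈ parabolic cs.simple T)
    (one : p 1)
    (mul : ∀ s ∈ T, ∀ v ∈ parabolic cs.simple T, p v → p (cs.simple s * v)) : p w := by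
  refine Subgroup.closure_induction_left (p := fun x _ => p x) one ?_ ?_ hw
  · rintro _ ⟨s, hs, rfl⟩ y hy h
    exact mul s hs y hy h
  · rintro _ ⟨s, hs, rfl⟩ y hy h
    rw [cs.inv_simple]
    exact mul s hs y hy h

/-- A reflection s in T reads only the coordinate s, so W_T acts on the coordinates in T
independently of the others. -/
theorem dualRep_congr (hM : IsEvenMatrix M) {T : Set S} {w : W} (hw : w ∈ parabolic cs.simple T)
    {x y : S → ℝ} (h : ∀ s ∈ T, x s = y s) :
    ∀ s ∈ T, dualRep cs hM w x s = dualRep cs hM w y s := by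
  refine parabolic_induction cs
    (p := fun w => ∀ s ∈ T, dualRep cs hM w x s = dualRep cs hM w y s) hw (by simpa using h) ?_
  intro s hs v _ ih r hr
  rw [dualRep_mul_apply, dualRep_mul_apply, dualRep_simple_apply, dualRep_simple_apply, ih r hr,
    ih s hs]

theorem dualRep_eq_self (hM : IsEvenMatrix M) {T : Set S} {w : W} (hw : w ∈ parabolic cs.simple T)
    {x : S → ℝ} (h : ∀ s ∈ T, x s = 0) : dualRep cs hM w x = x := by
  refine parabolic_induction cs (p := fun w => dualRep cs hM w x = x) hw (by simp) ?_
  intro s hs v _ ih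
  rw [dualRep_mul_apply, ih, dualRep_simple_of_eq_zero cs hM (h s hs)]

/-- For s outside T the basis vector e_s is fixed by W_T, but s negates its coordinate s. -/
theorem simple_mem_parabolic_iff (hM : IsEvenMatrix M) {T : Set S} {s : S} :
    cs.simple s ∈ parabolic cs.simple T ↔ s ∈ T := by
  classical
  refine ⟨fun h => ?_, gen_mem_parabolic⟩
  by_contra hs
  have h1 := dualRep_eq_self cs hM h (x := Pi.single s 1)
    (fun r hr => by rw [Pi.single_eq_of_ne]; rintro rfl; exact hs hr)
  have h2 := congrFun h1 s
  rw [dualRep_simple_self] at h2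
  norm_num at h2

theorem parabolic_le_iff (hM : IsEvenMatrix M) {T T' : Set S} :
    parabolic cs.simple T ≤ parabolic cs.simple T' ↔ T ⊆ T' :=
  ⟨fun h _ hs => (simple_mem_parabolic_iff cs hM).1 (h (gen_mem_parabolic hs)), parabolic_mono⟩

/-! ### Positivity -/

/-- The alternating product `a b a ⋯` with `k` factors. -/
def altProd (a b : G) : ℕ → G
  | 0 => 1
  | k + 1 => a * altProd b a k

theorem altProd_succ_right (a b : G) (k : ℕ) :
    altProd a b (k + 1) = altProd a b k * (if Even k then a else b) := by
  induction k generalizing a b with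
  | zero => simp [altProd]
  | succ k ih =>
    rw [altProd, ih b a, altProd, mul_assoc]
    by_cases h : Even k <;> simp [h, Nat.even_add_one]

theorem altProd_add (a b : G) (j i : ℕ) :
    altProd a b (j + j + i) = (a * b) ^ j * altProd a b i := by
  induction j with
  | zero => simp
  | succ j ih =>
    have : j + 1 + (j + 1) + i = (j + j + i) + 1 + 1 := by omega
    rw [this, altProd, altProd, ih, pow_succ']
    simp [mul_assoc]

theorem length_altProd_mul_le (s t : S) (k : ℕ) (v : W) :
    cs.length (altProd (cs.simple s) (cs.simple t) k * v) ≤ k + cs.length v := by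
  induction k generalizing s t with
  | zero => simp [altProd]
  | succ k ih =>
    rw [altProd, mul_assoc]
    have h1 := cs.length_mul_le (cs.simple s) (altProd (cs.simple t) (cs.simple s) k * v)
    rw [cs.length_simple] at h1
    have := ih t s
    omega

/-- The braid relation, used to change the first letter of a long alternating word from t to s.
Since m_st is even, (st)^(m_st/2) is its own inverse. -/
theorem altProd_swap {s t : S} (hM : IsEvenMatrix M) (hst : s ≠ t) {k : ℕ} (h0 : M s t ≠ 0)
    (hk : M s t ≤ k) : altProd (cs.simple t) (cs.simple s) k =
      altProd (cs.simple s) (cs.simple t) (M s t) *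
        altProd (cs.simple t) (cs.simple s) (k - M s t) := by
  obtain ⟨j, hj⟩ := (hM s t hst).resolve_left h0
  obtain ⟨i, rfl⟩ := Nat.exists_eq_add_of_le hk
  rw [Nat.add_sub_cancel_left, hj, altProd_add]
  have h1 : altProd (cs.simple s) (cs.simple t) (j + j) = (cs.simple s * cs.simple t) ^ j := by
    simpa [altProd] using altProd_add (cs.simple s) (cs.simple t) j 0
  rw [h1]
  congr 1
  have h2 : (cs.simple s * cs.simple t) ^ j * (cs.simple s * cs.simple t) ^ j = 1 := by
    rw [← pow_add, ← hj, cs.simple_mul_simple_pow]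
  rw [← inv_eq_iff_mul_eq_one.2 h2, ← inv_pow, mul_inv_rev, cs.inv_simple, cs.inv_simple]

/-- With θ = π/m_st the value is sin(kθ)/sin θ, and k ≤ m_st keeps kθ in [0, π]. For m_st = ∞ the
value is k. -/
theorem chebyshev_nonneg (s t : S) {k : ℕ} (h : M s t = 0 ∨ k ≤ M s t) (hM : IsEvenMatrix M)
    (hst : s ≠ t) :
    0 ≤ (Polynomial.Chebyshev.S ℝ ((k : ℤ) - 1)).eval (cosEntry M s t) := by
  by_cases h0 : M s t = 0
  · rw [cosEntry_of_zero h0, Polynomial.Chebyshev.S_eval_two]; simp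
  · have h2 : (2 : ℝ) ≤ M s t := by exact_mod_cast hM.two_le hst h0
    have hk : (k : ℝ) ≤ M s t := by exact_mod_cast h.resolve_left h0
    have h1 := Polynomial.Chebyshev.S_two_mul_real_cos (Real.pi / M s t) ((k : ℤ) - 1)
    have hsin : 0 < Real.sin (Real.pi / M s t) := by
      apply Real.sin_pos_of_pos_of_lt_pi (by positivity)
      rw [div_lt_iff₀ (by positivity)]
      nlinarith [Real.pi_pos]
    have h3 : 0 ≤ Real.sin ((((k : ℤ) - 1 : ℤ) + 1 : ℝ) * (Real.pi / M s t)) := by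
      apply Real.sin_nonneg_of_nonneg_of_le_pi
      · push_cast; ring_nf; positivity
      · push_cast
        rw [← mul_div_assoc, div_le_iff₀ (by positivity)]
        nlinarith [Real.pi_pos]
    rw [← h1] at h3
    exact nonneg_of_mul_nonneg_left h3 hsin

/-- The numbers p and p' are the two coordinates of y, in an order depending on the parity of k.
Hiding them behind an existential lets the induction exchange s and t, and the Chebyshev recurrence
does the rest. -/
theorem dualRep_altProd (hM : IsEvenMatrix M) (s t : S) (k : ℕ) {y : S → ℝ} (hs : 0 ≤ y s)
    (ht : 0 ≤ y t) : ∃ p p' : ℝ, 0 ≤ p ∧ 0 ≤ p' ∧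
      dualRep cs hM (altProd (cs.simple t) (cs.simple s) k) y s =
        (Polynomial.Chebyshev.S ℝ k).eval (cosEntry M s t) * p +
          (Polynomial.Chebyshev.S ℝ (k - 1)).eval (cosEntry M s t) * p' ∧
      dualRep cs hM (altProd (cs.simple t) (cs.simple s) k) y t =
        -((Polynomial.Chebyshev.S ℝ (k - 1)).eval (cosEntry M s t) * p +
          (Polynomial.Chebyshev.S ℝ (k - 2)).eval (cosEntry M s t) * p') := by
  induction k generalizing s t with
  | zero => exact ⟨y s, y t, hs, ht, by simp [altProd], by simp [altProd]⟩
  | succ k ih =>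
    obtain ⟨p, p', hp, hp', h1, h2⟩ := ih t s ht hs
    refine ⟨p, p', hp, hp', ?_, ?_⟩
    · rw [altProd, dualRep_mul_apply, dualRep_simple_apply, h1, h2, cosEntry_comm M t s]
      push_cast
      rw [Polynomial.Chebyshev.S_add_one, Polynomial.Chebyshev.S_sub_two, add_sub_cancel_right]
      simp only [Polynomial.eval_sub, Polynomial.eval_mul, Polynomial.eval_X]
      ring
    · rw [altProd, dualRep_mul_apply, dualRep_simple_self, h1, cosEntry_comm M t s]
      push_cast
      rw [add_sub_cancel_right, show (k : ℤ) + 1 - 2 = k - 1 by ring]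

/-- Tits' positivity, by induction on length. A maximal alternating prefix in s and t is split off
w; the remainder has neither s nor t as a descent, and the prefix acts on the two coordinates by
nonnegative Chebyshev values. -/
theorem dualRep_nonneg_of_not_isLeftDescent (hM : IsEvenMatrix M) {w : W} {s : S}
    (hs : ¬ cs.IsLeftDescent w s) {x : S → ℝ} (hx : ∀ r, 0 ≤ x r) :
    0 ≤ dualRep cs hM w x s := by
  induction hn : cs.length w using Nat.strong_induction_on generalizing w s with
  | _ n ih =>
    subst hn
    by_cases hw : w = 1
    · simpa [hw] using hx s
    obtain ⟨t, ht⟩ := cs.exists_leftDescent_of_ne_one hw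
    have hst : s ≠ t := by rintro rfl; exact hs ht
    let P : ℕ → Prop := fun k => ∃ v, w = altProd (cs.simple t) (cs.simple s) k * v ∧
      k + cs.length v = cs.length w
    have hP1 : P 1 := by
      refine ⟨cs.simple t * w, by simp [altProd], ?_⟩
      rw [cs.isLeftDescent_iff] at ht
      omega
    classical
    have hbound : ∀ k, P k → k ≤ cs.length w := by
      rintro k ⟨v, -, hv⟩; omega
    have hone := hbound 1 hP1
    set k := Nat.findGreatest P (cs.length w) with hk
    have hPk : P k := Nat.findGreatest_spec hone hP1
    have hk1 : 1 ≤ k := Nat.le_findGreatest hone hP1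
    have hmax : ¬ P (k + 1) := fun h => by
      have := Nat.le_findGreatest (hbound _ h) h
      omega
    obtain ⟨v, hwv, hlv⟩ := hPk
    obtain ⟨j, hj⟩ : ∃ j, k = j + 1 := ⟨k - 1, by omega⟩
    -- A descent of v equal to the next letter would lengthen the prefix; one equal to the last
    -- letter would cancel it and make w shorter than it is.
    have hdesc : ∀ r, r = s ∨ r = t → ¬ cs.IsLeftDescent v r := by
      intro r hr hd
      rw [cs.isLeftDescent_iff] at hd
      by_cases hrk : r = if Even k then t else s
      · refine hmax ⟨cs.simple r * v, ?_, by omega⟩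
        have : (if Even k then cs.simple t else cs.simple s) = cs.simple r := by
          rw [hrk]; split_ifs <;> rfl
        rw [altProd_succ_right, this, mul_assoc, cs.simple_mul_simple_cancel_left, hwv]
      · have hrj : (if Even j then cs.simple t else cs.simple s) = cs.simple r := by
          simp only [hj, Nat.even_add_one] at hrk
          by_cases h : Even j
          · simp only [h, not_true_eq_false, if_false, if_true] at hrk ⊢
            rw [hr.resolve_left hrk]
          · simp only [h, not_false_eq_true, if_false, if_true] at hrk ⊢
            rw [hr.resolve_right hrk]
        rw [hj, altProd_succ_right, hrj, mul_assoc] at hwv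
        have := length_altProd_mul_le cs t s j (cs.simple r * v)
        rw [← hwv] at this
        omega
    have hlt : cs.length v < cs.length w := by omega
    have ys := ih _ hlt (hdesc s (Or.inl rfl)) rfl
    have yt := ih _ hlt (hdesc t (Or.inr rfl)) rfl
    -- A prefix of length at least m_st could be rewritten to begin with s, making s a descent of w.
    have hkm : M s t = 0 ∨ k + 1 ≤ M s t := by
      by_contra hcon
      push Not at hcon
      apply hs
      obtain ⟨m, hm⟩ : ∃ m, M s t = m + 1 := ⟨M s t - 1, by omega⟩
      rw [altProd_swap cs hM hst hcon.1 (by omega), hm, altProd, mul_assoc, mul_assoc] at hwv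
      rw [CoxeterSystem.IsLeftDescent]
      nth_rewrite 1 [hwv]
      rw [cs.simple_mul_simple_cancel_left]
      have h1 := length_altProd_mul_le cs t s m
        (altProd (cs.simple t) (cs.simple s) (k - (m + 1)) * v)
      have h2 := length_altProd_mul_le cs t s (k - (m + 1)) v
      omega
    obtain ⟨p, p', hp, hp', h1, -⟩ := dualRep_altProd cs hM s t k ys yt
    rw [hwv, dualRep_mul_apply, h1]
    have c1 := chebyshev_nonneg (M := M) s t (k := k + 1) hkm hM hst
    have c2 := chebyshev_nonneg (M := M) s t (k := k) (by omega) hM hst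
    push_cast at c1
    rw [add_sub_cancel_right] at c1
    positivity

theorem dualRep_nonpos_of_isLeftDescent (hM : IsEvenMatrix M) {w : W} {s : S}
    (hs : cs.IsLeftDescent w s) {x : S → ℝ} (hx : ∀ r, 0 ≤ x r) :
    dualRep cs hM w x s ≤ 0 := by
  rw [cs.isLeftDescent_iff_not_isLeftDescent_mul] at hs
  have := dualRep_nonneg_of_not_isLeftDescent cs hM hs hx
  rw [dualRep_mul_apply, dualRep_simple_self] at this
  linarith

/-- If s is not in T, then w fixes e_s, whose coordinate s is 1, while a descent forces this
coordinate to be nonpositive. -/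
theorem mem_of_isLeftDescent_of_mem_parabolic (hM : IsEvenMatrix M) {T : Set S} {w : W} {s : S}
    (hw : w ∈ parabolic cs.simple T) (hs : cs.IsLeftDescent w s) : s ∈ T := by
  classical
  by_contra hsT
  have h1 := dualRep_eq_self cs hM hw (x := Pi.single s 1)
    (fun r hr => by rw [Pi.single_eq_of_ne]; rintro rfl; exact hsT hr)
  have h2 := dualRep_nonpos_of_isLeftDescent cs hM hs (x := Pi.single s 1)
    (fun r => by by_cases h : r = s <;> simp [h])
  rw [h1] at h2
  norm_num at h2

/-- The closed chamber is a strict fundamental domain for `W_T`. -/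
theorem dualRep_fundamental (hM : IsEvenMatrix M) {T : Set S} {w : W}
    (hw : w ∈ parabolic cs.simple T) {x y : S → ℝ} (hx : ∀ s ∈ T, 0 ≤ x s)
    (hy : ∀ s ∈ T, 0 ≤ y s) (h : ∀ s ∈ T, dualRep cs hM w x s = y s) :
    (∀ s ∈ T, x s = y s) ∧ w ∈ parabolic cs.simple {s ∈ T | x s = 0} := by
  classical
  induction hn : cs.length w using Nat.strong_induction_on generalizing w with
  | _ n ih =>
    subst hn
    by_cases hw1 : w = 1
    · subst hw1
      exact ⟨by simpa using h, one_mem _⟩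
    obtain ⟨s, hs⟩ := cs.exists_leftDescent_of_ne_one hw1
    have hsT := mem_of_isLeftDescent_of_mem_parabolic cs hM hw hs
    -- A descent s forces the coordinate s of wx to be nonpositive. Positivity needs all coordinates
    -- nonnegative, so x is first cut off outside T, which does not affect the coordinates of wx in
    -- T.
    have hys : y s = 0 := by
      refine le_antisymm ?_ (hy s hsT)
      have h1 := dualRep_nonpos_of_isLeftDescent cs hM hs
        (x := fun r => if r ∈ T then x r else 0)
        (fun r => by by_cases h : r ∈ T <;> simp [h, hx])
      rw [dualRep_congr cs hM hw (y := x) (fun r hr => by simp [hr]) s hsT] at h1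
      rwa [← h s hsT]
    have hsw : cs.simple s * w ∈ parabolic cs.simple T :=
      mul_mem (gen_mem_parabolic hsT) hw
    obtain ⟨h1, h2⟩ := ih _ hs hsw (fun r hr => by
      rw [dualRep_mul_apply, dualRep_simple_apply, h s hsT, h r hr, hys]; ring) rfl
    refine ⟨h1, ?_⟩
    have : w = cs.simple s * (cs.simple s * w) := by simp
    rw [this]
    exact mul_mem (gen_mem_parabolic ⟨hsT, by rw [h1 s hsT, hys]⟩) h2

end Representation

/-! ## Finite parabolic subgroups -/

section FiniteParabolic

variable {S W : Type*} [Group W] {M : CoxeterMatrix S} (cs : CoxeterSystem M W)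

open Classical in
/-- The invariant form of a finite parabolic subgroup `W_T`, obtained by averaging the
standard inner product of the coordinates in `T`. -/
def invariantForm (hM : IsEvenMatrix M) (T : Set S) (x y : S → ℝ) : ℝ :=
  ∑ᶠ w : parabolic cs.simple T, ∑ᶠ r : T, dualRep cs hM w x r * dualRep cs hM w y r

variable {cs} {hM : IsEvenMatrix M} {T : Set S}

theorem invariantForm_comm (x y : S → ℝ) :
    invariantForm cs hM T x y = invariantForm cs hM T y x := by
  simp only [invariantForm, mul_comm]

theorem invariantForm_add_left [Finite S] (hT : IsSpherical cs.simple T) (x x' y : S → ℝ) :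
    invariantForm cs hM T (x + x') y =
      invariantForm cs hM T x y + invariantForm cs hM T x' y := by
  have : Finite (parabolic cs.simple T) := hT
  rw [invariantForm, invariantForm, invariantForm,
    ← finsum_add_distrib (Set.toFinite _) (Set.toFinite _)]
  congr 1; ext w
  rw [← finsum_add_distrib (Set.toFinite _) (Set.toFinite _)]
  congr 1; ext r
  rw [map_add, Pi.add_apply, add_mul]

theorem invariantForm_smul_left [Finite S] (hT : IsSpherical cs.simple T) (a : ℝ) (x y : S → ℝ) :
    invariantForm cs hM T (a • x) y = a * invariantForm cs hM T x y := by
  have : Finite (parabolic cs.simple T) := hT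
  rw [invariantForm, invariantForm, ← smul_eq_mul, smul_finsum' _ (Set.toFinite _)]
  congr 1; ext w
  rw [smul_finsum' _ (Set.toFinite _)]
  congr 1; ext r
  rw [map_smul, Pi.smul_apply, smul_eq_mul, smul_eq_mul, mul_assoc]

theorem invariantForm_dualRep {v : W} (hv : v ∈ parabolic cs.simple T) (x y : S → ℝ) :
    invariantForm cs hM T (dualRep cs hM v x) (dualRep cs hM v y) =
      invariantForm cs hM T x y := by
  rw [invariantForm, invariantForm]
  refine finsum_eq_of_bijective (fun w => w * ⟨v, hv⟩) (Group.mulRight_bijective _) fun w => ?_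
  simp only [Subgroup.coe_mul, dualRep_mul_apply]

theorem invariantForm_self_nonneg (x : S → ℝ) : 0 ≤ invariantForm cs hM T x x :=
  finsum_nonneg fun _ => finsum_nonneg fun _ => mul_self_nonneg _

theorem dualRep_eq_zero_of_invariantForm [Finite S] (hT : IsSpherical cs.simple T) {x : S → ℝ}
    (h : invariantForm cs hM T x x ≤ 0) (w : parabolic cs.simple T) (r : T) :
    dualRep cs hM w x r = 0 := by
  have : Finite (parabolic cs.simple T) := hT
  by_contra hr
  have h1 : 0 < ∑ᶠ r : T, dualRep cs hM w x r * dualRep cs hM w x r :=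
    finsum_pos (fun _ => mul_self_nonneg _) ⟨r, mul_self_pos.2 hr⟩ (Set.toFinite _)
  have : 0 < invariantForm cs hM T x x :=
    finsum_pos (fun _ => finsum_nonneg fun _ => mul_self_nonneg _) ⟨w, h1⟩ (Set.toFinite _)
  linarith

theorem invariantForm_eq_zero_of_self [Finite S] (hT : IsSpherical cs.simple T) {x : S → ℝ}
    (h : invariantForm cs hM T x x ≤ 0) (y : S → ℝ) : invariantForm cs hM T x y = 0 := by
  simp [invariantForm, dualRep_eq_zero_of_invariantForm hT h]

/-- Apply invariance to the reflection s, which sends u_s to -u_s and x to x + x_s u_s. -/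
theorem invariantForm_simpleVector [Finite S] (hT : IsSpherical cs.simple T) {s : S} (hs : s ∈ T)
    (x : S → ℝ) : invariantForm cs hM T (simpleVector M s) x =
      - (x s * invariantForm cs hM T (simpleVector M s) (simpleVector M s)) / 2 := by
  have h1 := invariantForm_dualRep (hM := hM) (T := T) (gen_mem_parabolic (gen := cs.simple) hs)
    x (simpleVector M s)
  have h2 : dualRep cs hM (cs.simple s) (simpleVector M s) = (-1 : ℝ) • simpleVector M s := by
    rw [dualRep_simple, simpleVector, cosEntry_self]
    ext r; simp; ring
  rw [h2, dualRep_simple, invariantForm_add_left hT, invariantForm_smul_left hT,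
    invariantForm_comm x, invariantForm_smul_left hT,
    invariantForm_comm (simpleVector M s) (_ • _), invariantForm_smul_left hT,
    invariantForm_comm x] at h1
  linarith

theorem invariantForm_simpleVector_pos [Finite S] (hT : IsSpherical cs.simple T) {s : S} (hs : s ∈ T) :
    0 < invariantForm cs hM T (simpleVector M s) (simpleVector M s) := by
  refine lt_of_le_of_ne (invariantForm_self_nonneg _) fun h => ?_
  have h1 := dualRep_eq_zero_of_invariantForm hT h.symm.le 1 ⟨s, hs⟩
  simp [simpleVector, cosEntry_self] at h1

/-- Choose w maximizing the product of wx with the all-ones vector. That vector pairs negatively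
with every u_s, so a negative coordinate s of wx would let the reflection s increase the product. -/
theorem exists_dualRep_nonneg [Finite S] (hM : IsEvenMatrix M) (hT : IsSpherical cs.simple T) (x : S → ℝ) :
    ∃ w ∈ parabolic cs.simple T, ∀ s ∈ T, 0 ≤ dualRep cs hM w x s := by
  have : Finite (parabolic cs.simple T) := hT
  obtain ⟨w, hw⟩ := Finite.exists_max fun w : parabolic cs.simple T =>
    invariantForm cs hM T (dualRep cs hM w x) 1
  refine ⟨w, w.2, fun s hs => ?_⟩
  have h1 := hw (⟨cs.simple s, gen_mem_parabolic hs⟩ * w)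
  simp only [Subgroup.coe_mul, dualRep_mul_apply, dualRep_simple] at h1
  rw [invariantForm_add_left hT, invariantForm_smul_left hT, invariantForm_simpleVector hT hs] at h1
  have h2 := invariantForm_simpleVector_pos (hM := hM) hT hs
  simp only [Pi.one_apply, one_mul] at h1
  by_contra hcon
  push Not at hcon
  nlinarith

/-- The product of u_s and u_r can be computed from either side; comparing shows that generators
joined by an edge have vectors of equal norm. -/
theorem invariantForm_simpleVector_eq [Finite S] (hT : IsSpherical cs.simple T) {s r : S} (hs : s ∈ T)
    (hr : r ∈ T) (h : 0 < cosEntry M s r) :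
    invariantForm cs hM T (simpleVector M r) (simpleVector M r) =
      invariantForm cs hM T (simpleVector M s) (simpleVector M s) := by
  have h1 := invariantForm_simpleVector (hM := hM) hT hs (simpleVector M r)
  have h2 := invariantForm_simpleVector (hM := hM) hT hr (simpleVector M s)
  rw [invariantForm_comm, h1, simpleVector, simpleVector, cosEntry_comm M r s] at h2
  have h3 : cosEntry M s r * invariantForm cs hM T (simpleVector M s) (simpleVector M s) =
      cosEntry M s r * invariantForm cs hM T (simpleVector M r) (simpleVector M r) := by
    linarith
  exact (mul_left_cancel₀ h.ne' h3).symm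

/-- If m_sr = ∞, then u_s + u_r has nonpositive square and so lies in the radical of the form. Yet
its product with the all-ones vector is strictly negative. -/
theorem IsSpherical.ne_zero [Finite S] (hM : IsEvenMatrix M) (hT : IsSpherical cs.simple T) {s r : S}
    (hs : s ∈ T) (hr : r ∈ T) : M s r ≠ 0 := by
  intro h
  have hc := cosEntry_of_zero h
  have h0 := invariantForm_simpleVector_eq (hM := hM) hT hs hr (by rw [hc]; norm_num)
  have hpos := invariantForm_simpleVector_pos (hM := hM) hT hs
  have hform := invariantForm_simpleVector (hM := hM) hT hs
  have hform' := invariantForm_simpleVector (hM := hM) hT hr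
  set N := invariantForm cs hM T (simpleVector M s) (simpleVector M s)
  rw [h0] at hform'
  have hz := invariantForm_eq_zero_of_self (hM := hM) hT
    (x := simpleVector M s + simpleVector M r) (by
      rw [invariantForm_add_left hT, hform, hform']
      simp only [Pi.add_apply, simpleVector, cosEntry_self, cosEntry_comm M r s, hc]
      linarith) 1
  rw [invariantForm_add_left hT, hform, hform'] at hz
  simp only [Pi.one_apply] at hz
  linarith

theorem IsSpherical.eq_two [Finite S] (hM : IsEvenMatrix M) (hT : IsSpherical cs.simple T) {r s t : S}
    (hr : r ∈ T) (hs : s ∈ T) (ht : t ∈ T) (hrs : r ≠ s) (hrt : r ≠ t) (hst : s ≠ t)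
    (h : M s t ≠ 2) : M r s = 2 := by
  by_contra h2
  have hsq : √2 * √2 = 2 := Real.mul_self_sqrt (by norm_num)
  have hsq0 : 0 < √2 := by positivity
  have hc := sqrt_two_le_cosEntry hM hrs h2
  rw [cosEntry_comm] at hc
  have hd := sqrt_two_le_cosEntry hM hst h
  have he := cosEntry_nonneg hM hrt
  have h0 := invariantForm_simpleVector_eq (hM := hM) hT hs hr (hsq0.trans_le hc)
  have h1 := invariantForm_simpleVector_eq (hM := hM) hT hs ht (hsq0.trans_le hd)
  have hpos := invariantForm_simpleVector_pos (hM := hM) hT hs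
  have hform := invariantForm_simpleVector (hM := hM) hT hs
  have hform' := invariantForm_simpleVector (hM := hM) hT hr
  have hform'' := invariantForm_simpleVector (hM := hM) hT ht
  set N := invariantForm cs hM T (simpleVector M s) (simpleVector M s)
  rw [h0] at hform'
  rw [h1] at hform''
  -- The coefficients √2, 1, 1 give the null vector of the affine diagram with two consecutive edges
  -- of label 4. Larger labels, or an additional edge rt, can only decrease the square.
  have hz := invariantForm_eq_zero_of_self (hM := hM) hT
    (x := √2 • simpleVector M s + simpleVector M r + simpleVector M t) (by
      rw [invariantForm_add_left hT, invariantForm_add_left hT, invariantForm_smul_left hT,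
        hform, hform', hform'']
      simp only [Pi.add_apply, Pi.smul_apply, smul_eq_mul, simpleVector, cosEntry_self,
        cosEntry_comm M r s, cosEntry_comm M t s, cosEntry_comm M t r]
      set c := cosEntry M s r
      set d := cosEntry M s t
      set e := cosEntry M r t
      have hc' : 2 ≤ √2 * c := by nlinarith
      have hd' : 2 ≤ √2 * d := by nlinarith
      have : √2 * (√2 * -2 + c + d) + (√2 * c + -2 + e) + (√2 * d + e + -2) ≥ 0 := by
        nlinarith
      nlinarith) 1
  rw [invariantForm_add_left hT, invariantForm_add_left hT, invariantForm_smul_left hT,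
    hform, hform', hform''] at hz
  simp only [Pi.one_apply] at hz
  nlinarith

/-- The elements (st)^k and (st)^k s with k < m_st are closed under left multiplication by s and t.
-/
theorem isSpherical_pair {s t : S} (h : M s t ≠ 0) : IsSpherical cs.simple {s, t} := by
  have hfin : Set.Finite {w : W | ∃ k < M s t, w = (cs.simple s * cs.simple t) ^ k ∨
      w = (cs.simple s * cs.simple t) ^ k * cs.simple s} := by
    refine Set.Finite.subset (((Set.finite_lt_nat (M s t)).image
      fun k => (cs.simple s * cs.simple t) ^ k).union ((Set.finite_lt_nat (M s t)).image
      fun k => (cs.simple s * cs.simple t) ^ k * cs.simple s)) ?_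
    rintro w ⟨k, hk, rfl | rfl⟩
    · exact Or.inl ⟨k, hk, rfl⟩
    · exact Or.inr ⟨k, hk, rfl⟩
  have hmod : ∀ k : ℕ, ∃ j < M s t, (cs.simple s * cs.simple t) ^ k =
      (cs.simple s * cs.simple t) ^ j := fun k =>
    ⟨k % M s t, Nat.mod_lt _ (Nat.pos_of_ne_zero h), by
      nth_rewrite 1 [← Nat.mod_add_div k (M s t)]
      rw [pow_add, pow_mul, cs.simple_mul_simple_pow, one_pow, mul_one]⟩
  have hconj : ∀ k : ℕ, cs.simple s * (cs.simple s * cs.simple t) ^ k =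
      (cs.simple t * cs.simple s) ^ k * cs.simple s := by
    intro k
    induction k with
    | zero => simp
    | succ k ih => rw [pow_succ, ← mul_assoc, ih, pow_succ]; simp [mul_assoc]
  have hinv : ∀ k < M s t, (cs.simple t * cs.simple s) ^ k =
      (cs.simple s * cs.simple t) ^ (M s t - k) := by
    intro k hk
    have : (cs.simple t * cs.simple s) = (cs.simple s * cs.simple t)⁻¹ := by
      rw [mul_inv_rev, cs.inv_simple, cs.inv_simple]
    rw [this, inv_pow, inv_eq_iff_mul_eq_one, ← pow_add, Nat.add_sub_cancel' hk.le,
      cs.simple_mul_simple_pow]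
  refine (hfin.subset ?_).to_subtype
  intro w hw
  refine parabolic_induction cs (p := fun w => ∃ k < M s t, w = (cs.simple s * cs.simple t) ^ k ∨
      w = (cs.simple s * cs.simple t) ^ k * cs.simple s) hw
      ⟨0, Nat.pos_of_ne_zero h, by simp⟩ ?_
  have hs : ∀ v, (∃ k < M s t, v = (cs.simple s * cs.simple t) ^ k ∨
      v = (cs.simple s * cs.simple t) ^ k * cs.simple s) →
      (∃ k < M s t, cs.simple s * v = (cs.simple s * cs.simple t) ^ k ∨
      cs.simple s * v = (cs.simple s * cs.simple t) ^ k * cs.simple s) := by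
    rintro v ⟨k, hk, rfl | rfl⟩
    · obtain ⟨j, hj, hj'⟩ := hmod (M s t - k)
      exact ⟨j, hj, Or.inr (by rw [hconj, hinv k hk, hj'])⟩
    · obtain ⟨j, hj, hj'⟩ := hmod (M s t - k)
      refine ⟨j, hj, Or.inl ?_⟩
      rw [← mul_assoc, hconj, hinv k hk, hj', mul_assoc, cs.simple_mul_simple_self, mul_one]
  rintro r (rfl | hr) v - hv
  · exact hs v hv
  · rw [Set.mem_singleton_iff] at hr
    subst hr
    obtain ⟨k, hk, hk'⟩ := hs v hv
    have : cs.simple r * v = (cs.simple s * cs.simple r) ^ (M s r - 1) *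
        (cs.simple s * v) := by
      have h1 : (cs.simple s * cs.simple r) ^ (M s r - 1) = (cs.simple r * cs.simple s) := by
        have : (cs.simple r * cs.simple s) = (cs.simple s * cs.simple r)⁻¹ := by
          rw [mul_inv_rev, cs.inv_simple, cs.inv_simple]
        rw [this, eq_inv_iff_mul_eq_one, ← pow_succ,
          Nat.sub_add_cancel (Nat.pos_of_ne_zero h), cs.simple_mul_simple_pow]
      rw [h1, mul_assoc, cs.simple_mul_simple_cancel_left]
    obtain ⟨j, hj, hj'⟩ := hmod (M s r - 1 + k)
    refine ⟨j, hj, ?_⟩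
    rw [this]
    rcases hk' with hk' | hk'
    · left; rw [hk', ← pow_add, hj']
    · right; rw [hk', ← mul_assoc, ← pow_add, hj']

end FiniteParabolic

/-! ## Cones -/

section Cones

variable {E F : Type*} [NormedAddCommGroup E] [NormedSpace ℝ E] [NormedAddCommGroup F]
  [NormedSpace ℝ F]

/-- A linear map that is injective on a closed cone of a finite-dimensional space restricts to a
closed embedding. -/
theorem isClosedEmbedding_of_injOn_cone [FiniteDimensional ℝ E] [FiniteDimensional ℝ F]
    {A : Set E} (hA : IsClosed A) (h0 : (0 : E) ∈ A) (hsmul : ∀ a : ℝ, 0 ≤ a → ∀ x ∈ A, a • x ∈ A)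
    (L : E →ₗ[ℝ] F) (hL : Set.InjOn L A) :
    Topology.IsClosedEmbedding (fun x : A => L x) := by
  have hLc : Continuous L := L.continuous_of_finiteDimensional
  have hproper : ProperSpace E := FiniteDimensional.proper ℝ E
  have hproper' : ProperSpace F := FiniteDimensional.proper ℝ F
  -- On the compact set of unit vectors of A the norm of L has a minimum, which is positive since L
  -- is injective on A and 0 lies in A. By homogeneity this bounds L below on all of A, which makes
  -- the restriction proper.
  obtain ⟨c, hc, hcb⟩ : ∃ c : ℝ, 0 < c ∧ ∀ x ∈ A, c * ‖x‖ ≤ ‖L x‖ := by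
    have hK : IsCompact (A ∩ Metric.sphere 0 1) := (isCompact_sphere _ _).inter_left hA
    rcases (A ∩ Metric.sphere (0 : E) 1).eq_empty_or_nonempty with hK0 | hK0
    · refine ⟨1, one_pos, fun x hx => ?_⟩
      by_cases hx0 : x = 0
      · simp [hx0]
      · exfalso
        have : ‖x‖⁻¹ • x ∈ A ∩ Metric.sphere (0 : E) 1 :=
          ⟨hsmul _ (by positivity) _ hx, by simp [norm_smul, hx0]⟩
        rw [hK0] at this
        exact this
    · obtain ⟨x₀, hx₀, hmin⟩ := hK.exists_isMinOn hK0 hLc.norm.continuousOn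
      refine ⟨‖L x₀‖, ?_, fun x hx => ?_⟩
      · rw [norm_pos_iff]
        intro h
        have := hL hx₀.1 h0 (by rw [h, map_zero])
        have h2 := hx₀.2
        simp [this] at h2
      · by_cases hx0 : x = 0
        · simp [hx0]
        · have hn : 0 < ‖x‖ := norm_pos_iff.2 hx0
          have h1 : ‖L x₀‖ ≤ ‖L (‖x‖⁻¹ • x)‖ :=
            hmin ⟨hsmul _ (by positivity) _ hx, by simp [norm_smul, hx0]⟩
          rw [map_smul, norm_smul, norm_inv, norm_norm, inv_mul_eq_div, le_div_iff₀ hn] at h1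
          exact h1
  have hcont : Continuous fun x : A => L x := hLc.comp continuous_subtype_val
  refine Topology.IsClosedEmbedding.of_continuous_injective_isClosedMap hcont
    (fun x y h => Subtype.ext (hL x.2 y.2 h)) ?_
  refine IsProperMap.isClosedMap (isProperMap_iff_tendsto_cocompact.2 ⟨hcont, ?_⟩)
  rw [← Metric.cobounded_eq_cocompact (α := F), ← tendsto_norm_atTop_iff_cobounded]
  have h1 := (tendsto_norm_cocompact_atTop (E := E)).comp
    hA.isClosedEmbedding_subtypeVal.tendsto_cocompact
  refine Filter.tendsto_atTop_mono (fun x : A => hcb x x.2) ?_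
  exact h1.const_mul_atTop hc

/-- `A` is a cone on which `N` is a positively homogeneous function bounding the norm. -/
structure IsRadial (A : Set E) (N : E → ℝ) : Prop where
  zero_mem : (0 : E) ∈ A
  smul_mem : ∀ a : ℝ, 0 ≤ a → ∀ x ∈ A, a • x ∈ A
  continuous : Continuous N
  map_smul : ∀ a : ℝ, 0 ≤ a → ∀ x, N (a • x) = a * N x
  norm_le : ∀ x ∈ A, ‖x‖ ≤ N x

variable {A : Set E} {N : E → ℝ} {B : Set F} {N' : F → ℝ}

theorem IsRadial.nonneg (hA : IsRadial A N) {x : E} (hx : x ∈ A) : 0 ≤ N x :=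
  (norm_nonneg _).trans (hA.norm_le x hx)

theorem IsRadial.eq_zero (hA : IsRadial A N) {x : E} (hx : x ∈ A) (h : N x = 0) : x = 0 :=
  norm_le_zero_iff.1 (h ▸ hA.norm_le x hx)

theorem IsRadial.map_zero (hA : IsRadial A N) : N 0 = 0 := by
  simpa using hA.map_smul 0 le_rfl 0

theorem IsRadial.normalize_mem (hA : IsRadial A N) {x : E} (hx : x ∈ A) (h : N x ≠ 0) :
    (N x)⁻¹ • x ∈ {x ∈ A | N x = 1} := by
  have h1 : 0 ≤ (N x)⁻¹ := inv_nonneg.2 (hA.nonneg hx)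
  exact ⟨hA.smul_mem _ h1 x hx, by rw [hA.map_smul _ h1, inv_mul_cancel₀ h]⟩

open Classical in
/-- The radial extension of a map between the unit sets of two cones. -/
def radialExtension (hA : IsRadial A N) (hB : IsRadial B N')
    (φ : {x ∈ A | N x = 1} → {x ∈ B | N' x = 1}) (x : A) : B :=
  if h : N x = 0 then ⟨0, hB.zero_mem⟩ else
    ⟨N x • (φ ⟨_, hA.normalize_mem x.2 h⟩ : F),
      hB.smul_mem _ (hA.nonneg x.2) _ (φ ⟨_, hA.normalize_mem x.2 h⟩).2.1⟩

theorem radialExtension_of_ne (hA : IsRadial A N) (hB : IsRadial B N')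
    (φ : {x ∈ A | N x = 1} → {x ∈ B | N' x = 1}) (x : A) (h : N x ≠ 0) :
    (radialExtension hA hB φ x : F) = N x • (φ ⟨_, hA.normalize_mem x.2 h⟩ : F) := by
  rw [radialExtension, dif_neg h]

theorem radialExtension_of_eq (hA : IsRadial A N) (hB : IsRadial B N')
    (φ : {x ∈ A | N x = 1} → {x ∈ B | N' x = 1}) (x : A) (h : N x = 0) :
    (radialExtension hA hB φ x : F) = 0 := by
  rw [radialExtension, dif_pos h]

theorem radial_radialExtension (hA : IsRadial A N) (hB : IsRadial B N')
    (φ : {x ∈ A | N x = 1} → {x ∈ B | N' x = 1}) (x : A) :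
    N' (radialExtension hA hB φ x) = N x := by
  by_cases h : N x = 0
  · rw [radialExtension_of_eq hA hB φ x h, h, hB.map_zero]
  · rw [radialExtension_of_ne hA hB φ x h, hB.map_smul _ (hA.nonneg x.2), (φ _).2.2, mul_one]

/-- At the apex continuity follows from the norm being at most N; elsewhere the map is given by a
formula on the open set N ≠ 0. -/
theorem continuous_radialExtension (hA : IsRadial A N) (hB : IsRadial B N')
    {φ : {x ∈ A | N x = 1} → {x ∈ B | N' x = 1}} (hφ : Continuous φ) :
    Continuous (radialExtension hA hB φ) := by
  rw [Topology.IsInducing.subtypeVal.continuous_iff]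
  have hN : Continuous fun x : A => N x := hA.continuous.comp continuous_subtype_val
  rw [continuous_iff_continuousAt]
  intro x
  by_cases h : N x = 0
  · have h0 : (Subtype.val ∘ radialExtension hA hB φ) x = 0 := radialExtension_of_eq hA hB φ x h
    rw [ContinuousAt, h0]
    refine squeeze_zero_norm (a := fun x : A => N x) (fun y => ?_) ?_
    · exact (hB.norm_le _ (radialExtension hA hB φ y).2).trans
        (radial_radialExtension hA hB φ y).le
    · have := hN.tendsto x
      rwa [h] at this
  · have hU : IsOpen {y : A | N y ≠ 0} := isOpen_ne_fun hN continuous_const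
    let x' : {y : A | N y ≠ 0} := ⟨x, h⟩
    refine (hU.isOpenEmbedding_subtypeVal.continuousAt_iff (x := x')).1
      (Continuous.continuousAt ?_)
    have h2 : (Subtype.val ∘ radialExtension hA hB φ) ∘ Subtype.val =
        fun y : {y : A | N y ≠ 0} => N y • (φ ⟨_, hA.normalize_mem y.1.2 y.2⟩ : F) := by
      ext y
      exact radialExtension_of_ne hA hB φ y y.2
    rw [h2]
    have hN' : Continuous fun y : {y : A | N y ≠ 0} => N y := hN.comp continuous_subtype_val
    refine hN'.smul (continuous_subtype_val.comp (hφ.comp (Continuous.subtype_mk ?_ _)))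
    exact (hN'.inv₀ fun y => y.2).smul (continuous_subtype_val.comp continuous_subtype_val)

theorem radialExtension_comp (hA : IsRadial A N) (hB : IsRadial B N')
    {φ : {x ∈ A | N x = 1} → {x ∈ B | N' x = 1}} {ψ : {x ∈ B | N' x = 1} → {x ∈ A | N x = 1}}
    (h : ∀ x, ψ (φ x) = x) (x : A) :
    radialExtension hB hA ψ (radialExtension hA hB φ x) = x := by
  apply Subtype.ext
  have hr := radial_radialExtension hA hB φ x
  by_cases h0 : N x = 0
  · rw [radialExtension_of_eq _ _ _ _ (hr.trans h0), hA.eq_zero x.2 h0]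
  · have hne : N' (radialExtension hA hB φ x) ≠ 0 := by rwa [hr]
    have : (⟨_, hB.normalize_mem (radialExtension hA hB φ x).2 hne⟩ : {x ∈ B | N' x = 1}) =
        φ ⟨_, hA.normalize_mem x.2 h0⟩ := by
      apply Subtype.ext
      simp only [hr]
      rw [radialExtension_of_ne hA hB φ x h0, smul_smul, inv_mul_cancel₀ h0, one_smul]
    rw [radialExtension_of_ne _ _ _ _ hne, this, h, hr, smul_smul, mul_inv_cancel₀ h0, one_smul]

/-- Cones over homeomorphic bases are homeomorphic. -/
def radialHomeomorph (hA : IsRadial A N) (hB : IsRadial B N')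
    (e : {x ∈ A | N x = 1} ≃ₜ {x ∈ B | N' x = 1}) : A ≃ₜ B where
  toFun := radialExtension hA hB e
  invFun := radialExtension hB hA e.symm
  left_inv := radialExtension_comp hA hB e.symm_apply_apply
  right_inv := radialExtension_comp hB hA e.apply_symm_apply
  continuous_toFun := continuous_radialExtension hA hB e.continuous
  continuous_invFun := continuous_radialExtension hB hA e.symm.continuous

end Cones

/-! ## Realizations -/

section Realization

variable {V P : Type*}

/-- The cone over the realization of a complex: nonnegative weights whose support is empty or a
face. -/
def openCone (K : PreAbstractSimplicialComplex V) : Set (V → ℝ) :=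
  {y | (∀ v, 0 ≤ y v) ∧ (y = 0 ∨ ∃ σ ∈ K.faces, Function.support y = σ)}

theorem isRadial_openCone [Fintype V] (K : PreAbstractSimplicialComplex V) :
    IsRadial (openCone K) (fun y => ∑ v, y v) where
  zero_mem := ⟨fun _ => le_rfl, Or.inl rfl⟩
  smul_mem a ha y hy := by
    refine ⟨fun v => mul_nonneg ha (hy.1 v), ?_⟩
    rcases ha.eq_or_lt with rfl | ha
    · left; simp
    · rcases hy.2 with rfl | ⟨σ, hσ, h⟩
      · left; simp
      · right; exact ⟨σ, hσ, by rw [← h, Function.support_const_smul_of_ne_zero _ _ ha.ne']⟩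
  continuous := by fun_prop
  map_smul a _ x := by simp [Finset.mul_sum]
  norm_le y hy := by
    refine (pi_norm_le_iff_of_nonneg (Finset.sum_nonneg fun v _ => hy.1 v)).2 fun v => ?_
    rw [Real.norm_of_nonneg (hy.1 v)]
    exact Finset.single_le_sum (fun v _ => hy.1 v) (Finset.mem_univ v)

theorem realization_eq_openCone [Fintype V] (K : PreAbstractSimplicialComplex V) :
    K.realization = {y ∈ openCone K | ∑ v, y v = 1} := by
  ext y
  constructor
  · rintro ⟨h0, σ, hσ, hs, h1⟩
    refine ⟨⟨h0, Or.inr ⟨σ, hσ, hs⟩⟩, ?_⟩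
    rw [← h1]
    refine (Finset.sum_subset (Finset.subset_univ σ) fun v _ hv => ?_).symm
    by_contra hne
    exact hv (Finset.mem_coe.1 (hs ▸ hne))
  · rintro ⟨⟨h0, rfl | ⟨σ, hσ, hs⟩⟩, h1⟩
    · simp at h1
    · refine ⟨h0, σ, hσ, hs, ?_⟩
      rw [← h1]
      refine Finset.sum_subset (Finset.subset_univ σ) fun v _ hv => ?_
      by_contra hne
      exact hv (Finset.mem_coe.1 (hs ▸ hne))

theorem isRadial_univ {E : Type*} [NormedAddCommGroup E] [NormedSpace ℝ E] :
    IsRadial (Set.univ : Set E) norm where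
  zero_mem := trivial
  smul_mem _ _ _ _ := trivial
  continuous := continuous_norm
  map_smul a ha x := by rw [norm_smul, Real.norm_of_nonneg ha]
  norm_le _ _ := le_rfl

/-- The cone over a sphere is a Euclidean space. -/
theorem nonempty_openCone_homeomorph [Finite V] {K : PreAbstractSimplicialComplex V} {d : ℕ}
    (h : Nonempty (K.realization ≃ₜ Metric.sphere (0 : EuclideanSpace ℝ (Fin d)) 1)) :
    Nonempty (openCone K ≃ₜ EuclideanSpace ℝ (Fin d)) := by
  have := Fintype.ofFinite V
  obtain ⟨e⟩ := h
  have h2 : Metric.sphere (0 : EuclideanSpace ℝ (Fin d)) 1 =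
      {x ∈ (Set.univ : Set (EuclideanSpace ℝ (Fin d))) | ‖x‖ = 1} := by
    ext x; simp
  exact ⟨(radialHomeomorph (isRadial_openCone K) isRadial_univ
    ((Homeomorph.setCongr (realization_eq_openCone K)).symm.trans
      (e.trans (Homeomorph.setCongr h2)))).trans (Homeomorph.Set.univ _)⟩

/-- An injection of vertex sets that induces a bijection of faces induces a homeomorphism of
realizations. -/
theorem nonempty_realization_homeomorph {K : PreAbstractSimplicialComplex V}
    {K' : PreAbstractSimplicialComplex P} (i : V ↪ P)
    (h : ∀ σ, σ ∈ K'.faces ↔ ∃ τ ∈ K.faces, τ.map i = σ) :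
    Nonempty (K'.realization ≃ₜ K.realization) := by
  have hsupp : ∀ f ∈ K'.realization, ∀ p, p ∉ Set.range i → f p = 0 := by
    rintro f ⟨-, σ, hσ, hs, -⟩ p hp
    obtain ⟨τ, -, rfl⟩ := (h σ).1 hσ
    by_contra hne
    have : p ∈ Function.support f := hne
    rw [hs] at this
    simp only [Finset.coe_map] at this
    exact hp (Set.image_subset_range _ _ this)
  refine ⟨{
    toFun := fun f => ⟨f.1 ∘ i, ?_⟩
    invFun := fun g => ⟨Function.extend i g.1 0, ?_⟩
    left_inv := ?_
    right_inv := ?_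
    continuous_toFun := ?_
    continuous_invFun := ?_ }⟩
  · obtain ⟨f, h0, σ, hσ, hs, h1⟩ := f
    obtain ⟨τ, hτ, rfl⟩ := (h σ).1 hσ
    refine ⟨fun v => h0 _, τ, hτ, ?_, by simpa using h1⟩
    ext v
    have : i v ∈ Function.support f ↔ i v ∈ ((τ.map i : Finset P) : Set P) := by rw [hs]
    simpa using this
  · obtain ⟨g, h0, τ, hτ, hs, h1⟩ := g
    refine ⟨fun p => ?_, τ.map i, (h _).2 ⟨τ, hτ, rfl⟩, ?_, ?_⟩
    · by_cases hp : ∃ v, i v = p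
      · obtain ⟨v, rfl⟩ := hp
        rw [i.injective.extend_apply]
        exact h0 v
      · rw [Function.extend_apply' _ _ _ hp]; rfl
    · ext p
      by_cases hp : ∃ v, i v = p
      · obtain ⟨v, rfl⟩ := hp
        have : v ∈ Function.support g ↔ v ∈ (τ : Set V) := by rw [hs]
        rw [Function.mem_support, i.injective.extend_apply]
        simpa using this
      · rw [Function.mem_support, Function.extend_apply' _ _ _ hp]
        simp only [Pi.zero_apply, ne_eq, not_true_eq_false, Finset.coe_map, false_iff]
        exact fun hcon => hp (Set.image_subset_range _ _ hcon)
    · rw [Finset.sum_map]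
      exact (Finset.sum_congr rfl fun v _ => i.injective.extend_apply _ _ _).trans h1
  · rintro ⟨f, hf⟩
    apply Subtype.ext
    ext p
    by_cases hp : ∃ v, i v = p
    · obtain ⟨v, rfl⟩ := hp
      exact i.injective.extend_apply _ _ _
    · exact (Function.extend_apply' _ _ _ hp).trans (hsupp f hf p hp).symm
  · rintro ⟨g, hg⟩
    apply Subtype.ext
    ext v
    exact i.injective.extend_apply _ _ _
  · refine Continuous.subtype_mk (continuous_pi fun v => ?_) _
    exact (continuous_apply (i v)).comp continuous_subtype_val
  · refine Continuous.subtype_mk (continuous_pi fun p => ?_) _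
    by_cases hp : ∃ v, i v = p
    · obtain ⟨v, rfl⟩ := hp
      simp only [i.injective.extend_apply]
      exact (continuous_apply v).comp continuous_subtype_val
    · simp only [Function.extend_apply' _ _ _ hp]
      exact continuous_const

theorem nonempty_chainComplex_homeomorph [PartialOrder V] [PartialOrder P] {Q : Set P}
    (e : Q ≃o V) :
    Nonempty ((chainComplex Q).realization ≃ₜ (chainComplex (Set.univ : Set V)).realization) := by
  classical
  refine nonempty_realization_homeomorph
    (e.symm.toEquiv.toEmbedding.trans (Function.Embedding.subtype _)) fun σ => ?_
  constructor
  · rintro ⟨hne, hQ, hc⟩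
    refine ⟨(σ.subtype (· ∈ Q)).map e.toEquiv.toEmbedding, ⟨?_, Set.subset_univ _, ?_⟩, ?_⟩
    · obtain ⟨p, hp⟩ := hne
      rw [Finset.map_nonempty]
      exact ⟨⟨p, hQ hp⟩, by simpa using hp⟩
    · rintro v hv v' hv' hne'
      simp only [Finset.coe_map, Set.mem_image, Finset.mem_coe, Finset.mem_subtype] at hv hv'
      obtain ⟨p, hp, rfl⟩ := hv
      obtain ⟨p', hp', rfl⟩ := hv'
      rcases hc hp hp' (fun h => hne' (by rw [Subtype.ext h])) with h | h
      · exact Or.inl (e.monotone h)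
      · exact Or.inr (e.monotone h)
    · ext p
      simp only [Finset.mem_map, Finset.mem_subtype]
      constructor
      · rintro ⟨v, ⟨p', hp', rfl⟩, rfl⟩
        simpa using hp'
      · intro hp
        exact ⟨e ⟨p, hQ hp⟩, ⟨⟨p, hQ hp⟩, hp, rfl⟩, by simp⟩
  · rintro ⟨τ, ⟨hne, -, hc⟩, rfl⟩
    refine ⟨hne.map, ?_, ?_⟩
    · rintro p hp
      simp only [Finset.coe_map, Set.mem_image] at hp
      obtain ⟨v, -, rfl⟩ := hp
      exact (e.symm v).2
    · rintro p hp p' hp' hne'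
      simp only [Finset.coe_map, Set.mem_image] at hp hp'
      obtain ⟨v, hv, rfl⟩ := hp
      obtain ⟨v', hv', rfl⟩ := hp'
      rcases hc hv hv' (fun h => hne' (by rw [h])) with h | h
      · exact Or.inl (e.symm.monotone h)
      · exact Or.inr (e.symm.monotone h)

end Realization

/-! ## Open stars in the realization of a poset -/

section Star

variable {P : Type*} [PartialOrder P]

/-- The elements comparable to `a` and different from `a`. -/
def comparables (a : P) : Set P := {b | b ≠ a ∧ (b ≤ a ∨ a ≤ b)}

/-- Nonnegative weights on `B` that are supported on a chain. -/
def chainCone (B : Set P) : Set (B → ℝ) :=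
  {g | (∀ b, 0 ≤ g b) ∧ ∀ b c, g b ≠ 0 → g c ≠ 0 → b.1 ≤ c.1 ∨ c.1 ≤ b.1}

theorem isClosed_chainCone (B : Set P) : IsClosed (chainCone B) := by
  have : chainCone B = (⋂ b, {g : B → ℝ | 0 ≤ g b}) ∩
      ⋂ b : B, ⋂ c : B, {g : B → ℝ | g b * g c = 0 ∨ (b.1 ≤ c.1 ∨ c.1 ≤ b.1)} := by
    ext g
    simp only [chainCone, Set.mem_ofPred_eq, Set.mem_inter_iff, Set.mem_iInter, mul_eq_zero]
    refine and_congr_right fun _ => forall₂_congr fun b c => ?_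
    tauto
  rw [this]
  refine IsClosed.inter (isClosed_iInter fun b => isClosed_le (by fun_prop) (by fun_prop))
    (isClosed_iInter fun b => isClosed_iInter fun c => ?_)
  by_cases h : b.1 ≤ c.1 ∨ c.1 ≤ b.1
  · simp only [h, or_true]
    exact isClosed_univ
  · simp only [h, or_false]
    exact isClosed_eq (by fun_prop) (by fun_prop)

theorem zero_mem_chainCone (B : Set P) : (0 : B → ℝ) ∈ chainCone B :=
  ⟨fun _ => le_rfl, fun _ _ h => absurd rfl h⟩

theorem smul_mem_chainCone (B : Set P) (a : ℝ) (ha : 0 ≤ a) (g : B → ℝ) (hg : g ∈ chainCone B) :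
    a • g ∈ chainCone B :=
  ⟨fun b => mul_nonneg ha (hg.1 b), fun b c hb hc =>
    hg.2 b c (right_ne_zero_of_mul hb) (right_ne_zero_of_mul hc)⟩

theorem sum_comparables {a : P} [Fintype (comparables a)] {f : P → ℝ}
    (hf : f ∈ (chainComplex (Set.univ : Set P)).realization) (ha : 0 < f a) :
    f a + ∑ b : comparables a, f b = 1 := by
  classical
  obtain ⟨h0, σ, ⟨-, -, hc⟩, hs, h1⟩ := hf
  have haσ : a ∈ σ := Finset.mem_coe.1 (hs ▸ (ne_of_gt ha : f a ≠ 0))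
  rw [← h1, ← Finset.add_sum_erase _ _ haσ]
  congr 1
  have : ∑ b : comparables a, f b =
      ∑ b ∈ (Finset.univ : Finset (comparables a)).map (Function.Embedding.subtype _), f b := by
    rw [Finset.sum_map]; rfl
  rw [this]
  refine (Finset.sum_subset ?_ ?_).symm
  · intro b hb
    rw [Finset.mem_erase] at hb
    rw [Finset.mem_map]
    exact ⟨⟨b, hb.1, hc hb.2 haσ hb.1⟩, Finset.mem_univ _, rfl⟩
  · intro b hb hbσ
    rw [Finset.mem_map] at hb
    obtain ⟨b, -, rfl⟩ := hb
    by_contra hne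
    exact hbσ (Finset.mem_erase.2 ⟨b.2.1, Finset.mem_coe.1 (hs ▸ hne)⟩)

theorem eq_zero_of_not_comparable {a b : P} {f : P → ℝ}
    (hf : f ∈ (chainComplex (Set.univ : Set P)).realization) (ha : 0 < f a)
    (hb : b ∉ comparables a) (hne : b ≠ a) : f b = 0 := by
  obtain ⟨h0, σ, ⟨-, -, hc⟩, hs, h1⟩ := hf
  by_contra h
  have haσ : a ∈ (σ : Set P) := hs ▸ (ne_of_gt ha : f a ≠ 0)
  have hbσ : b ∈ (σ : Set P) := hs ▸ h
  exact hb ⟨hne, hc hbσ haσ hne⟩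

open Classical in
/-- The point of the open star of `a` with given weights away from `a`. -/
def starPoint (a : P) [Fintype (comparables a)] (g : comparables a → ℝ) (b : P) : ℝ :=
  if h : b ∈ comparables a then g ⟨b, h⟩ else if b = a then 1 - ∑ c, g c else 0

theorem starPoint_of_mem {a : P} [Fintype (comparables a)] (g : comparables a → ℝ)
    (b : comparables a) : starPoint a g b = g b := by
  rw [starPoint, dif_pos b.2]

theorem starPoint_self {a : P} [Fintype (comparables a)] (g : comparables a → ℝ) :
    starPoint a g a = 1 - ∑ c, g c := by
  rw [starPoint, dif_neg (fun h => h.1 rfl), if_pos rfl]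

theorem starPoint_of_notMem {a b : P} [Fintype (comparables a)] (g : comparables a → ℝ)
    (hb : b ∉ comparables a) (hne : b ≠ a) : starPoint a g b = 0 := by
  rw [starPoint, dif_neg hb, if_neg hne]

theorem starPoint_mem {a : P} [Fintype (comparables a)] {g : comparables a → ℝ}
    (hg : g ∈ chainCone (comparables a)) (h1 : ∑ c, g c < 1) :
    starPoint a g ∈ (chainComplex (Set.univ : Set P)).realization := by
  classical
  have hpos : ∀ b, starPoint a g b ≠ 0 → b = a ∨ ∃ c : comparables a, b = c ∧ g c ≠ 0 := by
    intro b hb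
    by_cases hb' : b ∈ comparables a
    · right; exact ⟨⟨b, hb'⟩, rfl, by rwa [← starPoint_of_mem g]⟩
    · left; by_contra hne; exact hb (starPoint_of_notMem g hb' hne)
  have ha : a ∉ (Finset.univ.filter fun c : comparables a => g c ≠ 0).map
      (Function.Embedding.subtype _) := by
    rw [Finset.mem_map]
    rintro ⟨c, -, hc⟩
    exact c.2.1 hc
  refine ⟨fun b => ?_, Finset.cons a ((Finset.univ.filter fun c : comparables a => g c ≠ 0).map
      (Function.Embedding.subtype _)) ha, ⟨⟨a, by simp⟩, Set.subset_univ _, ?_⟩, ?_, ?_⟩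
  · by_cases hb : b ∈ comparables a
    · rw [starPoint_of_mem g ⟨b, hb⟩]; exact hg.1 _
    · by_cases hba : b = a
      · subst hba; rw [starPoint_self]; linarith
      · rw [starPoint_of_notMem g hb hba]
  · intro b hb c hc hne
    simp only [Finset.coe_cons, Set.mem_insert_iff, Finset.mem_coe, Finset.mem_map,
      Finset.mem_filter, Finset.mem_univ, true_and] at hb hc
    rcases hb with rfl | ⟨b, hb, rfl⟩ <;> rcases hc with rfl | ⟨c, hc, rfl⟩
    · exact absurd rfl hne
    · exact c.2.2.symm
    · exact b.2.2
    · exact hg.2 b c hb hc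
  · ext b
    simp only [Function.mem_support, Finset.coe_cons, Set.mem_insert_iff, Finset.mem_coe,
      Finset.mem_map, Finset.mem_filter, Finset.mem_univ, true_and]
    constructor
    · intro hb
      rcases hpos b hb with rfl | ⟨c, rfl, hc⟩
      · exact Or.inl rfl
      · exact Or.inr ⟨c, hc, rfl⟩
    · rintro (rfl | ⟨c, hc, rfl⟩)
      · rw [starPoint_self]; linarith
      · exact (starPoint_of_mem g c).trans_ne hc
  · rw [Finset.sum_cons, Finset.sum_map, starPoint_self, Finset.sum_filter_of_ne]
    · have : ∑ c : comparables a, starPoint a g (Function.Embedding.subtype _ c) = ∑ c, g c :=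
        Finset.sum_congr rfl fun c _ => starPoint_of_mem g c
      rw [this]; ring
    · intro c _ hc
      rwa [← starPoint_of_mem g c]

/-- The open star of `a` is an open subset of the cone of weights on the elements comparable to
`a`. -/
theorem exists_isOpenEmbedding_star (a : P) [Finite (comparables a)] :
    ∃ e : {f : (chainComplex (Set.univ : Set P)).realization | 0 < f.1 a} →
      chainCone (comparables a), Topology.IsOpenEmbedding e := by
  have := Fintype.ofFinite (comparables a)
  let X := (chainComplex (Set.univ : Set P)).realization
  have hsum : Continuous fun g : chainCone (comparables a) => ∑ c, g.1 c := by fun_prop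
  have hopen : IsOpen {g : chainCone (comparables a) | ∑ c, g.1 c < 1} :=
    isOpen_lt hsum continuous_const
  -- The weight at a is redundant: it is 1 minus the sum of the others, and it is positive exactly
  -- when that sum is less than 1.
  let e : {f : X | 0 < f.1 a} ≃ₜ {g : chainCone (comparables a) | ∑ c, g.1 c < 1} :=
    { toFun := fun f => ⟨⟨fun b => f.1.1 b, fun b => f.1.2.1 b, fun b c hb hc => by
          obtain ⟨-, σ, ⟨-, -, hch⟩, hs, -⟩ := f.1.2
          have hb' : b.1 ∈ (σ : Set P) := hs ▸ hb
          have hc' : c.1 ∈ (σ : Set P) := hs ▸ hc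
          exact hch.total hb' hc'⟩, by
        have h1 := sum_comparables f.1.2 f.2
        have h2 : 0 < f.1.1 a := f.2
        simp only [Set.mem_ofPred_eq]
        linarith⟩
      invFun := fun g => ⟨⟨starPoint a g.1.1, starPoint_mem g.1.2 g.2⟩, by
        have := g.2
        simp only [Set.mem_ofPred_eq, starPoint_self] at this ⊢
        linarith⟩
      left_inv := by
        intro f
        apply Subtype.ext; apply Subtype.ext; ext b
        by_cases hb : b ∈ comparables a
        · exact starPoint_of_mem _ ⟨b, hb⟩
        · by_cases hba : b = a
          · subst hba
            refine (starPoint_self _).trans ?_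
            have h1 := sum_comparables f.1.2 f.2
            simp only
            linarith
          · exact (starPoint_of_notMem _ hb hba).trans
              (eq_zero_of_not_comparable f.1.2 f.2 hb hba).symm
      right_inv := by
        intro g
        apply Subtype.ext; apply Subtype.ext; ext b
        exact starPoint_of_mem _ b
      continuous_toFun := by
        refine Continuous.subtype_mk (Continuous.subtype_mk (continuous_pi fun b => ?_) _) _
        exact (continuous_apply b.1).comp (continuous_subtype_val.comp continuous_subtype_val)
      continuous_invFun := by
        refine Continuous.subtype_mk (Continuous.subtype_mk (continuous_pi fun b => ?_) _) _
        by_cases hb : b ∈ comparables a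
        · simp only [starPoint, dif_pos hb]
          exact (continuous_apply (⟨b, hb⟩ : comparables a)).comp
            (continuous_subtype_val.comp continuous_subtype_val)
        · by_cases hba : b = a
          · subst hba
            simp only [starPoint_self]
            exact continuous_const.sub (hsum.comp continuous_subtype_val)
          · simp only [starPoint_of_notMem _ hb hba]
            exact continuous_const }
  exact ⟨fun f => (e f).1, hopen.isOpenEmbedding_subtypeVal.comp e.isOpenEmbedding⟩

theorem nonempty_chartedSpace {X H : Type*} [TopologicalSpace X] [TopologicalSpace H]
    (h : ∀ x : X, ∃ U : Set X, IsOpen U ∧ x ∈ U ∧ ∃ e : U → H, Topology.IsOpenEmbedding e) :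
    Nonempty (ChartedSpace H X) := by
  have h' : ∀ x : X, ∃ c : OpenPartialHomeomorph X H, x ∈ c.source := by
    intro x
    obtain ⟨U, hU, hx, e, he⟩ := h x
    have : Nonempty U := ⟨⟨x, hx⟩⟩
    let U' : TopologicalSpace.Opens X := ⟨U, hU⟩
    have : Nonempty U' := ⟨⟨x, hx⟩⟩
    refine ⟨(U'.openPartialHomeomorphSubtypeCoe this).symm.trans
      (Topology.IsOpenEmbedding.toOpenPartialHomeomorph (X := U') e he), ?_⟩
    simpa using! (show x ∈ U' from hx)
  choose c hc using h'
  exact ⟨{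
    atlas := Set.range c
    chartAt := c
    mem_chart_source := hc
    chart_mem_atlas := fun x => ⟨x, rfl⟩ }⟩

end Star

/-! ## Weights on chains of sets -/

section Sorting

variable {ι S : Type*} [Fintype ι]

-- The sets of nonzero weight that do not contain A form a chain, so a point of A missing from the
-- largest of them is missing from all. At this point the weighted indicator sum counts exactly the
-- sets containing A.
open Classical in
theorem exists_tail_eq {D : ι → Set S} {g : ι → ℝ}
    (hc : ∀ i j, g i ≠ 0 → g j ≠ 0 → D i ⊆ D j ∨ D j ⊆ D i) {A : Set S} (hA : A.Nonempty) :
    ∃ s ∈ A, ∑ i, (if s ∈ D i then g i else 0) = ∑ i, (if A ⊆ D i then g i else 0) := by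
  have key : ∃ s ∈ A, ∀ i, g i ≠ 0 → s ∈ D i → A ⊆ D i := by
    by_cases hne : ∃ i, g i ≠ 0 ∧ ¬ A ⊆ D i
    · obtain ⟨i, hi, hmax⟩ := Set.Finite.exists_maximalFor D {i | g i ≠ 0 ∧ ¬ A ⊆ D i}
        (Set.toFinite _) hne
      obtain ⟨s, hs, hsi⟩ := Set.not_subset.1 hi.2
      refine ⟨s, hs, fun j hj hsj => ?_⟩
      by_contra hAj
      rcases hc i j hi.1 hj with h | h
      · exact hsi (hmax ⟨hj, hAj⟩ h hsj)
      · exact hsi (h hsj)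
    · push Not at hne
      obtain ⟨s, hs⟩ := hA
      exact ⟨s, hs, fun i hi _ => hne i hi⟩
  obtain ⟨s, hs, h⟩ := key
  refine ⟨s, hs, Finset.sum_congr rfl fun i _ => ?_⟩
  by_cases hi : g i = 0
  · simp [hi]
  · by_cases hA : A ⊆ D i
    · simp [hA, hA hs]
    · have hsi : s ∉ D i := fun hsi => hA (h i hi hsi)
      simp [hA, hsi]

open Classical in
/-- Nonnegative weights on a chain of nonempty sets are determined by the sum of the weighted
indicator functions. -/
theorem eq_of_sum_indicator_eq [Finite S] {D : ι → Set S} {g g' : ι → ℝ} (h0 : ∀ i, 0 ≤ g i)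
    (h0' : ∀ i, 0 ≤ g' i) (hc : ∀ i j, g i ≠ 0 → g j ≠ 0 → D i ⊆ D j ∨ D j ⊆ D i)
    (hc' : ∀ i j, g' i ≠ 0 → g' j ≠ 0 → D i ⊆ D j ∨ D j ⊆ D i)
    (hne : ∀ i, g i ≠ 0 ∨ g' i ≠ 0 → (D i).Nonempty)
    (hinj : ∀ i j, (g i ≠ 0 ∨ g' i ≠ 0) → (g j ≠ 0 ∨ g' j ≠ 0) → D i = D j → i = j)
    (h : ∀ s, ∑ i, (if s ∈ D i then g i else 0) = ∑ i, (if s ∈ D i then g' i else 0)) :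
    g = g' := by
  -- The total weight of the sets containing A is the minimum over A of the indicator sum, so it is
  -- the same for g and g'.
  have htail : ∀ A : Set S, A.Nonempty →
      ∑ i, (if A ⊆ D i then g i else 0) = ∑ i, (if A ⊆ D i then g' i else 0) := by
    have hle : ∀ (f : ι → ℝ), (∀ i, 0 ≤ f i) → ∀ (A : Set S), ∀ s ∈ A,
        ∑ i, (if A ⊆ D i then f i else 0) ≤ ∑ i, (if s ∈ D i then f i else 0) := by
      intro f hf A s hs
      refine Finset.sum_le_sum fun i _ => ?_
      by_cases hA : A ⊆ D i
      · simp [hA, hA hs]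
      · simp only [hA, if_false]
        split_ifs <;> simp [hf]
    intro A hA
    obtain ⟨s, hs, h1⟩ := exists_tail_eq hc hA
    obtain ⟨s', hs', h1'⟩ := exists_tail_eq hc' hA
    apply le_antisymm
    · rw [← h1', ← h]; exact hle g h0 A s' hs'
    · rw [← h1, h]; exact hle g' h0' A s hs
  by_contra hcon
  have hcon' : {i | g i ≠ g' i}.Nonempty := by
    by_contra hemp
    rw [Set.not_nonempty_iff_eq_empty] at hemp
    exact hcon (funext fun i => by
      by_contra hi
      exact (hemp ▸ (show i ∈ {i | g i ≠ g' i} from hi) : i ∈ (∅ : Set ι)))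
  -- At a maximal set where the weights differ, the totals over its supersets differ by that one
  -- weight only.
  obtain ⟨i, hi, hmax⟩ := Set.Finite.exists_maximalFor D _ (Set.toFinite _) hcon'
  have hi' : g i ≠ 0 ∨ g' i ≠ 0 := by
    by_contra hcon
    push Not at hcon
    exact hi (hcon.1.trans hcon.2.symm)
  have h1 := htail (D i) (hne i hi')
  rw [← sub_eq_zero, ← Finset.sum_sub_distrib, Finset.sum_eq_single i] at h1
  · simp only [subset_rfl, if_true] at h1
    exact hi (sub_eq_zero.1 h1)
  · intro j _ hji
    by_cases hD : D i ⊆ D j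
    · simp only [hD, if_true, sub_eq_zero]
      by_contra hj
      have hj' : g j ≠ 0 ∨ g' j ≠ 0 := by
        by_contra hcon
        push Not at hcon
        exact hj (hcon.1.trans hcon.2.symm)
      exact hji (hinj j i hj' hi' (le_antisymm (hmax hj hD) hD))
    · simp [hD]
  · simp

open Classical in
/-- Every nonnegative function is a sum of weighted indicator functions of a chain of subsets of
its support. -/
theorem exists_sum_indicator_eq [Finite S] {D : ι → Set S} {J : Set ι} {x : S → ℝ}
    (hx : ∀ s, 0 ≤ x s)
    (hD : ∀ A : Set S, A.Nonempty → A ⊆ Function.support x → ∃ i ∈ J, D i = A) :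
    ∃ g : ι → ℝ, (∀ i, 0 ≤ g i) ∧ (∀ i, g i ≠ 0 → i ∈ J ∧ D i ⊆ Function.support x) ∧
      (∀ i j, g i ≠ 0 → g j ≠ 0 → D i ⊆ D j ∨ D j ⊆ D i) ∧
      ∀ s, ∑ i, (if s ∈ D i then g i else 0) = x s := by
  induction hn : (Function.support x).ncard using Nat.strong_induction_on generalizing x with
  | _ n ih =>
    subst hn
    by_cases hx0 : x = 0
    · exact ⟨0, by simp, by simp, by simp, by simp [hx0]⟩
    have hne : (Function.support x).Nonempty := Function.support_nonempty_iff.2 hx0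
    obtain ⟨s₀, hs₀, hmin⟩ := Set.exists_min_image _ x (Set.toFinite _) hne
    have hm : 0 < x s₀ := lt_of_le_of_ne (hx s₀) (Ne.symm hs₀)
    -- Peel off the bottom layer: subtract the least nonzero value on the whole support. This
    -- empties at least one coordinate, and the later sets are contained in the support just used.
    set x' : S → ℝ := fun s => if s ∈ Function.support x then x s - x s₀ else 0 with hx'
    have hsupp : Function.support x' ⊆ Function.support x := by
      intro s hs
      by_contra h
      exact hs (by simp only [hx', h, if_false])
    have hlt : (Function.support x').ncard < (Function.support x).ncard := by
      refine Set.ncard_lt_ncard ⟨hsupp, fun h => h hs₀ ?_⟩ (Set.toFinite _)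
      simp [hx']
    obtain ⟨g, hg0, hgJ, hgc, hgs⟩ := ih _ hlt (x := x') (fun s => by
      simp only [hx']
      split_ifs with h
      · linarith [hmin s h]
      · exact le_rfl) (fun A hA h => hD A hA (h.trans hsupp)) rfl
    obtain ⟨i, hiJ, hi⟩ := hD _ hne subset_rfl
    refine ⟨g + Pi.single i (x s₀), ?_, ?_, ?_, ?_⟩
    · intro j
      have : 0 ≤ (Pi.single i (x s₀) : ι → ℝ) j := by
        by_cases h : j = i
        · subst h; simp [hm.le]
        · simp [h]
      exact add_nonneg (hg0 j) this
    · intro j hj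
      by_cases h : j = i
      · subst h; exact ⟨hiJ, hi.le⟩
      · have := hgJ j (by simpa [h] using hj)
        exact ⟨this.1, this.2.trans hsupp⟩
    · intro j k hj hk
      by_cases hji : j = i
      · subst hji
        right
        by_cases hkj : k = j
        · rw [hkj]
        · rw [hi]; exact ((hgJ k (by simpa [hkj] using hk)).2).trans hsupp
      · by_cases hki : k = i
        · subst hki
          left
          rw [hi]; exact ((hgJ j (by simpa [hji] using hj)).2).trans hsupp
        · exact hgc j k (by simpa [hji] using hj) (by simpa [hki] using hk)
    · intro s
      have h1 : ∀ j, (if s ∈ D j then (g + Pi.single i (x s₀) : ι → ℝ) j else 0) =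
          (if s ∈ D j then g j else 0) +
            (if j = i then (if s ∈ D i then x s₀ else 0) else 0) := by
        intro j
        by_cases hji : j = i
        · subst hji; simp; split_ifs <;> simp
        · simp [hji]
      simp only [h1, Finset.sum_add_distrib, hgs, Finset.sum_ite_eq', Finset.mem_univ, if_true, hi,
        hx']
      by_cases hs : s ∈ Function.support x
      · simp only [hs, if_true]; ring
      · simp only [hs, if_false]
        rw [Function.notMem_support] at hs
        rw [hs, add_zero]

end Sorting

/-! ## Spherical cosets -/

section Cosets

variable {S W : Type*} [Group W] {gen : S → W}

theorem mem_coset {w v : W} {T : Set S} {hT : IsSpherical gen T} :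
    v ∈ (coset gen w T hT).1 ↔ w⁻¹ * v ∈ parabolic gen T := by
  rw [coset, Set.mem_smul_set_iff_inv_smul_mem]; rfl

theorem self_mem_coset (w : W) {T : Set S} (hT : IsSpherical gen T) :
    w ∈ (coset gen w T hT).1 := by
  rw [mem_coset, inv_mul_cancel]; exact one_mem _

theorem coset_eq_of_mem {w v : W} {T : Set S} {hT : IsSpherical gen T}
    (h : v ∈ (coset gen w T hT).1) : coset gen w T hT = coset gen v T hT := by
  rw [mem_coset] at h
  apply Subtype.ext
  ext x
  rw [mem_coset, mem_coset]
  have : w⁻¹ * x = (w⁻¹ * v) * (v⁻¹ * x) := by group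
  rw [this, Subgroup.mul_mem_cancel_left _ h]

theorem SphericalCoset.exists_eq (C : SphericalCoset gen) :
    ∃ (w : W) (T : Set S) (hT : IsSpherical gen T), C = coset gen w T hT := by
  obtain ⟨C, w, T, hT, rfl⟩ := C
  exact ⟨w, T, hT, rfl⟩

theorem SphericalCoset.nonempty (C : SphericalCoset gen) : C.1.Nonempty := by
  obtain ⟨w, T, hT, rfl⟩ := C.exists_eq
  exact ⟨w, self_mem_coset w hT⟩

theorem coset_le_coset (w : W) {T T' : Set S} (hT : IsSpherical gen T) (hT' : IsSpherical gen T')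
    (h : T ⊆ T') : coset gen w T hT ≤ coset gen w T' hT' :=
  Set.smul_set_mono (parabolic_mono h)

theorem isSpherical_empty : IsSpherical gen ∅ := by
  rw [IsSpherical, parabolic_empty]; infer_instance

/-- The type of a spherical coset. -/
def cosetType (C : SphericalCoset gen) : Set S := {s | ∀ v ∈ C.1, v * gen s ∈ C.1}

variable {M : CoxeterMatrix S} {cs : CoxeterSystem M W}

theorem cosetType_coset (hM : IsEvenMatrix M) (w : W) {T : Set S} (hT : IsSpherical cs.simple T) :
    cosetType (coset cs.simple w T hT) = T := by
  ext s
  constructor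
  · intro h
    have := h w (self_mem_coset w hT)
    rwa [mem_coset, inv_mul_cancel_left, simple_mem_parabolic_iff cs hM] at this
  · intro h v hv
    rw [mem_coset] at hv ⊢
    rw [← mul_assoc]
    exact mul_mem hv (gen_mem_parabolic h)

theorem isSpherical_cosetType (hM : IsEvenMatrix M) (C : SphericalCoset cs.simple) :
    IsSpherical cs.simple (cosetType C) := by
  obtain ⟨w, T, hT, rfl⟩ := C.exists_eq
  rwa [cosetType_coset hM]

theorem SphericalCoset.eq_coset (hM : IsEvenMatrix M) (C : SphericalCoset cs.simple) {v : W}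
    (hv : v ∈ C.1) : C = coset cs.simple v (cosetType C) (isSpherical_cosetType hM C) := by
  obtain ⟨w, T, hT, rfl⟩ := C.exists_eq
  simp only [cosetType_coset hM]
  exact coset_eq_of_mem hv

theorem SphericalCoset.mem_iff (hM : IsEvenMatrix M) (C : SphericalCoset cs.simple) {v u : W}
    (hv : v ∈ C.1) : u ∈ C.1 ↔ v⁻¹ * u ∈ parabolic cs.simple (cosetType C) := by
  nth_rewrite 1 [C.eq_coset hM hv]
  exact mem_coset

theorem cosetType_mono (hM : IsEvenMatrix M) {C D : SphericalCoset cs.simple} (h : C ≤ D) :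
    cosetType C ⊆ cosetType D := by
  obtain ⟨v, hv⟩ := C.nonempty
  rw [← parabolic_le_iff cs hM]
  intro x hx
  have h1 : v * x ∈ C.1 := by rwa [C.mem_iff hM hv, inv_mul_cancel_left]
  have h2 : v * x ∈ D.1 := h h1
  rwa [D.mem_iff hM (h hv), inv_mul_cancel_left] at h2

theorem le_of_cosetType_subset (hM : IsEvenMatrix M) {C D : SphericalCoset cs.simple} {v : W}
    (hC : v ∈ C.1) (hD : v ∈ D.1) (h : cosetType C ⊆ cosetType D) : C ≤ D := by
  rw [C.eq_coset hM hC, D.eq_coset hM hD]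
  exact coset_le_coset v _ _ h

theorem eq_of_cosetType_eq (hM : IsEvenMatrix M) {C D : SphericalCoset cs.simple} {v : W}
    (hC : v ∈ C.1) (hD : v ∈ D.1) (h : cosetType C = cosetType D) : C = D :=
  le_antisymm (le_of_cosetType_subset hM hC hD h.le) (le_of_cosetType_subset hM hD hC h.ge)

/-- Cosets below a are subsets of a finite set; cosets above a share a vertex and are therefore told
apart by their types. -/
theorem finite_comparables [Finite S] (hM : IsEvenMatrix M) (a : SphericalCoset cs.simple) :
    Finite (comparables a) := by
  have h1 : Set.Finite {C : SphericalCoset cs.simple | C ≤ a} := by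
    have hfin : a.1.Finite := by
      obtain ⟨w, T, hT, rfl⟩ := a.exists_eq
      have : Finite (parabolic cs.simple T) := hT
      exact Set.Finite.smul_set (Set.toFinite _)
    exact Set.Finite.of_finite_image (f := Subtype.val)
      (hfin.finite_subsets.subset (by rintro _ ⟨C, hC, rfl⟩; exact hC))
      Subtype.val_injective.injOn
  have h2 : Set.Finite {C : SphericalCoset cs.simple | a ≤ C} := by
    obtain ⟨v, hv⟩ := a.nonempty
    exact Set.Finite.of_finite_image (f := cosetType) (Set.toFinite _)
      (fun C hC D hD h => eq_of_cosetType_eq hM (hC hv) (hD hv) h)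
  exact ((h1.union h2).subset fun C hC => hC.2).to_subtype

end Cosets

/-! ## Local structure of the Davis complex -/

section Local

variable {S W : Type*} [Group W] {M : CoxeterMatrix S} {cs : CoxeterSystem M W}

open Classical in
/-- The point of the closed chamber that represents the coset `W_A`. -/
def chamberPoint (A : Set S) (s : S) : ℝ := if s ∈ A then 0 else 1

/-- The point representing the spherical coset `w⁻¹ C` in the dual representation. -/
def barycenter (hM : IsEvenMatrix M) (w : W) (C : SphericalCoset cs.simple) : S → ℝ :=
  dualRep cs hM (w⁻¹ * C.nonempty.some) (chamberPoint (cosetType C))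

/-- The choice of vertex in C is immaterial, because the parabolic subgroup of the type of C fixes
the corresponding chamber point. -/
theorem barycenter_eq (hM : IsEvenMatrix M) (w : W) {C : SphericalCoset cs.simple} {u : W}
    (hu : u ∈ C.1) :
    barycenter hM w C = dualRep cs hM (w⁻¹ * u) (chamberPoint (cosetType C)) := by
  have h := (C.mem_iff hM hu).1 C.nonempty.some_mem
  have h1 : w⁻¹ * C.nonempty.some = (w⁻¹ * u) * (u⁻¹ * C.nonempty.some) := by group
  rw [barycenter, h1, dualRep_mul_apply, dualRep_eq_self cs hM h]
  intro s hs
  simp [chamberPoint, hs]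

open Classical in
/-- The coordinates of a coset comparable to `w W_T`: those of a smaller coset lie in the space
on which `W_T` acts, those of a larger one in the cone over the link of `T`. -/
def localVector (hM : IsEvenMatrix M) (w : W) {T : Set S} (hT : IsSpherical cs.simple T)
    (C : comparables (coset cs.simple w T hT)) : (T → ℝ) × (S → ℝ) :=
  if C.1 ≤ coset cs.simple w T hT then (fun s => barycenter hM w C.1 s, 0)
  else (0, fun s => if s ∈ cosetType C.1 \ T then 1 else 0)

variable {hM : IsEvenMatrix M} {w : W} {T : Set S} {hT : IsSpherical cs.simple T}

theorem mem_of_le_coset {C : comparables (coset cs.simple w T hT)}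
    (h : ¬ C.1 ≤ coset cs.simple w T hT) {u : W} (hu : w⁻¹ * u ∈ parabolic cs.simple T) :
    u ∈ C.1.1 :=
  (C.2.2.resolve_left h) (mem_coset.2 hu)

theorem cosetType_ne_of_comparables (hM : IsEvenMatrix M)
    (C : comparables (coset cs.simple w T hT)) : cosetType C.1 ≠ T := by
  intro h
  have h' : cosetType C.1 = cosetType (coset cs.simple w T hT) := by rw [h, cosetType_coset hM]
  obtain ⟨v, hv, hv'⟩ : ∃ v, v ∈ C.1.1 ∧ v ∈ (coset cs.simple w T hT).1 := by
    rcases C.2.2 with hle | hle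
    · obtain ⟨v, hv⟩ := C.1.nonempty
      exact ⟨v, hv, hle hv⟩
    · obtain ⟨v, hv⟩ := (coset cs.simple w T hT).nonempty
      exact ⟨v, hle hv, hv⟩
  exact C.2.1 (eq_of_cosetType_eq hM hv hv' h')

theorem cosetType_subset_of_le (hM : IsEvenMatrix M) {C : comparables (coset cs.simple w T hT)}
    (h : C.1 ≤ coset cs.simple w T hT) : cosetType C.1 ⊆ T := by
  have := cosetType_mono hM h
  rwa [cosetType_coset hM] at this

theorem subset_cosetType_of_not_le (hM : IsEvenMatrix M)
    {C : comparables (coset cs.simple w T hT)}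
    (h : ¬ C.1 ≤ coset cs.simple w T hT) : T ⊆ cosetType C.1 := by
  have := cosetType_mono hM (C.2.2.resolve_left h)
  rwa [cosetType_coset hM] at this

variable [Fintype (comparables (coset cs.simple w T hT))]

/-- The linear map comparing the open star of `w W_T` with a product of cones. -/
def localMap (hM : IsEvenMatrix M) (w : W) {T : Set S} (hT : IsSpherical cs.simple T)
    [Fintype (comparables (coset cs.simple w T hT))] :
    (comparables (coset cs.simple w T hT) → ℝ) →ₗ[ℝ] (T → ℝ) × (S → ℝ) :=
  Fintype.linearCombination ℝ (localVector hM w hT)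

open Classical in
theorem localMap_snd (g : comparables (coset cs.simple w T hT) → ℝ) (s : S) :
    (localMap hM w hT g).2 s =
      ∑ C, if s ∈ cosetType C.1 \ T then
        (if C.1 ≤ coset cs.simple w T hT then 0 else g C) else 0 := by
  rw [localMap, Fintype.linearCombination_apply, Prod.snd_sum, Finset.sum_apply]
  refine Finset.sum_congr rfl fun C _ => ?_
  by_cases h : C.1 ≤ coset cs.simple w T hT
  · simp [localVector, h]
  · by_cases hs : s ∈ cosetType C.1 \ T
    · simp only [localVector, h, hs, if_true, if_false]
      simp
      simp_all
    · simp only [localVector, h, hs, if_false]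
      simp
      simp_all

-- All lower cosets of nonzero weight contain u, so their barycenters lie in one chamber; moved back
-- by w⁻¹u, they contribute weighted indicators of T minus their types.
open Classical in
theorem localMap_fst {g : comparables (coset cs.simple w T hT) → ℝ} {u : W}
    (huT : w⁻¹ * u ∈ parabolic cs.simple T)
    (hu : ∀ C, g C ≠ 0 → C.1 ≤ coset cs.simple w T hT → u ∈ C.1.1) (s : T) :
    (localMap hM w hT g).1 s =
      dualRep cs hM (w⁻¹ * u) (fun s => ∑ C, if s ∈ T \ cosetType C.1 then
        (if C.1 ≤ coset cs.simple w T hT then g C else 0) else 0) s := by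
  have h1 : ∀ s ∈ T, (∑ C, if s ∈ T \ cosetType C.1 then
        (if C.1 ≤ coset cs.simple w T hT then g C else 0) else 0) =
      (∑ C, (if C.1 ≤ coset cs.simple w T hT then g C else 0) •
        chamberPoint (cosetType C.1)) s := by
    intro s hs
    rw [Finset.sum_apply]
    refine Finset.sum_congr rfl fun C _ => ?_
    by_cases h : s ∈ cosetType C.1 <;> simp [hs, h, chamberPoint]
  rw [dualRep_congr cs hM huT h1 s s.2, map_sum, Finset.sum_apply, localMap,
    Fintype.linearCombination_apply, Prod.fst_sum, Finset.sum_apply]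
  refine Finset.sum_congr rfl fun C _ => ?_
  by_cases h : C.1 ≤ coset cs.simple w T hT
  · by_cases hC : g C = 0
    · simp [hC]
    · simp [localVector, h, barycenter_eq hM w (hu C hC h)]
  · simp [localVector, h]

/-- Any element of the least weighted coset below wW_T works; if there is none, w does. -/
theorem exists_common_mem {g : comparables (coset cs.simple w T hT) → ℝ}
    (hg : g ∈ chainCone (comparables (coset cs.simple w T hT))) :
    ∃ u, w⁻¹ * u ∈ parabolic cs.simple T ∧
      ∀ C, g C ≠ 0 → C.1 ≤ coset cs.simple w T hT → u ∈ C.1.1 := by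
  by_cases hne : ∃ C, g C ≠ 0 ∧ C.1 ≤ coset cs.simple w T hT
  · obtain ⟨C, hC, hmin⟩ := Set.Finite.exists_minimalFor
      (fun C : comparables (coset cs.simple w T hT) => C.1)
      {C | g C ≠ 0 ∧ C.1 ≤ coset cs.simple w T hT} (Set.toFinite _) hne
    obtain ⟨u, hu⟩ := C.1.nonempty
    refine ⟨u, mem_coset.1 (hC.2 hu), fun D hD hDT => ?_⟩
    rcases hg.2 C D hC.1 hD with h | h
    · exact h hu
    · exact hmin ⟨hD, hDT⟩ h hu
  · push Not at hne
    exact ⟨w, by rw [inv_mul_cancel]; exact one_mem _, fun C hC h => absurd h (hne C hC)⟩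

/-- The first component determines the part of the chain below wW_T: its representative in the
closed chamber is unique, and the chamber is unique up to the stabilizer. The weights are then
recovered from indicator sums by `eq_of_sum_indicator_eq`. The second component determines the part
above in the same way. -/
theorem injOn_localMap [Finite S] :
    Set.InjOn (localMap hM w hT) (chainCone (comparables (coset cs.simple w T hT))) := by
  classical
  intro g hg g' hg' heq
  obtain ⟨u, huT, hu⟩ := exists_common_mem hg
  obtain ⟨u', huT', hu'⟩ := exists_common_mem hg'
  set x : S → ℝ := fun s => ∑ C, if s ∈ T \ cosetType C.1 then
        (if C.1 ≤ coset cs.simple w T hT then g C else 0) else 0 with hx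
  set x' : S → ℝ := fun s => ∑ C, if s ∈ T \ cosetType C.1 then
        (if C.1 ≤ coset cs.simple w T hT then g' C else 0) else 0 with hx'
  have hpos : ∀ (f : comparables (coset cs.simple w T hT) → ℝ), (∀ C, 0 ≤ f C) → ∀ (s : S)
      (C : comparables (coset cs.simple w T hT)), 0 ≤ if s ∈ T \ cosetType C.1 then
        (if C.1 ≤ coset cs.simple w T hT then f C else 0) else 0 := by
    intro f hf s C
    split_ifs
    · exact hf C
    all_goals exact le_rfl
  have hv : (w⁻¹ * u')⁻¹ * (w⁻¹ * u) = u'⁻¹ * u := by group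
  have hfund := dualRep_fundamental cs hM (T := T) (w := u'⁻¹ * u) (x := x) (y := x')
    (by rw [← hv]; exact mul_mem (inv_mem huT') huT)
    (fun s _ => Finset.sum_nonneg fun C _ => hpos g hg.1 s C)
    (fun s _ => Finset.sum_nonneg fun C _ => hpos g' hg'.1 s C) (by
      intro s hs
      have h1 : ∀ s ∈ T, dualRep cs hM (w⁻¹ * u) x s = dualRep cs hM (w⁻¹ * u') x' s := by
        intro s hs
        have := congrFun (congrArg Prod.fst heq) ⟨s, hs⟩
        rwa [localMap_fst huT hu, localMap_fst huT' hu'] at this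
      have h2 := dualRep_congr cs hM (inv_mem huT') h1 s hs
      rwa [← dualRep_mul_apply, ← dualRep_mul_apply, hv, inv_mul_cancel, map_one] at h2)
  -- The type of a lower coset of nonzero weight contains every zero of x in T, so the coset absorbs
  -- the stabilizer, which contains u'⁻¹u.
  have huu : ∀ C, g C ≠ 0 → C.1 ≤ coset cs.simple w T hT → u' ∈ C.1.1 := by
    intro C hC hCT
    rw [C.1.mem_iff hM (hu C hC hCT)]
    have h3 : u⁻¹ * u' = (u'⁻¹ * u)⁻¹ := by group
    rw [h3]
    refine inv_mem (parabolic_mono ?_ hfund.2)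
    rintro s ⟨hsT, hs⟩
    by_contra hsC
    have h4 := (Finset.sum_eq_zero_iff_of_nonneg fun C _ => hpos g hg.1 s C).1 hs C
      (Finset.mem_univ C)
    rw [if_pos ⟨hsT, hsC⟩, if_pos hCT] at h4
    exact hC h4
  have hlow : (fun C : comparables (coset cs.simple w T hT) =>
        if C.1 ≤ coset cs.simple w T hT then g C else 0) =
      fun C => if C.1 ≤ coset cs.simple w T hT then g' C else 0 := by
    have aux : ∀ {f : comparables (coset cs.simple w T hT) → ℝ} {C},
        (if C.1 ≤ coset cs.simple w T hT then f C else 0) ≠ 0 →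
        C.1 ≤ coset cs.simple w T hT ∧ f C ≠ 0 := by
      intro f C h
      by_cases hC : C.1 ≤ coset cs.simple w T hT
      · rw [if_pos hC] at h; exact ⟨hC, h⟩
      · rw [if_neg hC] at h; exact absurd rfl h
    have auxc : ∀ {f : comparables (coset cs.simple w T hT) → ℝ},
        f ∈ chainCone (comparables (coset cs.simple w T hT)) → ∀ C D,
        (if C.1 ≤ coset cs.simple w T hT then f C else 0) ≠ 0 →
        (if D.1 ≤ coset cs.simple w T hT then f D else 0) ≠ 0 →
        T \ cosetType C.1 ⊆ T \ cosetType D.1 ∨ T \ cosetType D.1 ⊆ T \ cosetType C.1 := by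
      intro f hf C D hC hD
      rcases hf.2 C D (aux hC).2 (aux hD).2 with h | h
      · exact Or.inr (Set.sdiff_subset_sdiff_right (cosetType_mono hM h))
      · exact Or.inl (Set.sdiff_subset_sdiff_right (cosetType_mono hM h))
    have auxu : ∀ C, ((if C.1 ≤ coset cs.simple w T hT then g C else 0) ≠ 0 ∨
        (if C.1 ≤ coset cs.simple w T hT then g' C else 0) ≠ 0) →
        C.1 ≤ coset cs.simple w T hT ∧ u' ∈ C.1.1 := by
      rintro C (h | h)
      · exact ⟨(aux h).1, huu C (aux h).2 (aux h).1⟩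
      · exact ⟨(aux h).1, hu' C (aux h).2 (aux h).1⟩
    refine eq_of_sum_indicator_eq (D := fun C => T \ cosetType C.1) ?_ ?_ (auxc hg) (auxc hg')
      ?_ ?_ ?_
    · intro C; split_ifs
      exacts [hg.1 C, le_rfl]
    · intro C; split_ifs
      exacts [hg'.1 C, le_rfl]
    · intro C hC
      by_contra hemp
      rw [Set.not_nonempty_iff_eq_empty, Set.sdiff_eq_empty] at hemp
      exact cosetType_ne_of_comparables hM C
        (subset_antisymm (cosetType_subset_of_le hM (auxu C hC).1) hemp)
    · intro C D hC hD h
      apply Subtype.ext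
      refine eq_of_cosetType_eq hM (auxu C hC).2 (auxu D hD).2 ?_
      have hC' := cosetType_subset_of_le hM (auxu C hC).1
      have hD' := cosetType_subset_of_le hM (auxu D hD).1
      rw [← Set.sdiff_sdiff_cancel_left hC', h, Set.sdiff_sdiff_cancel_left hD']
    · intro s
      by_cases hs : s ∈ T
      · convert hfund.1 s hs
      · simp [hs]
  have hup : (fun C : comparables (coset cs.simple w T hT) =>
        if C.1 ≤ coset cs.simple w T hT then 0 else g C) =
      fun C => if C.1 ≤ coset cs.simple w T hT then 0 else g' C := by
    have aux : ∀ {f : comparables (coset cs.simple w T hT) → ℝ} {C},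
        (if C.1 ≤ coset cs.simple w T hT then 0 else f C) ≠ 0 →
        ¬ C.1 ≤ coset cs.simple w T hT ∧ f C ≠ 0 := by
      intro f C h
      by_cases hC : C.1 ≤ coset cs.simple w T hT
      · rw [if_pos hC] at h; exact absurd rfl h
      · rw [if_neg hC] at h; exact ⟨hC, h⟩
    have auxc : ∀ {f : comparables (coset cs.simple w T hT) → ℝ},
        f ∈ chainCone (comparables (coset cs.simple w T hT)) → ∀ C D,
        (if C.1 ≤ coset cs.simple w T hT then 0 else f C) ≠ 0 →
        (if D.1 ≤ coset cs.simple w T hT then 0 else f D) ≠ 0 →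
        cosetType C.1 \ T ⊆ cosetType D.1 \ T ∨ cosetType D.1 \ T ⊆ cosetType C.1 \ T := by
      intro f hf C D hC hD
      rcases hf.2 C D (aux hC).2 (aux hD).2 with h | h
      · exact Or.inl (Set.sdiff_subset_sdiff_left (cosetType_mono hM h))
      · exact Or.inr (Set.sdiff_subset_sdiff_left (cosetType_mono hM h))
    have auxu : ∀ C, ((if C.1 ≤ coset cs.simple w T hT then 0 else g C) ≠ 0 ∨
        (if C.1 ≤ coset cs.simple w T hT then 0 else g' C) ≠ 0) →
        ¬ C.1 ≤ coset cs.simple w T hT := by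
      rintro C (h | h)
      · exact (aux h).1
      · exact (aux h).1
    refine eq_of_sum_indicator_eq (D := fun C => cosetType C.1 \ T) ?_ ?_ (auxc hg) (auxc hg')
      ?_ ?_ ?_
    · intro C; split_ifs
      exacts [le_rfl, hg.1 C]
    · intro C; split_ifs
      exacts [le_rfl, hg'.1 C]
    · intro C hC
      by_contra hemp
      rw [Set.not_nonempty_iff_eq_empty, Set.sdiff_eq_empty] at hemp
      exact cosetType_ne_of_comparables hM C
        (subset_antisymm hemp (subset_cosetType_of_not_le hM (auxu C hC)))
    · intro C D hC hD h
      apply Subtype.ext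
      refine eq_of_cosetType_eq hM (mem_of_le_coset (auxu C hC) huT)
        (mem_of_le_coset (auxu D hD) huT) ?_
      have hC' := subset_cosetType_of_not_le hM (auxu C hC)
      have hD' := subset_cosetType_of_not_le hM (auxu D hD)
      rw [← Set.sdiff_union_of_subset hC', h, Set.sdiff_union_of_subset hD']
    · intro s
      have := congrFun (congrArg Prod.snd heq) s
      rw [localMap_snd, localMap_snd] at this
      convert this
  ext C
  have h1 := congrFun hlow C
  have h2 := congrFun hup C
  by_cases hC : C.1 ≤ coset cs.simple w T hT
  · simpa [hC] using h1
  · simpa [hC] using h2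

/-- For surjectivity, v is moved into the closed chamber and y is supported on a simplex of the
link. Both are then cut into layers by `exists_sum_indicator_eq`; the two resulting chains lie below
and above wW_T, so together they form a chain. -/
theorem range_localMap [Finite S] {T : Finset S} {hT : IsSpherical cs.simple (T : Set S)}
    [Fintype (comparables (coset cs.simple w (T : Set S) hT))] :
    localMap hM w hT '' chainCone (comparables (coset cs.simple w (T : Set S) hT)) =
      Set.univ ×ˢ openCone ((nerve cs.simple).link T) := by
  classical
  ext ⟨v, y⟩
  simp only [Set.mem_prod, Set.mem_univ, true_and]
  constructor
  · rintro ⟨g, hg, hgy⟩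
    have hy : y = (localMap hM w hT g).2 := by rw [hgy]
    subst hy
    refine ⟨fun s => ?_, ?_⟩
    · rw [localMap_snd]
      exact Finset.sum_nonneg fun C _ => by
        split_ifs
        exacts [le_rfl, hg.1 C, le_rfl]
    · by_cases h0 : (localMap hM w hT g).2 = 0
      · exact Or.inl h0
      right
      have hmem : ∀ s, (localMap hM w hT g).2 s ≠ 0 → ∃ C, g C ≠ 0 ∧
          ¬ C.1 ≤ coset cs.simple w (T : Set S) hT ∧ s ∈ cosetType C.1 \ (T : Set S) := by
        intro s hs
        rw [localMap_snd] at hs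
        obtain ⟨C, -, hC⟩ := Finset.exists_ne_zero_of_sum_ne_zero hs
        refine ⟨C, ?_⟩
        by_cases h1 : s ∈ cosetType C.1 \ (T : Set S)
        · rw [if_pos h1] at hC
          by_cases h2 : C.1 ≤ coset cs.simple w (T : Set S) hT
          · rw [if_pos h2] at hC; exact absurd rfl hC
          · rw [if_neg h2] at hC; exact ⟨hC, h2, h1⟩
        · rw [if_neg h1] at hC; exact absurd rfl hC
      obtain ⟨s₀, hs₀⟩ := Function.ne_iff.1 h0
      obtain ⟨C₀, hC₀⟩ := hmem s₀ hs₀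
      obtain ⟨D, hD, hmax⟩ := Set.Finite.exists_maximalFor
        (fun C : comparables (coset cs.simple w (T : Set S) hT) => C.1)
        {C | g C ≠ 0 ∧ ¬ C.1 ≤ coset cs.simple w (T : Set S) hT} (Set.toFinite _)
        ⟨C₀, hC₀.1, hC₀.2.1⟩
      have hsub : ∀ s, (localMap hM w hT g).2 s ≠ 0 → s ∈ cosetType D.1 \ (T : Set S) := by
        intro s hs
        obtain ⟨C, hC, hCT, hsC⟩ := hmem s hs
        refine ⟨cosetType_mono hM ?_ hsC.1, hsC.2⟩
        rcases hg.2 C D hC hD.1 with h | h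
        · exact h
        · exact hmax ⟨hC, hCT⟩ h
      refine ⟨(Set.toFinite (Function.support (localMap hM w hT g).2)).toFinset, ⟨?_, ?_,
        (Set.toFinite (cosetType D.1)).toFinset, ⟨?_, ?_⟩, ?_, ?_⟩, by simp⟩
      · exact ⟨s₀, by simpa using hs₀⟩
      · rw [Finset.disjoint_left]
        intro s hs
        have := hsub s (by simpa using hs)
        simpa using this.2
      · exact ⟨s₀, by simpa using (hsub s₀ hs₀).1⟩
      · simpa using isSpherical_cosetType hM D.1
      · intro s hs
        simpa using (hsub s (by simpa using hs)).1
      · intro s hs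
        simpa using subset_cosetType_of_not_le hM hD.2 hs
  · rintro ⟨hy0, hy⟩
    obtain ⟨u₀, hu₀, hdom⟩ := exists_dualRep_nonneg hM hT
      (fun s => if h : s ∈ (T : Set S) then v ⟨s, h⟩ else 0)
    set v' : S → ℝ := fun s => if h : s ∈ (T : Set S) then v ⟨s, h⟩ else 0 with hv'
    -- The vertex of wW_T whose chamber contains v; all lower cosets are taken through it.
    set u := w * u₀⁻¹ with hu
    have hwu : w⁻¹ * u = u₀⁻¹ := by rw [hu]; group
    have huT : w⁻¹ * u ∈ parabolic cs.simple (T : Set S) := by rw [hwu]; exact inv_mem hu₀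
    set x : S → ℝ := fun s => if s ∈ T then dualRep cs hM u₀ v' s else 0 with hx
    have hle : ∀ A : Set S, ∀ hA : IsSpherical cs.simple A, A ⊆ T →
        coset cs.simple u A hA ≤ coset cs.simple w (T : Set S) hT := by
      intro A hA hAT
      rw [coset_eq_of_mem (mem_coset.2 huT)]
      exact coset_le_coset u hA hT hAT
    obtain ⟨gl, hl0, hlJ, hlc, hls⟩ := exists_sum_indicator_eq
      (D := fun C : comparables (coset cs.simple w (T : Set S) hT) => (T : Set S) \ cosetType C.1)
      (J := {C | C.1 ≤ coset cs.simple w (T : Set S) hT ∧ u ∈ C.1.1}) (x := x)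
      (fun s => by
        simp only [hx]; split_ifs with h
        exacts [hdom s h, le_rfl])
      (fun A hA hAx => by
        have hAT : A ⊆ T := fun s hs => by
          by_contra h
          exact hAx hs (if_neg h)
        have hsph : IsSpherical cs.simple ((T : Set S) \ A) := hT.mono Set.sdiff_subset
        refine ⟨⟨coset cs.simple u _ hsph, ?_, Or.inl (hle _ hsph Set.sdiff_subset)⟩,
          ⟨hle _ hsph Set.sdiff_subset, self_mem_coset u hsph⟩, ?_⟩
        · intro h
          have := congrArg cosetType h
          rw [cosetType_coset hM, cosetType_coset hM] at this
          obtain ⟨s, hs⟩ := hA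
          have hsT := hAT hs
          rw [← this] at hsT
          exact hsT.2 hs
        · simp only [cosetType_coset hM]
          exact Set.sdiff_sdiff_cancel_left hAT)
    obtain ⟨gu, hu0, huJ, huc, hus⟩ := exists_sum_indicator_eq
      (D := fun C : comparables (coset cs.simple w (T : Set S) hT) => cosetType C.1 \ (T : Set S))
      (J := {C | ¬ C.1 ≤ coset cs.simple w (T : Set S) hT}) (x := y) hy0
      (fun A hA hAy => by
        obtain rfl | ⟨σ, ⟨hσne, hσT, ρ, hρ, hσρ, hTρ⟩, hσ⟩ := hy
        · obtain ⟨s, hs⟩ := hA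
          exact absurd rfl (hAy hs)
        rw [hσ] at hAy
        have hsph : IsSpherical cs.simple (A ∪ T) :=
          hρ.2.mono (Set.union_subset (hAy.trans (Finset.coe_subset.2 hσρ))
            (Finset.coe_subset.2 hTρ))
        have hAT : Disjoint A T :=
          Set.disjoint_of_subset_left hAy (Finset.disjoint_coe.2 hσT)
        have hnle : ¬ coset cs.simple w _ hsph ≤ coset cs.simple w (T : Set S) hT := by
          intro h
          have := cosetType_mono hM h
          rw [cosetType_coset hM, cosetType_coset hM] at this
          obtain ⟨s, hs⟩ := hA
          exact Set.disjoint_left.1 hAT hs (this (Or.inl hs))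
        refine ⟨⟨coset cs.simple w _ hsph, fun h => hnle h.le,
          Or.inr (coset_le_coset w _ _ Set.subset_union_right)⟩, hnle, ?_⟩
        simp only [cosetType_coset hM]
        rw [Set.union_sdiff_right, hAT.sdiff_eq_left])
    have hsupp : ∀ C, (gl + gu) C ≠ 0 → gl C ≠ 0 ∨ gu C ≠ 0 := by
      intro C h
      by_contra hcon
      push Not at hcon
      exact h (by simp [hcon.1, hcon.2])
    have hlow : ∀ C, (if C.1 ≤ coset cs.simple w (T : Set S) hT then (gl + gu) C else 0) = gl C := by
      intro C
      split_ifs with h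
      · have : gu C = 0 := by
          by_contra hcon
          exact (huJ C hcon).1 h
        simp [this]
      · by_contra hcon
        exact h (hlJ C (Ne.symm hcon)).1.1
    have hupp : ∀ C, (if C.1 ≤ coset cs.simple w (T : Set S) hT then 0 else (gl + gu) C) = gu C := by
      intro C
      split_ifs with h
      · by_contra hcon
        exact (huJ C (Ne.symm hcon)).1 h
      · have : gl C = 0 := by
          by_contra hcon
          exact h (hlJ C hcon).1.1
        simp [this]
    have hlu : ∀ C D, gl C ≠ 0 → gu D ≠ 0 → C.1 ≤ D.1 := fun C D hC hD =>
      (hlJ C hC).1.1.trans (D.2.2.resolve_left (huJ D hD).1)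
    refine ⟨gl + gu, ⟨fun C => add_nonneg (hl0 C) (hu0 C), fun C D hC hD => ?_⟩, ?_⟩
    · rcases hsupp C hC with hC | hC <;> rcases hsupp D hD with hD | hD
      · have hC' := hlJ C hC
        have hD' := hlJ D hD
        have hCT := cosetType_subset_of_le hM hC'.1.1
        have hDT := cosetType_subset_of_le hM hD'.1.1
        rcases hlc C D hC hD with h | h
        · right
          refine le_of_cosetType_subset hM hD'.1.2 hC'.1.2 ?_
          rw [← Set.sdiff_sdiff_cancel_left hCT, ← Set.sdiff_sdiff_cancel_left hDT]
          exact Set.sdiff_subset_sdiff_right h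
        · left
          refine le_of_cosetType_subset hM hC'.1.2 hD'.1.2 ?_
          rw [← Set.sdiff_sdiff_cancel_left hCT, ← Set.sdiff_sdiff_cancel_left hDT]
          exact Set.sdiff_subset_sdiff_right h
      · exact Or.inl (hlu C D hC hD)
      · exact Or.inr (hlu D C hD hC)
      · have hC' := (huJ C hC).1
        have hD' := (huJ D hD).1
        have hCT := subset_cosetType_of_not_le hM hC'
        have hDT := subset_cosetType_of_not_le hM hD'
        rcases huc C D hC hD with h | h
        · left
          refine le_of_cosetType_subset hM (mem_of_le_coset hC' huT) (mem_of_le_coset hD' huT) ?_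
          rw [← Set.sdiff_union_of_subset hCT, ← Set.sdiff_union_of_subset hDT]
          exact Set.union_subset_union_left _ h
        · right
          refine le_of_cosetType_subset hM (mem_of_le_coset hD' huT) (mem_of_le_coset hC' huT) ?_
          rw [← Set.sdiff_union_of_subset hCT, ← Set.sdiff_union_of_subset hDT]
          exact Set.union_subset_union_left _ h
    · refine Prod.ext (funext fun s => ?_) (funext fun s => ?_)
      · rw [localMap_fst huT (fun C hC hCT => by
          rcases hsupp C hC with h | h
          · exact (hlJ C h).1.2
          · exact absurd hCT (huJ C h).1)]
        rw [hwu, dualRep_congr cs hM (inv_mem hu₀) (y := dualRep cs hM u₀ v')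
          (fun r hr => ?_) s s.2, ← dualRep_mul_apply, inv_mul_cancel, map_one]
        · simp [hv']
        · simp only [hlow]
          have hxr : x r = dualRep cs hM u₀ v' r := if_pos hr
          rw [← hxr, ← hls r]
          congr!
      · rw [localMap_snd]
        simp only [hupp]
        rw [← hus s]
        congr!

end Local

/-! ## The Davis complex as a manifold -/

section Manifold

variable {S W : Type*} [Group W] {M : CoxeterMatrix S} (cs : CoxeterSystem M W)

/-- The cone is ℝ^T times the cone over the link of T. The link is S^(d-1) with d + |T| = m, so the
dimensions add up to m whatever the type. -/
theorem nonempty_chainCone_homeomorph [Finite S] (hM : IsEvenMatrix M) {m : ℕ}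
    (h : (nerve cs.simple).IsSphereTriangulation m) (C : SphericalCoset cs.simple) :
    Nonempty (chainCone (comparables C) ≃ₜ EuclideanSpace ℝ (Fin m)) := by
  obtain ⟨w, T, hT, rfl⟩ := C.exists_eq
  obtain ⟨T, rfl⟩ : ∃ T' : Finset S, (T' : Set S) = T := ⟨T.toFinite.toFinset, by simp⟩
  have hfin := finite_comparables hM (coset cs.simple w T hT)
  have := Fintype.ofFinite (comparables (coset cs.simple w T hT))
  have := Fintype.ofFinite S
  obtain ⟨d, hd, e⟩ := h T (by
    rcases T.eq_empty_or_nonempty with h | h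
    · exact Or.inl h
    · exact Or.inr ⟨h, hT⟩)
  obtain ⟨e⟩ := nonempty_openCone_homeomorph e
  have hemb := isClosedEmbedding_of_injOn_cone (isClosed_chainCone _) (zero_mem_chainCone _)
    (smul_mem_chainCone _) (localMap hM w hT) injOn_localMap
  have hrange : Set.range (fun x : chainCone (comparables (coset cs.simple w (T : Set S) hT)) =>
      localMap hM w hT x) = Set.univ ×ˢ openCone ((nerve cs.simple).link T) := by
    rw [← range_localMap (hM := hM) (w := w) (hT := hT), Set.image_eq_range]
  have hrank : Module.finrank ℝ ((↥(T : Set S) → ℝ) × EuclideanSpace ℝ (Fin d)) =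
      Module.finrank ℝ (EuclideanSpace ℝ (Fin m)) := by
    rw [Module.finrank_prod, finrank_euclideanSpace_fin, finrank_euclideanSpace_fin,
      Module.finrank_fintype_fun_eq_card, ← hd, add_comm]
    simp
  have e2 : ((↥(T : Set S) → ℝ) × EuclideanSpace ℝ (Fin d)) ≃L[ℝ] EuclideanSpace ℝ (Fin m) :=
    ContinuousLinearEquiv.ofFinrankEq hrank
  exact ⟨hemb.isEmbedding.toHomeomorph.trans <| (Homeomorph.setCongr hrange).trans <|
    (Homeomorph.Set.prod _ _).trans <| ((Homeomorph.Set.univ _).prodCongr e).trans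
    e2.toHomeomorph⟩

theorem nonempty_chartedSpace_davisComplex [Finite S] (hM : IsEvenMatrix M) {m : ℕ}
    (h : (nerve cs.simple).IsSphereTriangulation m) :
    Nonempty (ChartedSpace (EuclideanSpace ℝ (Fin m)) (davisComplex cs.simple).realization) := by
  refine nonempty_chartedSpace fun f => ?_
  obtain ⟨C, hC⟩ : ∃ C, 0 < f.1 C := by
    obtain ⟨h0, σ, ⟨⟨C, hC⟩, -⟩, hs, -⟩ := f.2
    have : f.1 C ≠ 0 := by rw [← Function.mem_support, hs]; exact hC
    exact ⟨C, lt_of_le_of_ne (h0 C) (Ne.symm this)⟩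
  have := finite_comparables hM C
  obtain ⟨e, he⟩ := exists_isOpenEmbedding_star C
  obtain ⟨e'⟩ := nonempty_chainCone_homeomorph cs hM h C
  refine ⟨{f | 0 < f.1 C}, ?_, hC, e' ∘ e, e'.isOpenEmbedding.comp he⟩
  exact isOpen_lt continuous_const ((continuous_apply C).comp continuous_subtype_val)

/-! ### Paths between points and vertices of the realization of a poset. -/

section Vertices

variable {P : Type*} [PartialOrder P] [DecidableEq P]

theorem single_mem_realization (p : P) :
    (Pi.single p 1 : P → ℝ) ∈ (chainComplex (Set.univ : Set P)).realization := by
  refine ⟨fun q => ?_, {p}, ⟨⟨p, by simp⟩, Set.subset_univ _, by simp⟩, ?_, by simp⟩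
  · by_cases h : q = p
    · subst h; simp
    · simp [h]
  · ext q
    by_cases h : q = p
    · subst h; simp
    · simp [h]

/-- Since p is comparable to the whole support of f, the straight segment stays inside one simplex.
-/
theorem joinedIn_single {f : P → ℝ} (hf : f ∈ (chainComplex (Set.univ : Set P)).realization)
    {p : P} (hp : ∀ q, f q ≠ 0 → q ≤ p ∨ p ≤ q) :
    JoinedIn (chainComplex (Set.univ : Set P)).realization f (Pi.single p 1) := by
  apply JoinedIn.of_segment_subset
  rintro _ ⟨a, b, ha, hb, hab, rfl⟩
  rcases hb.eq_or_lt with rfl | hb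
  · rw [add_zero] at hab; subst hab; simpa using hf
  rcases ha.eq_or_lt with rfl | ha
  · rw [zero_add] at hab; subst hab; simpa using single_mem_realization p
  obtain ⟨h0, σ, ⟨hne, -, hc⟩, hs, h1⟩ := hf
  have hpos : ∀ q, 0 ≤ (Pi.single p 1 : P → ℝ) q := (single_mem_realization p).1
  refine ⟨fun q => add_nonneg (mul_nonneg ha.le (h0 q)) (mul_nonneg hb.le (hpos q)),
    insert p σ, ⟨⟨p, by simp⟩, Set.subset_univ _, ?_⟩, ?_, ?_⟩
  · rw [Finset.coe_insert]
    refine hc.insert fun q hq _ => ?_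
    exact (hp q (by rw [← Function.mem_support, hs]; exact hq)).symm
  · ext q
    simp only [Function.mem_support, Pi.add_apply, Pi.smul_apply, smul_eq_mul, Finset.coe_insert,
      Set.mem_insert_iff, ← hs]
    by_cases h : q = p
    · subst h
      have : 0 ≤ a * f q := mul_nonneg ha.le (h0 q)
      simp only [Pi.single_eq_same, mul_one, true_or, iff_true]
      positivity
    · simp [h, ha.ne']
  · have hf1 : ∑ q ∈ insert p σ, f q = 1 := by
      rw [← h1]
      refine (Finset.sum_subset (Finset.subset_insert p σ) fun q _ hq => ?_).symm
      by_contra hne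
      exact hq (Finset.mem_coe.1 (hs ▸ hne))
    have hp1 : ∑ q ∈ insert p σ, (Pi.single p 1 : P → ℝ) q = 1 := by
      rw [Finset.sum_pi_single']
      simp
    simp only [Pi.add_apply, Pi.smul_apply, smul_eq_mul, Finset.sum_add_distrib, ← Finset.mul_sum,
      hf1, hp1, mul_one, hab]

end Vertices

/-- Vertices w and ws are joined through the coset wW_{s}, the generators link all vertices, and
every point is joined to a vertex through a coset in its support. -/
theorem connectedSpace_davisComplex : ConnectedSpace (davisComplex cs.simple).realization := by
  classical
  rw [← isConnected_iff_connectedSpace]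
  apply IsPathConnected.isConnected
  set X := (davisComplex cs.simple).realization with hX
  have hvert : ∀ w v : W, w⁻¹ * v ∈ Set.range cs.simple → JoinedIn X
      (Pi.single (coset cs.simple w ∅ isSpherical_empty) 1)
      (Pi.single (coset cs.simple v ∅ isSpherical_empty) 1) := by
    rintro w v ⟨s, hs⟩
    have hsp : IsSpherical cs.simple {s} := by
      have := isSpherical_pair (cs := cs) (s := s) (t := s) (by simp)
      simpa using this
    have h1 : ∀ x, w⁻¹ * x ∈ parabolic cs.simple {s} → JoinedIn X
        (Pi.single (coset cs.simple x ∅ isSpherical_empty) 1)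
        (Pi.single (coset cs.simple w {s} hsp) 1) := by
      intro x hx
      refine joinedIn_single (single_mem_realization _) fun q hq => ?_
      by_cases h : q = coset cs.simple x ∅ isSpherical_empty
      · subst h
        left
        rw [coset_eq_of_mem (mem_coset.2 hx)]
        exact coset_le_coset _ _ _ (Set.empty_subset _)
      · simp [h] at hq
    refine (h1 w (by rw [inv_mul_cancel]; exact one_mem _)).trans (h1 v ?_).symm
    rw [← hs]
    exact gen_mem_parabolic rfl
  have hbase : ∀ w : W, JoinedIn X (Pi.single (coset cs.simple 1 ∅ isSpherical_empty) 1)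
      (Pi.single (coset cs.simple w ∅ isSpherical_empty) 1) := by
    intro w
    refine cs.simple_induction_right (p := fun w => JoinedIn X
      (Pi.single (coset cs.simple 1 ∅ isSpherical_empty) 1)
      (Pi.single (coset cs.simple w ∅ isSpherical_empty) 1)) w ?_ ?_
    · exact JoinedIn.refl (single_mem_realization _)
    · intro w s hw
      exact hw.trans (hvert w _ ⟨s, by simp⟩)
  refine ⟨_, single_mem_realization (coset cs.simple 1 ∅ isSpherical_empty), fun {f} hf => ?_⟩
  obtain ⟨h0, σ, ⟨⟨C, hC⟩, -, hc⟩, hs, h1⟩ := hf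
  obtain ⟨w, hw⟩ := C.nonempty
  refine (hbase w).trans (JoinedIn.symm ?_)
  have e1 : JoinedIn X f (Pi.single C 1) := by
    refine joinedIn_single ⟨h0, σ, ⟨⟨C, hC⟩, Set.subset_univ _, hc⟩, hs, h1⟩ fun q hq => ?_
    exact hc.total (hs ▸ hq : q ∈ (σ : Set _)) hC
  refine e1.trans (JoinedIn.symm (joinedIn_single (single_mem_realization _) fun q hq => ?_))
  by_cases h : q = coset cs.simple w ∅ isSpherical_empty
  · subst h
    left
    obtain ⟨v, T, hT, rfl⟩ := C.exists_eq
    rw [coset_eq_of_mem hw]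
    exact coset_le_coset _ _ _ (Set.empty_subset _)
  · simp [h] at hq

theorem countable_sphericalCoset [Finite S] : Countable (SphericalCoset cs.simple) := by
  have : Countable W := cs.wordProd_surjective.countable
  refine Function.Surjective.countable (α := W × {T : Set S // IsSpherical cs.simple T})
    (f := fun x => coset cs.simple x.1 x.2.1 x.2.2) fun C => ?_
  obtain ⟨w, T, hT, rfl⟩ := C.exists_eq
  exact ⟨⟨w, T, hT⟩, rfl⟩

/-- The open stars cover the complex, and the vertex of the coset wW_∅ lies in its own star only. A
finite subcover would leave finitely many w. -/
theorem noncompactSpace_davisComplex [Infinite W] :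
    NoncompactSpace (davisComplex cs.simple).realization := by
  classical
  rw [← not_compactSpace_iff, ← isCompact_iff_compactSpace]
  intro hcomp
  obtain ⟨F, hF⟩ := hcomp.elim_finite_subcover
    (fun C : SphericalCoset cs.simple => {f : SphericalCoset cs.simple → ℝ | 0 < f C})
    (fun C => isOpen_lt continuous_const (continuous_apply C)) (by
      rintro f ⟨h0, σ, ⟨⟨C, hC⟩, -⟩, hs, -⟩
      have : f C ≠ 0 := by rw [← Function.mem_support, hs]; exact hC
      exact Set.mem_iUnion.2 ⟨C, lt_of_le_of_ne (h0 C) (Ne.symm this)⟩)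
  have hinj : Function.Injective
      fun w : W => (coset cs.simple w ∅ isSpherical_empty : SphericalCoset cs.simple) := by
    intro w v h
    have h1 : v ∈ (coset cs.simple w ∅ isSpherical_empty : SphericalCoset cs.simple).1 := by
      simp only at h
      rw [h]
      exact self_mem_coset v _
    rw [mem_coset, parabolic_empty, Subgroup.mem_bot] at h1
    exact inv_mul_eq_one.1 h1
  have hmem : ∀ w : W, coset cs.simple w ∅ isSpherical_empty ∈ F := by
    intro w
    have := hF (single_mem_realization (coset cs.simple w ∅ isSpherical_empty))
    simp only [Set.mem_iUnion, Set.mem_ofPred_eq] at this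
    obtain ⟨C, hC, hpos⟩ := this
    by_cases h : C = coset cs.simple w ∅ isSpherical_empty
    · rwa [← h]
    · simp [h] at hpos
  have : Finite W := Finite.of_injective (fun w => (⟨_, hmem w⟩ : F))
    fun w v h => hinj (congrArg Subtype.val h)
  exact not_finite W

/-- A Coxeter group whose nerve triangulates a nonempty sphere is infinite. -/
theorem infinite_of_isSphereTriangulation [Finite S] {m : ℕ} (hm : 1 ≤ m)
    (h : (nerve cs.simple).IsSphereTriangulation m) : Infinite W := by
  classical
  by_contra hfin
  rw [not_infinite_iff_finite] at hfin
  have := Fintype.ofFinite S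
  have hsph : ∀ T : Set S, IsSpherical cs.simple T := fun T =>
    inferInstanceAs (Finite (parabolic cs.simple T))
  rcases isEmpty_or_nonempty S with hS | ⟨⟨r⟩⟩
  · obtain ⟨d, hd, ⟨e⟩⟩ := h ∅ (Or.inl rfl)
    rw [Finset.card_empty, add_zero] at hd
    have : Nonempty (Fin d) := ⟨⟨0, by omega⟩⟩
    obtain ⟨x, hx⟩ := (NormedSpace.sphere_nonempty (E := EuclideanSpace ℝ (Fin d)) (x := 0)
      (r := 1)).2 zero_le_one
    obtain ⟨-, σ, ⟨⟨s, -⟩, -⟩, -⟩ := (e.symm ⟨x, hx⟩).2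
    exact hS.elim s
  -- For finite W every subset of S is spherical, so the link of S - r is the single point r. A
  -- sphere is never a single point, as antipodes differ.
  · obtain ⟨d, hd, ⟨e⟩⟩ := h (Finset.univ.erase r) (by
      rcases (Finset.univ.erase r).eq_empty_or_nonempty with h | h
      · exact Or.inl h
      · exact Or.inr ⟨h, hsph _⟩)
    have hsub : ∀ f ∈ ((nerve cs.simple).link (Finset.univ.erase r)).realization,
        f = Pi.single r 1 := by
      rintro f ⟨h0, σ, ⟨hne, hd, -⟩, hs, h1⟩
      have hσ : σ = {r} := by
        refine Finset.eq_singleton_iff_nonempty_unique_mem.2 ⟨hne, fun s hs => ?_⟩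
        by_contra hsr
        exact Finset.disjoint_left.1 hd hs (by simp [hsr])
      subst hσ
      ext s
      by_cases hsr : s = r
      · subst hsr; simpa using h1
      · rw [Pi.single_eq_of_ne hsr]
        by_contra hne
        have : s ∈ Function.support f := hne
        rw [hs] at this
        exact hsr (by simpa using this)
    have hmem : (Pi.single r 1 : S → ℝ) ∈
        ((nerve cs.simple).link (Finset.univ.erase r)).realization := by
      refine ⟨fun s => ?_, {r}, ⟨by simp, by simp, Finset.univ, ⟨⟨r, by simp⟩, hsph _⟩,
        Finset.subset_univ _, Finset.subset_univ _⟩, ?_, by simp⟩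
      · by_cases h : s = r
        · subst h; simp
        · simp [h]
      · ext s
        by_cases h : s = r
        · subst h; simp
        · simp [h]
    set x := e ⟨_, hmem⟩ with hx
    have hall : ∀ y, y = x := by
      intro y
      rw [← e.apply_symm_apply y, hx]
      congr 1
      exact Subtype.ext (hsub _ (e.symm y).2)
    have hx1 : ‖(x : EuclideanSpace ℝ (Fin d))‖ = 1 := by
      simp
    have h2 : -x = x := hall (-x)
    have h3 : -(x : EuclideanSpace ℝ (Fin d)) = x := congrArg Subtype.val h2
    have h4 : (x : EuclideanSpace ℝ (Fin d)) = 0 := by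
      have h5 : (2 : ℝ) • (x : EuclideanSpace ℝ (Fin d)) = 0 := by
        rw [two_smul]; nth_rewrite 1 [← h3]; simp
      simpa using h5
    rw [h4, norm_zero] at hx1
    exact zero_ne_one hx1

end Manifold

/-! ## Retractions and subsystems -/

section Subsystem

variable {S W : Type*} [Group W] {M : CoxeterMatrix S} (cs : CoxeterSystem M W)

open Classical in
/-- The retraction of `W` onto `W_T` that kills the generators outside `T`. -/
def retraction (hM : IsEvenMatrix M) (T : Set S) : W →* parabolic cs.simple T :=
  cs.lift ⟨_, retraction_liftable cs hM T⟩

theorem retraction_simple_of_mem (hM : IsEvenMatrix M) {T : Set S} {s : S} (hs : s ∈ T) :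
    (retraction cs hM T (cs.simple s) : W) = cs.simple s := by
  rw [retraction, cs.lift_apply_simple (retraction_liftable cs hM T), dif_pos hs]; rfl

theorem retraction_simple_of_notMem (hM : IsEvenMatrix M) {T : Set S} {s : S} (hs : s ∉ T) :
    retraction cs hM T (cs.simple s) = 1 := by
  rw [retraction, cs.lift_apply_simple (retraction_liftable cs hM T), dif_neg hs]

theorem retraction_of_mem (hM : IsEvenMatrix M) {T : Set S} {w : W}
    (hw : w ∈ parabolic cs.simple T) : (retraction cs hM T w : W) = w := by
  refine parabolic_induction cs (p := fun w => (retraction cs hM T w : W) = w) hw (by simp) ?_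
  intro s hs v _ ih
  rw [map_mul, Subgroup.coe_mul, ih, retraction_simple_of_mem cs hM hs]

theorem retraction_mem (hM : IsEvenMatrix M) (T : Set S) {V : Set S} {w : W}
    (hw : w ∈ parabolic cs.simple V) :
    (retraction cs hM T w : W) ∈ parabolic cs.simple (T ∩ V) := by
  refine parabolic_induction cs
    (p := fun w => (retraction cs hM T w : W) ∈ parabolic cs.simple (T ∩ V)) hw (by simp) ?_
  intro s hs v _ ih
  rw [map_mul, Subgroup.coe_mul]
  refine mul_mem ?_ ih
  by_cases hsT : s ∈ T
  · rw [retraction_simple_of_mem cs hM hsT]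
    exact gen_mem_parabolic ⟨hsT, hs⟩
  · rw [retraction_simple_of_notMem cs hM hsT]
    exact one_mem _

/-- The retraction onto W_T fixes w and carries W_V into W_(T ∩ V). -/
theorem mem_parabolic_inter (hM : IsEvenMatrix M) {T V : Set S} {w : W}
    (hT : w ∈ parabolic cs.simple T) (hV : w ∈ parabolic cs.simple V) :
    w ∈ parabolic cs.simple (T ∩ V) := by
  rw [← retraction_of_mem cs hM hT]
  exact retraction_mem cs hM T hV

theorem simple_commute {s t : S} (h : M s t = 2) :
    cs.simple s * cs.simple t = cs.simple t * cs.simple s := by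
  have := cs.simple_mul_simple_pow s t
  rw [h, pow_two] at this
  rw [← inv_eq_iff_mul_eq_one.2 this, mul_inv_rev, cs.inv_simple, cs.inv_simple]

theorem parabolic_commute {A B : Set S} (h : ∀ a ∈ A, ∀ b ∈ B, M a b = 2) {x y : W}
    (hx : x ∈ parabolic cs.simple A) (hy : y ∈ parabolic cs.simple B) : x * y = y * x := by
  refine parabolic_induction cs (p := fun x => x * y = y * x) hx (by simp) ?_
  intro a ha x _ ih
  have : cs.simple a * y = y * cs.simple a := by
    refine parabolic_induction cs (p := fun y => cs.simple a * y = y * cs.simple a) hy (by simp) ?_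
    intro b hb y _ ih
    rw [← mul_assoc, simple_commute cs (h a ha b hb), mul_assoc, ih, mul_assoc]
  rw [mul_assoc, ih, ← mul_assoc, this, mul_assoc]

theorem exists_eq_mul_of_mem_union {A B : Set S} (h : ∀ a ∈ A, ∀ b ∈ B, M a b = 2) {x : W}
    (hx : x ∈ parabolic cs.simple (A ∪ B)) :
    ∃ y ∈ parabolic cs.simple A, ∃ z ∈ parabolic cs.simple B, x = y * z := by
  refine parabolic_induction cs (p := fun x => ∃ y ∈ parabolic cs.simple A,
    ∃ z ∈ parabolic cs.simple B, x = y * z) hx ⟨1, one_mem _, 1, one_mem _, by simp⟩ ?_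
  rintro s hs _ - ⟨y, hy, z, hz, rfl⟩
  rcases hs with hs | hs
  · exact ⟨cs.simple s * y, mul_mem (gen_mem_parabolic hs) hy, z, hz, by rw [mul_assoc]⟩
  · refine ⟨y, hy, cs.simple s * z, mul_mem (gen_mem_parabolic hs) hz, ?_⟩
    rw [← mul_assoc, ← mul_assoc, parabolic_commute cs h hy (gen_mem_parabolic hs)]

/-- The restriction of a Coxeter matrix to a set of generators. -/
def subMatrix (M : CoxeterMatrix S) (V : Set S) : CoxeterMatrix V where
  M := fun i j => M i j
  isSymm := by ext i j; exact M.symmetric j i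
  diagonal i := M.diagonal i
  off_diagonal i j h := M.off_diagonal i j fun h' => h (Subtype.ext h')

theorem isEvenMatrix_subMatrix (hM : IsEvenMatrix M) (V : Set S) :
    IsEvenMatrix (subMatrix M V) :=
  fun s t h => hM s t fun h' => h (Subtype.ext h')

theorem subGen_isLiftable (V : Set S) : (subMatrix M V).IsLiftable (subGen cs.simple V) := by
  intro i j
  apply Subtype.ext
  rw [Subgroup.coe_pow, Subgroup.coe_mul]
  exact cs.simple_mul_simple_pow i j

-- A relation between a kept and a killed generator becomes an even power of an involution; this is
-- where evenness enters.
open Classical in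
theorem subMatrix_isLiftable (hM : IsEvenMatrix M) (V : Set S) :
    M.IsLiftable (fun s => if h : s ∈ V then (subMatrix M V).simple ⟨s, h⟩ else 1) := by
  intro i j
  have hsq : ∀ k : V, (subMatrix M V).simple k * (subMatrix M V).simple k = 1 := fun k =>
    (subMatrix M V).toCoxeterSystem.simple_mul_simple_self k
  by_cases hij : i = j
  · subst hij
    rw [M.diagonal, pow_one]
    by_cases h : i ∈ V <;> simp [h, hsq]
  have hpow : ∀ k : V, (subMatrix M V).simple k ^ M i j = 1 := by
    intro k
    rcases hM i j hij with h | ⟨l, hl⟩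
    · rw [h, pow_zero]
    · rw [hl, ← two_mul, pow_mul, pow_two, hsq, one_pow]
  by_cases hi : i ∈ V <;> by_cases hj : j ∈ V
  · simp only [hi, hj, dif_pos]
    exact (subMatrix M V).toCoxeterSystem.simple_mul_simple_pow ⟨i, hi⟩ ⟨j, hj⟩
  · simp [hi, hj, hpow]
  · simp [hi, hj, hpow]
  · simp [hi, hj]

/-- The subgroup `W_V` of an even Coxeter system is a Coxeter group with generators `V`. -/
def subSystem (hM : IsEvenMatrix M) (V : Set S) :
    CoxeterSystem (subMatrix M V) (parabolic cs.simple V) where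
  mulEquiv := MulEquiv.symm <| MonoidHom.toMulEquiv
    ((subMatrix M V).toCoxeterSystem.lift ⟨_, subGen_isLiftable cs V⟩)
    ((cs.lift ⟨_, subMatrix_isLiftable hM V⟩).comp (parabolic cs.simple V).subtype)
    (by
      apply (subMatrix M V).toCoxeterSystem.ext_simple
      intro i
      rw [MonoidHom.comp_apply,
        (subMatrix M V).toCoxeterSystem.lift_apply_simple (subGen_isLiftable cs V)]
      have : (parabolic cs.simple V).subtype (subGen cs.simple V i) = cs.simple i := rfl
      rw [MonoidHom.comp_apply, this, cs.lift_apply_simple (subMatrix_isLiftable hM V),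
        dif_pos i.2]
      rfl)
    (by
      ext ⟨w, hw⟩
      refine parabolic_induction cs (p := fun w =>
        ((subMatrix M V).toCoxeterSystem.lift ⟨_, subGen_isLiftable cs V⟩
          (cs.lift ⟨_, subMatrix_isLiftable hM V⟩ w) : W) = w) hw (by simp) ?_
      intro s hs v _ ih
      rw [map_mul, map_mul, Subgroup.coe_mul, ih,
        cs.lift_apply_simple (subMatrix_isLiftable hM V), dif_pos hs]
      congr 1
      have := (subMatrix M V).toCoxeterSystem.lift_apply_simple (subGen_isLiftable cs V) ⟨s, hs⟩
      exact congrArg Subtype.val this)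

theorem subSystem_simple (hM : IsEvenMatrix M) (V : Set S) :
    (subSystem cs hM V).simple = subGen cs.simple V := by
  funext i
  exact (subMatrix M V).toCoxeterSystem.lift_apply_simple (subGen_isLiftable cs V) i

/-! ### Parabolic subgroups and spherical subsets of a subsystem. -/

variable {G I : Type*} [Group G]

theorem map_parabolic_subGen (gen : I → G) (V : Set I) (A : Set V) :
    (parabolic (subGen gen V) A).map (parabolic gen V).subtype =
      parabolic gen (Subtype.val '' A) := by
  change (Subgroup.closure _).map _ = Subgroup.closure _
  rw [MonoidHom.map_closure, Set.image_image, Set.image_image]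
  rfl

theorem isSpherical_subGen_iff (gen : I → G) (V : Set I) (A : Set V) :
    IsSpherical (subGen gen V) A ↔ IsSpherical gen (Subtype.val '' A) := by
  rw [IsSpherical, IsSpherical, ← map_parabolic_subGen]
  exact ((parabolic (subGen gen V) A).equivMapOfInjective _
    (parabolic gen V).subtype_injective).toEquiv.finite_iff

theorem coe_mem_parabolic_iff (hM : IsEvenMatrix M) {V A : Set S} (x : parabolic cs.simple V) :
    (x : W) ∈ parabolic cs.simple A ↔
      x ∈ parabolic (subGen cs.simple V) (Subtype.val ⁻¹' A) := by
  have h : x ∈ parabolic (subGen cs.simple V) (Subtype.val ⁻¹' A) ↔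
      (x : W) ∈ parabolic cs.simple (V ∩ A) := by
    rw [← Subtype.image_preimage_coe, ← map_parabolic_subGen]
    exact (Subgroup.mem_map_iff_mem (parabolic cs.simple V).subtype_injective).symm
  rw [h]
  exact ⟨fun hx => mem_parabolic_inter cs hM x.2 hx,
    fun hx => parabolic_mono Set.inter_subset_right hx⟩

end Subsystem

/-! ## Consequences of flagness -/

section Flag

variable {S W : Type*} [Group W] {M : CoxeterMatrix S} {cs : CoxeterSystem M W} {s t : S}

theorem ne_of_mem_bigSet (hs : s ∈ bigSet M t) : s ≠ t := by
  rintro rfl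
  have := hs.2
  simp at this

theorem notMem_commSet : s ∉ commSet M s t ∧ t ∉ commSet M s t :=
  ⟨fun h => by simpa using h.2, fun h => by simpa using h.1⟩

variable [Finite S]

theorem isSpherical_of_pairwise (hflag : (nerve cs.simple).IsFlag) {A : Set S}
    (h : ∀ u ∈ A, ∀ v ∈ A, M u v ≠ 0) : IsSpherical cs.simple A := by
  classical
  rcases A.eq_empty_or_nonempty with rfl | hne
  · exact isSpherical_empty
  have := hflag A.toFinite.toFinset (by simpa using hne) fun u hu v hv =>
    ⟨{u, v}, ⟨⟨u, by simp⟩, by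
      simpa using isSpherical_pair (h u (by simpa using hu) v (by simpa using hv))⟩,
      by simp, by simp⟩
  simpa using this.2

/-- The edge st has label above 2, so by `IsSpherical.eq_two` no other generator of A fails to
commute with s or t. -/
theorem mem_commSet_of_isSpherical (hM : IsEvenMatrix M) (hs : s ∈ bigSet M t) {A : Set S}
    (hA : IsSpherical cs.simple A) (hsA : s ∈ A) (htA : t ∈ A) {r : S} (hr : r ∈ A) (hrs : r ≠ s)
    (hrt : r ≠ t) : r ∈ commSet M s t := by
  have hst := ne_of_mem_bigSet hs
  have h2 := hs.2
  refine ⟨hA.eq_two hM hr htA hsA hrt hrs hst.symm ?_, hA.eq_two hM hr hsA htA hrs hrt hst ?_⟩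
  · rw [M.symmetric]; omega
  · omega

theorem eq_of_mem_bigSet (hM : IsEvenMatrix M) (hs : s ∈ bigSet M t) {A : Set S}
    (hA : IsSpherical cs.simple A) (hsA : s ∈ A) (htA : t ∈ A) {r : S} (hr : r ∈ A)
    (hrb : r ∈ bigSet M t) : r = s := by
  by_contra hrs
  have h1 := (mem_commSet_of_isSpherical hM hs hA hsA htA hr hrs (ne_of_mem_bigSet hrb)).1
  have h2 := hrb.2
  omega

theorem isSpherical_union_pair (hM : IsEvenMatrix M) (hflag : (nerve cs.simple).IsFlag)
    (hs : s ∈ bigSet M t) {A : Set S} (hA : IsSpherical cs.simple A) (hAV : A ⊆ commSet M s t) :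
    IsSpherical cs.simple ({s, t} ∪ A) := by
  have hst : M s t ≠ 0 := hs.1
  have hts : M t s ≠ 0 := by rwa [M.symmetric]
  apply isSpherical_of_pairwise hflag
  rintro u ((rfl | rfl) | hu) v ((rfl | rfl) | hv)
  · simp
  · exact hst
  · rw [M.symmetric, (hAV hv).2]; norm_num
  · exact hts
  · simp
  · rw [M.symmetric, (hAV hv).1]; norm_num
  · rw [(hAV hu).2]; norm_num
  · rw [(hAV hu).1]; norm_num
  · exact hA.ne_zero hM hu hv

open Classical in
/-- The nerve of `U_st` is the link of `{s, t}`, so it triangulates a sphere. -/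
theorem isSphereTriangulation_commSet (hM : IsEvenMatrix M) {n : ℕ}
    (hflag : (nerve cs.simple).IsFlag) (hsphere : (nerve cs.simple).IsSphereTriangulation n)
    (hs : s ∈ bigSet M t) :
    ∃ d, d + 2 = n ∧ (nerve (subGen cs.simple (commSet M s t))).IsSphereTriangulation d := by
  have hst := ne_of_mem_bigSet hs
  obtain ⟨hsV, htV⟩ := notMem_commSet (M := M) (s := s) (t := t)
  have hpair : ({s, t} : Finset S) ∈ (nerve cs.simple).faces :=
    ⟨⟨s, by simp⟩, by simpa using isSpherical_pair hs.1⟩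
  obtain ⟨d, hd, -⟩ := hsphere {s, t} (Or.inr hpair)
  rw [Finset.card_pair hst] at hd
  refine ⟨d, hd, fun σ hσ => ?_⟩
  set i := Function.Embedding.subtype (· ∈ commSet M s t) with hi
  have himg : ∀ τ : Finset (commSet M s t), ((τ.map i : Finset S) : Set S) =
      Subtype.val '' (τ : Set (commSet M s t)) := by
    intro τ; rw [Finset.coe_map]; rfl
  have hsub : ∀ τ : Finset (commSet M s t), ((τ.map i : Finset S) : Set S) ⊆ commSet M s t := by
    intro τ; rw [himg]; rintro _ ⟨r, -, rfl⟩; exact r.2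
  have hext : ∀ τ : Finset (commSet M s t), IsSpherical (subGen cs.simple (commSet M s t)) τ →
      (({s, t} ∪ τ.map i : Finset S)) ∈ (nerve cs.simple).faces := by
    intro τ hτ
    refine ⟨⟨s, by simp⟩, ?_⟩
    rw [isSpherical_subGen_iff, ← himg] at hτ
    rw [Finset.coe_union, Finset.coe_pair]
    exact isSpherical_union_pair hM hflag hs hτ (hsub τ)
  have hσsph : IsSpherical (subGen cs.simple (commSet M s t)) σ := by
    rcases hσ with rfl | hσ
    · rw [Finset.coe_empty]; exact isSpherical_empty
    · exact hσ.2
  obtain ⟨d', hd', ⟨e⟩⟩ := hsphere ({s, t} ∪ σ.map i) (Or.inr (hext σ hσsph))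
  have hcard : ({s, t} ∪ σ.map i : Finset S).card = 2 + σ.card := by
    rw [Finset.card_union_of_disjoint, Finset.card_pair hst, Finset.card_map]
    rw [Finset.disjoint_left]
    intro r hr hr'
    have := hsub σ hr'
    simp only [Finset.mem_insert, Finset.mem_singleton] at hr
    rcases hr with rfl | rfl
    · exact hsV this
    · exact htV this
  refine ⟨d', by omega, ?_⟩
  obtain ⟨e'⟩ := nonempty_realization_homeomorph
    (K := (nerve (subGen cs.simple (commSet M s t))).link σ)
    (K' := (nerve cs.simple).link ({s, t} ∪ σ.map i)) i (fun τ' => by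
      constructor
      · rintro ⟨hne, hdisj, ρ, hρ, hτρ, hσρ⟩
        have hsρ : s ∈ ρ := hσρ (by simp)
        have htρ : t ∈ ρ := hσρ (by simp)
        -- Simplices of the link automatically lie in U_st, since together with s and t they are
        -- spherical.
        have hτV : ∀ r ∈ τ', r ∈ commSet M s t := by
          intro r hr
          have hr' := Finset.disjoint_left.1 hdisj hr
          simp only [Finset.mem_union, Finset.mem_insert, Finset.mem_singleton, not_or] at hr'
          exact mem_commSet_of_isSpherical hM hs hρ.2 hsρ htρ (hτρ hr) hr'.1.1 hr'.1.2
        have hmap : (τ'.subtype (· ∈ commSet M s t)).map i = τ' := by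
          ext r
          rw [hi, Finset.subtype_map, Finset.mem_filter]
          exact ⟨fun h => h.1, fun h => ⟨h, hτV r h⟩⟩
        have hne' : (τ'.subtype (· ∈ commSet M s t)).Nonempty := by
          rw [← Finset.map_nonempty (f := i), hmap]; exact hne
        have hτρ' : τ'.subtype (· ∈ commSet M s t) ⊆ ρ.subtype (· ∈ commSet M s t) := by
          intro r hr
          rw [Finset.mem_subtype] at hr ⊢
          exact hτρ hr
        refine ⟨τ'.subtype (· ∈ commSet M s t), ⟨hne', ?_, ρ.subtype (· ∈ commSet M s t),
          ⟨hne'.mono hτρ', ?_⟩, hτρ', ?_⟩, hmap⟩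
        · rw [Finset.disjoint_left]
          intro r hr hrσ
          rw [Finset.mem_subtype] at hr
          refine Finset.disjoint_left.1 hdisj hr (Finset.mem_union_right _ ?_)
          exact Finset.mem_map_of_mem i hrσ
        · rw [isSpherical_subGen_iff]
          refine hρ.2.mono ?_
          rintro _ ⟨r, hr, rfl⟩
          simpa using hr
        · intro r hr
          rw [Finset.mem_subtype]
          exact hσρ (Finset.mem_union_right _ (Finset.mem_map_of_mem i hr))
      · rintro ⟨τ, ⟨hne, hdisj, ρ, hρ, hτρ, hσρ⟩, rfl⟩
        refine ⟨hne.map, ?_, {s, t} ∪ ρ.map i, hext ρ hρ.2, ?_, ?_⟩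
        · rw [Finset.disjoint_union_right]
          constructor
          · rw [Finset.disjoint_right]
            intro r hr hr'
            have := hsub τ hr'
            simp only [Finset.mem_insert, Finset.mem_singleton] at hr
            rcases hr with rfl | rfl
            · exact hsV this
            · exact htV this
          · rwa [Finset.disjoint_map]
        · exact (Finset.map_subset_map.2 hτρ).trans Finset.subset_union_right
        · exact Finset.union_subset_union_right (Finset.map_subset_map.2 hσρ))
  exact ⟨e'.symm.trans e⟩

end Flag

/-! ## Colors and collars -/

theorem mem_faces_iSup {V : Type*} {ι : Sort*} {K : ι → PreAbstractSimplicialComplex V}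
    {σ : Finset V} : σ ∈ (⨆ i, K i).faces ↔ ∃ i, σ ∈ (K i).faces := by
  change σ ∈ ⋃ L ∈ Set.range K, L.faces ↔ _
  simp

theorem exists_min_of_mem_faces {P : Type*} [PartialOrder P] {Q : Set P} {σ : Finset P}
    (hσ : σ ∈ (chainComplex Q).faces) : ∃ a ∈ σ, ∀ b ∈ σ, a ≤ b := by
  obtain ⟨hne, -, hc⟩ := hσ
  obtain ⟨a, ha⟩ := σ.exists_minimal hne
  refine ⟨a, ha.1, fun b hb => ?_⟩
  rcases hc.total ha.1 hb with h | h
  · exact h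
  · exact ha.2 hb h

theorem exists_max_of_mem_faces {P : Type*} [PartialOrder P] {Q : Set P} {σ : Finset P}
    (hσ : σ ∈ (chainComplex Q).faces) : ∃ a ∈ σ, ∀ b ∈ σ, b ≤ a := by
  obtain ⟨hne, -, hc⟩ := hσ
  obtain ⟨a, ha⟩ := σ.exists_maximal hne
  refine ⟨a, ha.1, fun b hb => ?_⟩
  rcases hc.total ha.1 hb with h | h
  · exact ha.2 hb h
  · exact h

/-! ### Left translation of spherical cosets. -/

section Translate

variable {S W : Type*} [Group W] {gen : S → W}

theorem translate_coset (v w : W) {T : Set S} (hT : IsSpherical gen T) :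
    translate v (coset gen w T hT) = coset gen (v * w) T hT :=
  Subtype.ext (smul_smul v w _)

theorem isChain_image_translate {Q : Set (SphericalCoset gen)} (h : IsChain (· ≤ ·) Q) (v : W) :
    IsChain (· ≤ ·) (translate v '' Q) := by
  rintro _ ⟨C, hC, rfl⟩ _ ⟨D, hD, rfl⟩ -
  exact (h.total hC hD).imp (fun h => Set.smul_set_mono h) fun h => Set.smul_set_mono h

end Translate

section StarSet

variable {S W : Type*} [Group W] {M : CoxeterMatrix S} {cs : CoxeterSystem M W} {t : S}

theorem subset_starSet [Finite S] (hM : IsEvenMatrix M) {T : Set S}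
    (hT : IsSpherical cs.simple T) (ht : t ∈ T) : T ⊆ starSet M t :=
  fun _ hs => hT.ne_zero hM hs ht

end StarSet

section Collar

variable {S W : Type*} [Group W] {M : CoxeterMatrix S} (cs : CoxeterSystem M W)
  (hM : IsEvenMatrix M) (t : S)

/-- The elements of `W` whose image in every `W_T` with `T ∋ t` spherical lies in `W_{T-t}`. -/
def colorKer : Subgroup W :=
  ⨅ T : {T : Set S // IsSpherical cs.simple T ∧ t ∈ T},
    ((parabolic cs.simple (T.1 \ {t})).subgroupOf (parabolic cs.simple T.1)).comap
      (retraction cs hM T.1)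

variable {cs hM t}

theorem mem_colorKer {x : W} : x ∈ colorKer cs hM t ↔ ∀ T, IsSpherical cs.simple T → t ∈ T →
    (retraction cs hM T x : W) ∈ parabolic cs.simple (T \ {t}) := by
  rw [colorKer, Subgroup.mem_iInf]
  exact ⟨fun h T hT ht => h ⟨T, hT, ht⟩, fun h T => h T.1 T.2.1 T.2.2⟩

theorem color_eq_color_iff {w w' : parabolic cs.simple (starSet M t)} :
    color cs hM t w = color cs hM t w' ↔ (w : W)⁻¹ * w' ∈ colorKer cs hM t := by
  rw [funext_iff, colorKer, Subgroup.mem_iInf]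
  refine forall_congr' fun T => ?_
  rw [Subgroup.mem_comap, map_mul, map_inv]
  have h : ∀ w : parabolic cs.simple (starSet M t), color cs hM t w T =
      QuotientGroup.mk (retraction cs hM T.1 w) := fun w =>
    congrArg QuotientGroup.mk (mul_one (retraction cs hM T.1 (w : W)))
  rw [h, h, QuotientGroup.eq]

theorem mem_colorKer_of_mem {A : Set S} (hA : t ∉ A) {x : W} (hx : x ∈ parabolic cs.simple A) :
    x ∈ colorKer cs hM t := by
  rw [mem_colorKer]
  intro T _ _
  refine parabolic_mono ?_ (retraction_mem cs hM T hx)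
  rintro r ⟨hrT, hrA⟩
  exact ⟨hrT, fun h => hA (h ▸ hrA)⟩

/-- For T = {t} the subgroup W_(T-t) is trivial, so this factor of a color records the full image in
W_{t}, that is, the parity. -/
theorem retraction_eq_one_of_mem_colorKer {x : W} (hx : x ∈ colorKer cs hM t) :
    retraction cs hM {t} x = 1 := by
  have hsph : IsSpherical cs.simple {t} := by
    have := isSpherical_pair (cs := cs) (s := t) (t := t) (by simp)
    simpa using this
  have := mem_colorKer.1 hx {t} hsph rfl
  rw [Set.sdiff_self, parabolic_empty, Subgroup.mem_bot] at this
  exact Subtype.ext this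

variable (cs hM t)

/-- The spherical cosets spanning the collar of color `c`. -/
def collarSet (c : Color cs t) : Set (SphericalCoset cs.simple) :=
  {C | cosetType C ⊆ starSet M t ∧
    ∃ v : parabolic cs.simple (starSet M t), (v : W) ∈ C.1 ∧ color cs hM t v = c}

variable {t} [Finite S]

/-- Vertices of one boundary collar share a color, as they differ by elements of W_(U-t).
Conversely, a chain in `collarSet` is translated into the fundamental domain by a vertex of color c
in its least coset. -/
theorem collar_eq_chainComplex (hflag : (nerve cs.simple).IsFlag) (c : Color cs t) :
    collar cs hM t c = chainComplex (collarSet cs hM t c) := by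
  classical
  apply PreAbstractSimplicialComplex.ext
  ext σ
  simp only [collar, boundaryCollar, mem_faces_iSup]
  constructor
  · rintro ⟨w, hw, v, hv, τ, ⟨⟨hne, hK, hc⟩, hΩ⟩, rfl⟩
    simp only [ruin, mem_faces_iSup] at hΩ
    obtain ⟨w', T, hT, htT, -, hle, -⟩ := hΩ
    rw [Set.mem_smul_set_iff_inv_smul_mem] at hv
    change (w : W)⁻¹ * v ∈ parabolic cs.simple (starSet M t \ {t}) at hv
    have hvU : v ∈ parabolic cs.simple (starSet M t) := by
      rw [← mul_inv_cancel_left (w : W) v]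
      exact mul_mem w.2 (parabolic_mono Set.sdiff_subset hv)
    refine ⟨hne.image _, ?_, ?_⟩
    · intro C hC
      rw [Finset.coe_image] at hC
      obtain ⟨D, hD, rfl⟩ := hC
      obtain ⟨A, hA, rfl⟩ := hK hD
      rw [translate_coset, mul_one]
      refine ⟨?_, ⟨v, hvU⟩, self_mem_coset v hA, ?_⟩
      · have := cosetType_mono hM (hle hD)
        rw [cosetType_coset hM, cosetType_coset hM] at this
        rw [cosetType_coset hM]
        exact this.trans (subset_starSet hM hT htT)
      · rw [← hw, eq_comm, color_eq_color_iff]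
        exact mem_colorKer_of_mem (fun h => h.2 rfl) hv
    · rw [Finset.coe_image]
      exact isChain_image_translate hc v
  · intro hσ
    obtain ⟨D, hD, hmin⟩ := exists_min_of_mem_faces hσ
    obtain ⟨E, hE, hmax⟩ := exists_max_of_mem_faces hσ
    obtain ⟨hne, hQ, hc⟩ := hσ
    obtain ⟨-, v, hvD, hv⟩ := hQ hD
    have hmem : ∀ C ∈ σ, (v : W) ∈ C.1 := fun C hC => hmin C hC hvD
    have htr : ∀ C ∈ σ, translate (v : W)⁻¹ C =
        coset cs.simple 1 (cosetType C) (isSpherical_cosetType hM C) := by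
      intro C hC
      conv_lhs => rw [C.eq_coset hM (hmem C hC)]
      rw [translate_coset, inv_mul_cancel]
    -- Flagness enters here: the type of the largest coset lies in U, so adding t keeps it spherical
    -- and gives a cell of Ω that contains the translated chain.
    have hET : IsSpherical cs.simple (cosetType E ∪ {t}) := by
      apply isSpherical_of_pairwise hflag
      have hEU := (hQ hE).1
      have hE' := isSpherical_cosetType hM E
      rintro a (ha | rfl) b (hb | rfl)
      · exact hE'.ne_zero hM ha hb
      · exact hEU ha
      · rw [M.symmetric]; exact hEU hb
      · simp
    refine ⟨v, hv, v, ⟨1, one_mem _, mul_one _⟩, σ.image (translate (v : W)⁻¹),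
      ⟨⟨hne.image _, ?_, ?_⟩, ?_⟩, ?_⟩
    · intro C hC
      rw [Finset.coe_image] at hC
      obtain ⟨D, hD, rfl⟩ := hC
      exact ⟨_, _, htr D hD⟩
    · rw [Finset.coe_image]
      exact isChain_image_translate hc _
    · simp only [ruin, mem_faces_iSup]
      refine ⟨1, _, hET, Or.inr rfl, hne.image _, ?_, ?_⟩
      · intro C hC
        rw [Finset.coe_image] at hC
        obtain ⟨D, hD, rfl⟩ := hC
        rw [htr D hD]
        exact coset_le_coset 1 _ _ ((cosetType_mono hM (hmax D hD)).trans Set.subset_union_left)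
      · rw [Finset.coe_image]
        exact isChain_image_translate hc _
    · change Finset.image _ (Finset.image _ σ) = σ
      rw [Finset.image_image]
      conv_rhs => rw [← Finset.image_id (s := σ)]
      refine Finset.image_congr fun C _ => ?_
      apply Subtype.ext
      exact smul_inv_smul (v : W) C.1

end Collar

/-! ## Realizations of subposets -/

section Realization

variable {P : Type*} [PartialOrder P] {Q Q' : Set P} {f : P → ℝ}

theorem mem_realization_chainComplex_iff : f ∈ (chainComplex Q).realization ↔
    f ∈ (chainComplex (Set.univ : Set P)).realization ∧ Function.support f ⊆ Q := by
  constructor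
  · rintro ⟨h0, σ, ⟨hne, hQ, hc⟩, hs, h1⟩
    exact ⟨⟨h0, σ, ⟨hne, Set.subset_univ _, hc⟩, hs, h1⟩, hs ▸ hQ⟩
  · rintro ⟨⟨h0, σ, ⟨hne, -, hc⟩, hs, h1⟩, hQ⟩
    exact ⟨h0, σ, ⟨hne, hs ▸ hQ, hc⟩, hs, h1⟩

theorem exists_min_of_mem_realization (hf : f ∈ (chainComplex Q).realization) :
    ∃ a ∈ Q, f a ≠ 0 ∧ ∀ b, f b ≠ 0 → a ≤ b := by
  obtain ⟨-, σ, hσ, hs, -⟩ := hf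
  obtain ⟨a, ha, hmin⟩ := exists_min_of_mem_faces hσ
  have hmem : ∀ b, f b ≠ 0 ↔ b ∈ σ := fun b => by
    rw [← Function.mem_support, hs, Finset.mem_coe]
  exact ⟨a, hσ.2.1 ha, (hmem a).2 ha, fun b hb => hmin b ((hmem b).1 hb)⟩

theorem le_or_le_of_mem_realization (hf : f ∈ (chainComplex Q).realization) {a b : P}
    (ha : f a ≠ 0) (hb : f b ≠ 0) : a ≤ b ∨ b ≤ a := by
  obtain ⟨-, σ, ⟨-, -, hc⟩, hs, -⟩ := hf
  have hmem : ∀ b, f b ≠ 0 → b ∈ (σ : Set P) := fun b hb => hs ▸ hb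
  exact hc.total (hmem a ha) (hmem b hb)

/-- A subposet that is a union of components of the comparability relation gives an open part of
the realization. -/
theorem realization_eq_inter_of_comparable (hQ : Q' ⊆ Q)
    (h : ∀ a ∈ Q', ∀ b ∈ Q, a ≤ b ∨ b ≤ a → b ∈ Q') :
    (chainComplex Q').realization =
      (chainComplex Q).realization ∩ ⋃ a ∈ Q', {f | 0 < f a} := by
  ext f
  constructor
  · intro hf
    obtain ⟨a, ha, hfa, -⟩ := exists_min_of_mem_realization hf
    have hf' := mem_realization_chainComplex_iff.1 hf
    exact ⟨mem_realization_chainComplex_iff.2 ⟨hf'.1, hf'.2.trans hQ⟩,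
      Set.mem_biUnion ha (lt_of_le_of_ne (hf.1 a) hfa.symm)⟩
  · rintro ⟨hf, ha⟩
    obtain ⟨a, ha, hfa⟩ := Set.mem_iUnion₂.1 ha
    have hf' := mem_realization_chainComplex_iff.1 hf
    refine mem_realization_chainComplex_iff.2 ⟨hf'.1, fun b hb => ?_⟩
    exact h a ha b (hf'.2 hb) (le_or_le_of_mem_realization hf (ne_of_gt hfa) hb)

end Realization

/-! ## The pieces of the intersection of two collars -/

section Pieces

variable {S W : Type*} [Group W] {M : CoxeterMatrix S} {cs : CoxeterSystem M W} {s t : S}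

variable (cs s t) in
/-- The spherical cosets `v u W_T` with `u ∈ W_V` and `{s, t} ⊆ T ⊆ {s, t} ∪ V`, where
`V = U_st`. -/
def piece (v : W) : Set (SphericalCoset cs.simple) :=
  {C | s ∈ cosetType C ∧ t ∈ cosetType C ∧ cosetType C ⊆ commSet M s t ∪ {s, t} ∧
    ∃ u ∈ parabolic cs.simple (commSet M s t), v * u ∈ C.1}

theorem commSet_commute : ∀ a ∈ commSet M s t, ∀ b ∈ ({s, t} : Set S), M a b = 2 := by
  rintro a ha b (rfl | rfl)
  exacts [ha.2, ha.1]

/-- An element of a coset in a piece is the product of one in `v W_V` and one in `W_{s,t}`. -/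
theorem exists_eq_of_mem_piece (hM : IsEvenMatrix M) {v : W} {C : SphericalCoset cs.simple}
    (hC : C ∈ piece cs s t v) {a : W} (ha : a ∈ C.1) :
    ∃ u ∈ parabolic cs.simple (commSet M s t), ∃ h ∈ parabolic cs.simple {s, t},
      a = v * u * h := by
  obtain ⟨-, -, hCV, u, hu, hvu⟩ := hC
  obtain ⟨u', hu', h, hh, heq⟩ := exists_eq_mul_of_mem_union cs commSet_commute
    (parabolic_mono hCV ((C.mem_iff hM hvu).1 ha))
  refine ⟨u * u', mul_mem hu hu', h, hh, ?_⟩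
  rw [← mul_assoc, mul_assoc (v * u), ← heq, mul_inv_cancel_left]

theorem mul_mem_of_mem_piece (hM : IsEvenMatrix M) {v : W} {C : SphericalCoset cs.simple}
    (hC : C ∈ piece cs s t v) {a h : W} (ha : a ∈ C.1) (hh : h ∈ parabolic cs.simple {s, t}) :
    a * h ∈ C.1 := by
  rw [C.mem_iff hM ha, inv_mul_cancel_left]
  refine parabolic_mono ?_ hh
  rintro r (rfl | rfl)
  exacts [hC.1, hC.2.1]

theorem mem_piece_of_mem (hM : IsEvenMatrix M) [Finite S] (hs : s ∈ bigSet M t)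
    {C : SphericalCoset cs.simple} (hsC : s ∈ cosetType C) (htC : t ∈ cosetType C) {v u : W}
    (hu : u ∈ parabolic cs.simple (commSet M s t)) (hv : v * u ∈ C.1) : C ∈ piece cs s t v := by
  refine ⟨hsC, htC, fun r hr => ?_, u, hu, hv⟩
  by_cases hrs : r = s
  · exact Or.inr (Or.inl hrs)
  by_cases hrt : r = t
  · exact Or.inr (Or.inr hrt)
  exact Or.inl (mem_commSet_of_isSpherical hM hs (isSpherical_cosetType hM C) hsC htC hr hrs hrt)

/-- A larger D inherits s and the vertex in vW_V. For a smaller D the element r of S' must be s,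
because the type of C has room for only one; then D absorbs the W_{s,t}-factor of its vertices and
so meets vW_V. -/
theorem mem_piece_of_comparable (hM : IsEvenMatrix M) [Finite S] (hs : s ∈ bigSet M t) {v : W}
    {C D : SphericalCoset cs.simple} (hC : C ∈ piece cs s t v) (htD : t ∈ cosetType D) {r : S}
    (hr : r ∈ bigSet M t) (hrD : r ∈ cosetType D) (h : C ≤ D ∨ D ≤ C) : D ∈ piece cs s t v := by
  rcases h with h | h
  · obtain ⟨u, hu, hvu⟩ := hC.2.2.2
    exact mem_piece_of_mem hM hs (cosetType_mono hM h hC.1) htD hu (h hvu)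
  · have hrs : r = s := eq_of_mem_bigSet hM hs (isSpherical_cosetType hM C) hC.1 hC.2.1
      (cosetType_mono hM h hrD) hr
    subst hrs
    obtain ⟨b, hb⟩ := D.nonempty
    obtain ⟨u, hu, x, hx, rfl⟩ := exists_eq_of_mem_piece hM hC (h hb)
    refine mem_piece_of_mem hM hs hrD htD hu ?_
    rw [D.mem_iff hM hb]
    have : (v * u * x)⁻¹ * (v * u) = x⁻¹ := by group
    rw [this]
    refine inv_mem (parabolic_mono ?_ hx)
    rintro q (rfl | rfl)
    exacts [hrD, htD]

/-- Through C, the representatives v and v' differ by elements of W_V and W_{s,t}. These commute,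
and the second factor is absorbed by every coset of a piece. -/
theorem piece_subset_piece (hM : IsEvenMatrix M) {v v' : W} {C : SphericalCoset cs.simple}
    (hC : C ∈ piece cs s t v) (hC' : C ∈ piece cs s t v') :
    piece cs s t v' ⊆ piece cs s t v := by
  obtain ⟨-, -, -, u', hu', hvu'⟩ := hC'
  obtain ⟨u, hu, h, hh, heq⟩ := exists_eq_of_mem_piece hM hC hvu'
  rintro D hD
  obtain ⟨hsD, htD, hDV, x, hx, hvx⟩ := id hD
  have hy : u * u'⁻¹ * x ∈ parabolic cs.simple (commSet M s t) :=
    mul_mem (mul_mem hu (inv_mem hu')) hx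
  refine ⟨hsD, htD, hDV, _, hy, ?_⟩
  have h1 : v' * x = v * u * h * (u'⁻¹ * x) := by rw [← heq]; group
  have h2 : v * (u * u'⁻¹ * x) = v' * x * h⁻¹ := by
    rw [h1, mul_assoc (v * u) h, ← parabolic_commute cs commSet_commute
      (mul_mem (inv_mem hu') hx) hh]
    group
  rw [h2]
  exact mul_mem_of_mem_piece hM hD hvx (inv_mem hh)

/-- A piece lies in a collar as soon as it meets it. -/
theorem mem_collarSet_of_mem_piece [Finite S] {hM : IsEvenMatrix M} {c : Color cs t}
    {v : W} {C D : SphericalCoset cs.simple} (hC : C ∈ piece cs s t v) (hD : D ∈ piece cs s t v)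
    (hCc : C ∈ collarSet cs hM t c) : D ∈ collarSet cs hM t c := by
  obtain ⟨-, a, ha, hac⟩ := hCc
  obtain ⟨u, hu, h, hh, heq⟩ := exists_eq_of_mem_piece hM hC ha
  obtain ⟨u', hu', hvu'⟩ := hD.2.2.2
  have hVU : commSet M s t ⊆ starSet M t := fun r hr => by
    change M r t ≠ 0
    rw [hr.1]; norm_num
  have hx : u⁻¹ * u' ∈ parabolic cs.simple (commSet M s t) := mul_mem (inv_mem hu) hu'
  -- Moving the colored vertex by an element of W_V reaches D up to W_{s,t}, and keeps the color
  -- because t is not in V.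
  refine ⟨subset_starSet hM (isSpherical_cosetType hM D) hD.2.1,
    ⟨a * (u⁻¹ * u'), mul_mem a.2 (parabolic_mono hVU hx)⟩, ?_, ?_⟩
  · have : (a : W) * (u⁻¹ * u') = v * u' * h := by
      rw [heq, mul_assoc (v * u), ← parabolic_commute cs commSet_commute hx hh]
      group
    change (a : W) * (u⁻¹ * u') ∈ D.1
    rw [this]
    exact mul_mem_of_mem_piece hM hD hvu' hh
  · rw [← hac, eq_comm, color_eq_color_iff]
    simp only [inv_mul_cancel_left]
    exact mem_colorKer_of_mem notMem_commSet.2 hx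

/-- The isomorphism sends C to the set of d in W_V with vd in C. The inverse image of uW_B is
vuW_({s,t} ∪ B), which is spherical by flagness. -/
theorem exists_orderIso_piece (hM : IsEvenMatrix M) [Finite S] (hflag : (nerve cs.simple).IsFlag)
    (hs : s ∈ bigSet M t) (v : W) :
    Nonempty (piece cs s t v ≃o SphericalCoset (subGen cs.simple (commSet M s t))) := by
  set V := commSet M s t with hV
  have hF : ∀ C ∈ piece cs s t v, ∃ (w : parabolic cs.simple V) (T : Set V),
      IsSpherical (subGen cs.simple V) T ∧
        {d : parabolic cs.simple V | v * d ∈ C.1} =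
          w • (parabolic (subGen cs.simple V) T : Set (parabolic cs.simple V)) := by
    rintro C ⟨-, -, -, u, hu, hvu⟩
    refine ⟨⟨u, hu⟩, Subtype.val ⁻¹' cosetType C, ?_, ?_⟩
    · rw [isSpherical_subGen_iff]
      exact (isSpherical_cosetType hM C).mono (Set.image_preimage_subset _ _)
    · ext d
      rw [Set.mem_smul_set_iff_inv_smul_mem]
      change v * d ∈ C.1 ↔ (⟨u, hu⟩ : parabolic cs.simple V)⁻¹ * d ∈
        parabolic (subGen cs.simple V) _
      rw [C.mem_iff hM hvu, ← coe_mem_parabolic_iff cs hM]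
      have : (v * u)⁻¹ * (v * (d : W)) = u⁻¹ * d := by group
      rw [this]
      rfl
  let F : piece cs s t v → SphericalCoset (subGen cs.simple V) :=
    fun C => ⟨{d | v * d ∈ C.1.1}, hF C.1 C.2⟩
  have hle : ∀ C D, F C ≤ F D ↔ C ≤ D := by
    rintro ⟨C, hC⟩ ⟨D, hD⟩
    constructor
    · intro h
      obtain ⟨u, hu, hvu⟩ := hC.2.2.2
      have hvuD : v * u ∈ D.1 := h (show (⟨u, hu⟩ : parabolic cs.simple V) ∈ (F ⟨C, hC⟩).1 from hvu)
      refine le_of_cosetType_subset hM hvu hvuD fun r hr => ?_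
      rcases hC.2.2.1 hr with hrV | rfl | rfl
      · have hur : u * cs.simple r ∈ parabolic cs.simple V := mul_mem hu (gen_mem_parabolic hrV)
        have h1 : v * (u * cs.simple r) ∈ C.1 := by rw [← mul_assoc]; exact hr _ hvu
        have h2 : v * (u * cs.simple r) ∈ D.1 :=
          h (show (⟨_, hur⟩ : parabolic cs.simple V) ∈ (F ⟨C, hC⟩).1 from h1)
        rwa [← mul_assoc, D.mem_iff hM hvuD, inv_mul_cancel_left,
          simple_mem_parabolic_iff cs hM] at h2
      · exact hD.1
      · exact hD.2.1
    · exact fun h d hd => h hd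
  refine ⟨RelIso.ofSurjective (OrderEmbedding.ofMapLEIff F hle) ?_⟩
  intro E
  obtain ⟨u, B, hB, rfl⟩ := E.exists_eq
  obtain ⟨hsV, htV⟩ := notMem_commSet (M := M) (s := s) (t := t)
  have hBV : Subtype.val '' B ⊆ V := by rintro _ ⟨r, -, rfl⟩; exact r.2
  have hT := isSpherical_union_pair hM hflag hs ((isSpherical_subGen_iff _ _ _).1 hB) hBV
  have hpre : (Subtype.val ⁻¹' ({s, t} ∪ Subtype.val '' B) : Set V) = B := by
    ext ⟨r, hr⟩
    constructor
    · rintro ((h | h) | ⟨q, hq, hqr⟩)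
      · exact absurd (show s ∈ V from h ▸ hr) hsV
      · exact absurd (show t ∈ V from h ▸ hr) htV
      · rwa [← show q = ⟨r, hr⟩ from Subtype.ext hqr]
    · exact fun h => Or.inr ⟨_, h, rfl⟩
  refine ⟨⟨coset cs.simple (v * u) _ hT, ?_⟩, ?_⟩
  · refine mem_piece_of_mem hM hs ?_ ?_ u.2 (self_mem_coset _ hT) <;> rw [cosetType_coset hM]
    exacts [Or.inl (Or.inl rfl), Or.inl (Or.inr rfl)]
  · apply Subtype.ext
    ext d
    rw [mem_coset]
    change v * (d : W) ∈ (coset cs.simple (v * u) _ hT).1 ↔ _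
    have : (v * (u : W))⁻¹ * (v * (d : W)) = (u⁻¹ * d : parabolic cs.simple V) := by
      rw [Subgroup.coe_mul, Subgroup.coe_inv]; group
    rw [mem_coset, this, coe_mem_parabolic_iff cs hM, hpre]

/-- If two vertices of a coset have different even colors, its type contains `t` and an element
of `S'`. -/
theorem exists_mem_bigSet [Finite S] {hM : IsEvenMatrix M} {c c' : Color cs t}
    (hc : IsEvenColor cs hM t c) (hc' : IsEvenColor cs hM t c') (hne : c ≠ c')
    {C : SphericalCoset cs.simple} (hC : C ∈ collarSet cs hM t c)
    (hC' : C ∈ collarSet cs hM t c') : t ∈ cosetType C ∧ ∃ s ∈ bigSet M t, s ∈ cosetType C := by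
  -- The parity of a vertex is read off from its color, so every vertex of an even color is even.
  have heven : ∀ {c : Color cs t} {v : parabolic cs.simple (starSet M t)},
      IsEvenColor cs hM t c → color cs hM t v = c → retraction cs hM {t} v = 1 := by
    rintro c v ⟨w, hw, rfl⟩ hv
    have h := retraction_eq_one_of_mem_colorKer (color_eq_color_iff.1 hv)
    rw [map_mul, map_inv, show retraction cs hM {t} (w : W) = 1 from hw, mul_one, inv_eq_one] at h
    exact h
  obtain ⟨-, v, hvC, hv⟩ := hC
  obtain ⟨-, v', hvC', hv'⟩ := hC'
  have hx : (v : W)⁻¹ * v' ∉ colorKer cs hM t := fun h =>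
    hne (by rw [← hv, ← hv', color_eq_color_iff.2 h])
  have hx1 : retraction cs hM {t} ((v : W)⁻¹ * v') = 1 := by
    rw [map_mul, map_inv, heven hc hv, heven hc' hv', inv_one, one_mul]
  have hxC := (C.mem_iff hM hvC).1 hvC'
  have ht : t ∈ cosetType C := by
    by_contra h
    exact hx (mem_colorKer_of_mem h hxC)
  refine ⟨ht, ?_⟩
  -- Without an element of S' in the type, t commutes with the other generators. Then v⁻¹v' splits
  -- as y z with y in W_(T-t) and z in W_{t}; parity kills z, and y preserves colors.
  by_contra! hno
  have h2 : ∀ a ∈ cosetType C \ {t}, ∀ b ∈ ({t} : Set S), M a b = 2 := by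
    rintro a ⟨ha, hat⟩ b rfl
    have h0 := (isSpherical_cosetType hM C).ne_zero hM ha ht
    have h1 : ¬ 2 < M a b := fun h => hno a ⟨h0, h⟩ ha
    have h3 : M a b ≠ 1 := M.off_diagonal a b hat
    omega
  have hxC' : (v : W)⁻¹ * v' ∈ parabolic cs.simple (cosetType C \ {t} ∪ {t}) :=
    parabolic_mono (fun r hr => (em (r = t)).elim Or.inr fun h => Or.inl ⟨hr, h⟩) hxC
  obtain ⟨y, hy, z, hz, heq⟩ := exists_eq_mul_of_mem_union cs h2 hxC'
  have hyK : y ∈ colorKer cs hM t := mem_colorKer_of_mem (fun h => h.2 rfl) hy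
  have hz1 : z = 1 := by
    rw [heq, map_mul, retraction_eq_one_of_mem_colorKer hyK, one_mul] at hx1
    rw [← retraction_of_mem cs hM hz, hx1, Subgroup.coe_one]
  rw [heq, hz1, mul_one] at hx
  exact hx hyK

end Pieces

/-! ## The intersection of a collar with a union of collars -/

section Main

variable {S W : Type*} [Finite S] [Group W] {M : CoxeterMatrix S} {cs : CoxeterSystem M W}

/-- A chain in the union of the `collarSet`s lies in a single one: the vertex of color `c j` in its
least coset belongs to every coset of the chain. -/
theorem collarSpace_inter_iUnion (hM : IsEvenMatrix M) {t : S}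
    (hflag : (nerve cs.simple).IsFlag) {ι : Type*} (c : ι → Color cs t) (ce : Color cs t) :
    collarSpace cs hM t ce ∩ ⋃ j, collarSpace cs hM t (c j) =
      (chainComplex (collarSet cs hM t ce ∩ ⋃ j, collarSet cs hM t (c j))).realization := by
  simp only [collarSpace, collar_eq_chainComplex cs hM hflag]
  ext f
  constructor
  · rintro ⟨hfe, hfj⟩
    obtain ⟨j, hfj⟩ := Set.mem_iUnion.1 hfj
    rw [mem_realization_chainComplex_iff] at hfe hfj ⊢
    exact ⟨hfe.1, Set.subset_inter hfe.2 (hfj.2.trans (Set.subset_iUnion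
      (fun j => collarSet cs hM t (c j)) j))⟩
  · intro hf
    obtain ⟨C, hC, -, hmin⟩ := exists_min_of_mem_realization hf
    obtain ⟨j, -, v, hvC, hv⟩ := Set.mem_iUnion.1 hC.2
    rw [mem_realization_chainComplex_iff] at hf
    refine ⟨mem_realization_chainComplex_iff.2 ⟨hf.1, hf.2.trans Set.inter_subset_left⟩,
      Set.mem_iUnion.2 ⟨j, mem_realization_chainComplex_iff.2 ⟨hf.1, fun D hD => ?_⟩⟩⟩
    exact ⟨(hf.2 hD).1.1, v, hmin D hD hvC, hv⟩

theorem isDavisCopy_piece (hM : IsEvenMatrix M) {s t : S} (hflag : (nerve cs.simple).IsFlag)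
    (hs : s ∈ bigSet M t) (v : W) :
    IsDavisCopy cs (commSet M s t) (chainComplex (piece cs s t v)).realization := by
  obtain ⟨e⟩ := exists_orderIso_piece hM hflag hs v
  exact ⟨⟨_, rfl, ⟨e⟩⟩, nonempty_chainComplex_homeomorph e⟩

/-- By `subSystem` the group W_{U_st} is itself an even Coxeter group, so the general results on
Davis complexes apply and are carried over by the homeomorphism. -/
theorem isManifold_of_isDavisCopy (hM : IsEvenMatrix M) {n : ℕ}
    (hflag : (nerve cs.simple).IsFlag) (hsphere : (nerve cs.simple).IsSphereTriangulation n)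
    {s t : S} (hs : s ∈ bigSet M t) {C : Set (SphericalCoset cs.simple → ℝ)}
    (hC : IsDavisCopy cs (commSet M s t) C) :
    ConnectedSpace C ∧ (∃ d : ℕ, d + 2 = n ∧
      Nonempty (ChartedSpace (EuclideanSpace ℝ (Fin d)) C)) ∧ (3 ≤ n → NoncompactSpace C) := by
  obtain ⟨-, ⟨e⟩⟩ := hC
  obtain ⟨d, hd, hsph⟩ := isSphereTriangulation_commSet hM hflag hsphere hs
  set cs' := subSystem cs hM (commSet M s t) with hcs'
  rw [← subSystem_simple cs hM] at e hsph
  have hconn := connectedSpace_davisComplex cs'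
  have : Nonempty C := hconn.toNonempty.map e.symm
  obtain ⟨hchart⟩ := nonempty_chartedSpace_davisComplex cs' (isEvenMatrix_subMatrix hM _) hsph
  refine ⟨e.symm.surjective.connectedSpace e.symm.continuous, ⟨d, hd, ⟨?_⟩⟩, fun hn => ?_⟩
  · let _ := e.isOpenEmbedding.singletonChartedSpace
    exact ChartedSpace.comp _ (davisComplex cs'.simple).realization C
  · have := infinite_of_isSphereTriangulation cs' (by omega) hsph
    have := noncompactSpace_davisComplex cs'
    rw [← not_compactSpace_iff] at this ⊢
    exact fun _ => this e.compactSpace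

theorem isDisjointUnion_collarSpace_inter_iUnion (hM : IsEvenMatrix M) {n : ℕ}
    (hflag : (nerve cs.simple).IsFlag) (hsphere : (nerve cs.simple).IsSphereTriangulation n)
    {t : S} {ι : Type*} {c : ι → Color cs t} {ce : Color cs t}
    (hc : ∀ j, IsEvenColor cs hM t (c j)) (hce : IsEvenColor cs hM t ce) (hne : ∀ j, c j ≠ ce) :
    IsDisjointUnionOfDavisManifolds cs t n
      (collarSpace cs hM t ce ∩ ⋃ j, collarSpace cs hM t (c j)) := by
  rw [collarSpace_inter_iUnion hM hflag]
  set Q := collarSet cs hM t ce ∩ ⋃ j, collarSet cs hM t (c j) with hQ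
  have hbig : ∀ C ∈ Q, t ∈ cosetType C ∧ ∃ s ∈ bigSet M t, s ∈ cosetType C := by
    rintro C ⟨hCe, hCj⟩
    obtain ⟨j, hCj⟩ := Set.mem_iUnion.1 hCj
    exact exists_mem_bigSet hce (hc j) (hne j).symm hCe hCj
  have hsub : ∀ {s v C}, C ∈ piece cs s t v → C ∈ Q → piece cs s t v ⊆ Q := by
    rintro s v C hC ⟨hCe, hCj⟩ D hD
    obtain ⟨j, hCj⟩ := Set.mem_iUnion.1 hCj
    exact ⟨mem_collarSet_of_mem_piece hC hD hCe,
      Set.mem_iUnion.2 ⟨j, mem_collarSet_of_mem_piece hC hD hCj⟩⟩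
  have hcomp : ∀ {s v}, s ∈ bigSet M t → ∀ C ∈ piece cs s t v, ∀ D ∈ Q, C ≤ D ∨ D ≤ C →
      D ∈ piece cs s t v := by
    intro s v hs C hC D hD h
    obtain ⟨htD, r, hr, hrD⟩ := hbig D hD
    exact mem_piece_of_comparable hM hs hC htD hr hrD h
  -- The components are the pieces that meet Q. Two of them sharing a point share a coset, which
  -- forces the same s and hence equal pieces.
  refine ⟨{X | ∃ s ∈ bigSet M t, ∃ v, X = (chainComplex (piece cs s t v)).realization ∧
    ∃ C ∈ piece cs s t v, C ∈ Q}, ?_, ?_, ?_⟩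
  · ext f
    constructor
    · rintro ⟨_, ⟨s, hs, v, rfl, C, hC, hCQ⟩, hf⟩
      rw [realization_eq_inter_of_comparable (hsub hC hCQ) (hcomp hs)] at hf
      exact hf.1
    · intro hf
      obtain ⟨C, hC, hfC, -⟩ := exists_min_of_mem_realization hf
      obtain ⟨htC, s, hs, hsC⟩ := hbig C hC
      obtain ⟨v, hv⟩ := C.nonempty
      have hCp : C ∈ piece cs s t v :=
        mem_piece_of_mem hM hs hsC htC (one_mem _) (by rwa [mul_one])
      refine ⟨_, ⟨s, hs, v, rfl, C, hCp, hC⟩, ?_⟩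
      rw [realization_eq_inter_of_comparable (hsub hCp hC) (hcomp hs)]
      exact ⟨hf, Set.mem_biUnion hCp (lt_of_le_of_ne (hf.1 C) hfC.symm)⟩
  · rintro _ ⟨s, hs, v, rfl, -⟩ _ ⟨s', hs', v', rfl, -⟩ hXY
    refine Set.disjoint_left.2 fun f hf hf' => hXY ?_
    obtain ⟨C, hC, hfC, -⟩ := exists_min_of_mem_realization hf
    have hC' := (mem_realization_chainComplex_iff.1 hf').2 hfC
    have hss : s' = s :=
      eq_of_mem_bigSet hM hs (isSpherical_cosetType hM C) hC.1 hC.2.1 hC'.1 hs'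
    subst hss
    rw [subset_antisymm (piece_subset_piece hM hC' hC) (piece_subset_piece hM hC hC')]
  · rintro _ ⟨s, hs, v, rfl, C, hC, hCQ⟩
    have hcopy := isDavisCopy_piece hM hflag hs v
    obtain ⟨h1, h2, h3⟩ := isManifold_of_isDavisCopy hM hflag hsphere hs hcopy
    have := countable_sphericalCoset cs
    exact ⟨⟨_, isOpen_biUnion fun C _ => isOpen_lt continuous_const (continuous_apply C),
      realization_eq_inter_of_comparable (hsub hC hCQ) (hcomp hs)⟩, ⟨s, hs, hcopy⟩, h1,
      inferInstance, inferInstance, h2, h3⟩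

end Main

end Davis

end

theorem mainTheorem7 {S W : Type*} [Finite S] [Group W] {M : CoxeterMatrix S}
    (cs : CoxeterSystem M W) (hM : Davis.IsEvenMatrix M) (n : ℕ)
    (hflag : (Davis.nerve cs.simple).IsFlag)
    (hsphere : (Davis.nerve cs.simple).IsSphereTriangulation n) (t : S) :
    (∀ c c' : Davis.Color cs t,
      Davis.IsEvenColor cs hM t c → Davis.IsEvenColor cs hM t c' → c ≠ c' →
      Davis.IsDisjointUnionOfDavisManifolds cs t n
        (Davis.collarSpace cs hM t c ∩ Davis.collarSpace cs hM t c')) ∧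
    (∀ (k : ℕ) (c : Fin k → Davis.Color cs t) (ce : Davis.Color cs t),
      (∀ j, Davis.IsEvenColor cs hM t (c j)) → Davis.IsEvenColor cs hM t ce →
      (∀ j, c j ≠ ce) →
      Davis.IsDisjointUnionOfDavisManifolds cs t n
        (Davis.collarSpace cs hM t ce ∩ ⋃ j, Davis.collarSpace cs hM t (c j))) := by
  refine ⟨fun c c' hc hc' hne => ?_, fun k c ce hc hce hne =>
    Davis.isDisjointUnion_collarSpace_inter_iUnion hM hflag hsphere hc hce hne⟩
  -- Two collars are the case of a union indexed by one element.
  have := Davis.isDisjointUnion_collarSpace_inter_iUnion hM hflag hsphere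
    (c := fun _ : Unit => c') (fun _ => hc') hc (fun _ => hne.symm)
  rwa [Set.iUnion_const] at this
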